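/- **Setting.** All functions are complex-valued. Let $\Omega=(0,\pi)\times(-1,0)$, $H=L^2[0,\pi]$, and for $\mu>0$ let $\Delta_\mu=\mu\,\partial_x^2+\partial_y^2$. * *Dirichlet to Neumann map $A_\mu$.* If $f\in C^2(\overline\Omega)$ satisfies $\Delta_\mu f=0$ in $\Omega$, $f(x,0)=\eta(x)$, $\partial_y f(x,-1)=0$ for $x\in(0,\pi)$ and $\partial_x f(0,y)=\partial_x f(\pi,y)=0$ for $y\in(-1,0)$, put $A_\mu\eta=\partial_y f(\cdot,0)$. $A_\mu$ denotes the closure in $H$ of this operator; it is a non-negative self-adjoint operator with domain $W^{1,2}[0,\pi]$. * *Neumann to Neumann map $B_\mu$.* If $f\in C^2(\overline\Omega)$ satisfies $\Delta_\mu f=0$ in $\Omega$, $f(x,0)=0$, $\partial_y f(x,-1)=0$ for $x\in(0,\pi)$ and $\partial_x f(0,y)=-v(y)$, $\partial_x f(\pi,y)=0$ for $y\in(-1,0)$, put $B_\mu v=\partial_y f(\cdot,0)$. $B_\mu$ denotes the bounded extension of this operator from $L^2[-1,0]$ to $H$. For $c\in\mathbb C$, $B_\mu c$ is $B_\mu$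 applied to the constant function $c$. * *Sobolev norms.* $W^{1,2}[0,\pi]$ is the space of $\eta\in L^2[0,\pi]$ with distributional derivative in $L^2[0,\pi]$. With $\varphi_0=1/\sqrt\pi$, $\varphi_k(x)=\sqrt{2/\pi}\cos(kx)$ $(k\ge1)$, the space $W^{1/2,2}[0,\pi]$ is defined by interpolation, with norm $\|\eta\|_{W^{1/2,2}}^2=\sum_{k\ge0}(1+k^2)^{1/2}|\langle\eta,\varphi_k\rangle|^2$. **Theorem.** Let $u\in L^2_{loc}[0,\infty)$, $\zeta_0\in W^{1,2}[0,\pi]$ and $\zeta_1\in L^2[0,\pi]$. For every $\mu>0$, the dimensionless linearized water waves system in $\Omega$, with velocity potential $\phi_\mu$ and surface elevation $\zeta_\mu$, $$\Delta_\mu\phi_\mu=0 \text{ in }\Omega,\quad \partial_t\zeta_\mu=\tfrac1\mu\,\partial_y\phi_\mu(t,x,0),\quad \partial_t\phi_\mu(t,x,0)=-\zeta_\mu,$$ $$\partial_x\phi_\mu(t,0,y)=-v(t),\quad \partial_y\phi_\mu(t,x,-1)=0=\partial_x\phi_\mu(t,\pi,y),\qquad u=\tfrac{dv}{dt},$$ has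 as its free surface equation $$\partial_t^2\zeta_\mu+\tfrac1\mu A_\mu\zeta_\mu=\tfrac1\mu B_\mu u(t),\qquad \zeta_\mu(0)=\zeta_0,\quad \partial_t\zeta_\mu(0)=\zeta_1 .$$ This problem has a unique solution $\zeta_\mu\in C([0,\infty);W^{1/2,2}[0,\pi])\cap C^1([0,\infty);L^2[0,\pi])$, in the sense that $\zeta_\mu(0)=\zeta_0$, $\partial_t\zeta_\mu(0)=\zeta_1$ and, for all $t\ge0$ and all $\psi$ in the domain of $A_\mu$, $$\langle\partial_t\zeta_\mu(t),\psi\rangle-\langle\zeta_1,\psi\rangle=-\tfrac1\mu\int_0^t\langle\zeta_\mu(\sigma),A_\mu\psi\rangle\,d\sigma+\tfrac1\mu\int_0^t\langle B_\mu u(\sigma),\psi\rangle\,d\sigma .$$ The wave equation with Neumann boundary control $$\partial_t^2\zeta-\partial_x^2\zeta=0,\quad \partial_x\zeta(t,0)=u(t),\quad \partial_x\zeta(t,\pi)=0,\quad \zeta(0)=\zeta_0,\quad \partial_t\zeta(0)=\zeta_1$$ has a unique weak solution $\zeta\in C([0,\infty);W^{1,2}[0,\pi])\cap C^1([0,\infty);L^2[0,\pi])$,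 that is, $\zeta(0)=\zeta_0$, $\partial_t\zeta(0)=\zeta_1$ and, for all $t\ge0$ and all $\psi\in W^{1,2}[0,\pi]$, $$\langle\partial_t\zeta(t),\psi\rangle-\langle\zeta_1,\psi\rangle=-\int_0^t\langle\partial_x\zeta(\sigma),\psi'\rangle\,d\sigma-\int_0^t u(\sigma)\,\overline{\psi(0)}\,d\sigma .$$ Moreover, for every $\tau>0$, $$\lim_{\mu\to0^+}\ \sup_{t\in[0,\tau]}\|\zeta_\mu(t)-\zeta(t)\|_{W^{1/2,2}[0,\pi]}=0,\qquad \lim_{\mu\to0^+}\ \sup_{t\in[0,\tau]}\|\partial_t\zeta_\mu(t)-\partial_t\zeta(t)\|_{L^2[0,\pi]}=0 .$$ -/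

import Mathlib

open MeasureTheory Set Filter Topology
open scoped ENNReal ContDiff ComplexConjugate

namespace WaterWaves

noncomputable section

/-- `H = L²[0, π]` (complex-valued). -/
abbrev H : Type := Lp ℂ 2 (volume.restrict (Ioo (0 : ℝ) Real.pi))

/-- `L²[-1, 0]`, functions of the vertical variable along a lateral wall. -/
abbrev V : Type := Lp ℂ 2 (volume.restrict (Ioo (-1 : ℝ) 0))

/-! ### Sobolev spaces on `(0, π)` -/

/-- `dη ∈ L²(0, π)` is the distributional derivative of `η` on `(0, π)`; hence
`η ∈ W^{1,2}[0, π]` iff `∃ dη, HasWeakDeriv η dη`. -/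
def HasWeakDeriv (η dη : H) : Prop :=
  ∀ χ : ℝ → ℝ, ContDiff ℝ ∞ χ → HasCompactSupport χ → tsupport χ ⊆ Ioo 0 Real.pi →
    ∫ x in Ioo 0 Real.pi, ((deriv χ x : ℝ) : ℂ) * η x
      = -∫ x in Ioo 0 Real.pi, ((χ x : ℝ) : ℂ) * dη x

/-- Membership in `W^{1,2}[0, π]`. -/
def MemW12 (η : H) : Prop := ∃ dη : H, HasWeakDeriv η dη

/-- `η` has a representative that is continuous on `[0, π]` and takes the value `c` at `0`
(every element of `W^{1,2}[0, π]` has exactly one such value). -/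
def HasValueAtZero (η : H) (c : ℂ) : Prop :=
  ∃ p : ℝ → ℂ, ContinuousOn p (Icc 0 Real.pi) ∧
    (η : ℝ → ℂ) =ᵐ[volume.restrict (Ioo 0 Real.pi)] p ∧ p 0 = c

/-- The orthonormal cosine basis `φ₀ = 1/√π`, `φ_k(x) = √(2/π) cos (k x)` of `L²[0, π]`:
the eigenfunctions of the Neumann Laplacian `-d²/dx²`, with eigenvalues `k²`. -/
def cosMode (k : ℕ) (x : ℝ) : ℝ :=
  if k = 0 then 1 / √Real.pi else √(2 / Real.pi) * Real.cos (k * x)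

/-- The Fourier coefficient `⟨η, φ_k⟩`. -/
def cosCoeff (η : H) (k : ℕ) : ℂ :=
  ∫ x in Ioo 0 Real.pi, η x * ((cosMode k x : ℝ) : ℂ)

/-- The norm of `W^{s,2}[0, π]` for `0 ≤ s ≤ 1` (equal to `∞` outside this space). It is defined
by interpolation via fractional powers: it is the norm `‖Λ^s η‖` of the domain of `Λ^s`, where
`Λ = (1 - d²/dx²)^{1/2}` (with Neumann conditions) is the positive self-adjoint operator on
`L²[0, π]` with domain `W^{1,2}[0, π]` and `‖Λ η‖ = ‖η‖_{W^{1,2}}`; the eigenvalues of `Λ` are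
`(1 + k²)^{1/2}`. -/
def sobolevENorm (s : ℝ) (η : H) : ℝ≥0∞ :=
  (∑' k : ℕ, ENNReal.ofReal ((1 + (k : ℝ) ^ 2) ^ s * ‖cosCoeff η k‖ ^ 2)) ^ (1 / 2 : ℝ)

/-- `z ∈ C([0, ∞); W^{s,2}[0, π])`. -/
def ContinuousInSobolev (s : ℝ) (z : ℝ → H) : Prop :=
  ∀ t ∈ Ici (0 : ℝ), sobolevENorm s (z t) < ⊤ ∧
    Tendsto (fun r => sobolevENorm s (z r - z t)) (𝓝[Ici 0] t) (𝓝 0)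

/-! ### The Dirichlet to Neumann and Neumann to Neumann maps of `Ω = (0, π) × (-1, 0)` -/

/-- `f ∈ C²(Ω̄)` (a restriction of a `C²` function on the plane), `Δ_μ f = 0` in `Ω` with
`Δ_μ = μ ∂²/∂x² + ∂²/∂y²`, and `f` satisfies homogeneous Neumann conditions on the bottom
`y = -1` and on the right wall `x = π`. -/
structure IsPotential (μ : ℝ) (f : ℝ → ℝ → ℂ) : Prop where
  contDiff : ContDiff ℝ 2 (fun p : ℝ × ℝ => f p.1 p.2)
  laplace : ∀ x ∈ Ioo 0 Real.pi, ∀ y ∈ Ioo (-1 : ℝ) 0,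
    (μ : ℂ) * iteratedDeriv 2 (fun x' => f x' y) x + iteratedDeriv 2 (f x) y = 0
  bottom : ∀ x ∈ Ioo 0 Real.pi, deriv (f x) (-1) = 0
  right : ∀ y ∈ Ioo (-1 : ℝ) 0, deriv (fun x' => f x' y) Real.pi = 0

/-- `f = D_μ η` (Dirichlet map) in the classical sense: `f(x, 0) = η(x)` on the top, and
`∂f/∂x = 0` on the left wall. -/
structure IsDirichletSolution (μ : ℝ) (η : ℝ → ℂ) (f : ℝ → ℝ → ℂ) : Prop
    extends IsPotential μ f where
  top : ∀ x ∈ Ioo 0 Real.pi, f x 0 = η x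
  left : ∀ y ∈ Ioo (-1 : ℝ) 0, deriv (fun x' => f x' y) 0 = 0

/-- `f = N_μ v` (Neumann map) in the classical sense: `f(x, 0) = 0` on the top, and
`∂f/∂x(0, y) = -v(y)` on the left wall. -/
structure IsNeumannSolution (μ : ℝ) (v : ℝ → ℂ) (f : ℝ → ℝ → ℂ) : Prop
    extends IsPotential μ f where
  top : ∀ x ∈ Ioo 0 Real.pi, f x 0 = 0
  left : ∀ y ∈ Ioo (-1 : ℝ) 0, deriv (fun x' => f x' y) 0 = -v y

/-- The graph, in `L²[0, π] × L²[0, π]`, of the Dirichlet to Neumann map `A_μ`: the closure of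
the graph of the classical map `η ↦ ∂(D_μ η)/∂y (·, 0)`. -/
def dirichletToNeumann (μ : ℝ) : Set (H × H) :=
  closure {p | ∃ (η : ℝ → ℂ) (f : ℝ → ℝ → ℂ), IsDirichletSolution μ η f ∧
    (p.1 : ℝ → ℂ) =ᵐ[volume.restrict (Ioo 0 Real.pi)] η ∧
    (p.2 : ℝ → ℂ) =ᵐ[volume.restrict (Ioo 0 Real.pi)] fun x => deriv (f x) 0}

/-- The graph, in `L²[-1, 0] × L²[0, π]`, of the Neumann to Neumann map `B_μ`: the closure of
the graph of the classical map `v ↦ ∂(N_μ v)/∂y (·, 0)`. -/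
def neumannToNeumann (μ : ℝ) : Set (V × H) :=
  closure {p | ∃ (v : ℝ → ℂ) (f : ℝ → ℝ → ℂ), IsNeumannSolution μ v f ∧
    (p.1 : ℝ → ℂ) =ᵐ[volume.restrict (Ioo (-1) 0)] v ∧
    (p.2 : ℝ → ℂ) =ᵐ[volume.restrict (Ioo 0 Real.pi)] fun x => deriv (f x) 0}

/-- The profile `h = 1` of the wave maker, as an element of `L²[-1, 0]`. -/
def profile : V := (memLp_const (1 : ℂ)).toLp (fun _ : ℝ => (1 : ℂ))

/-! ### The two evolution problems -/

/-- The time derivative on `[0, ∞)` (one-sided at `0`). -/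
def timeDeriv (z : ℝ → H) (t : ℝ) : H := derivWithin z (Ici 0) t

/-- `u ∈ L²_loc[0, ∞)`. -/
def MemL2Loc (u : ℝ → ℂ) : Prop :=
  ∀ τ : ℝ, 0 < τ → MemLp u 2 (volume.restrict (Ioc 0 τ))

/-- `z` is the solution, in `C([0, ∞); W^{1/2,2}[0, π]) ∩ C¹([0, ∞); L²[0, π])`, of the free
surface equations of the water waves system
`∂²z/∂t² + (1/μ) A_μ z = (1/μ) B_μ u`, `z(0) = ζ₀`, `∂z/∂t(0) = ζ₁`;
here `b = B_μ 1`, and the equation is integrated in time and tested against every `ψ` in the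
domain of the self-adjoint operator `A_μ`, with `g = A_μ ψ`. The Mathlib inner product is
conjugate-linear in the first variable. -/
structure IsWaterWave (μ : ℝ) (u : ℝ → ℂ) (ζ₀ ζ₁ : H) (z : ℝ → H) : Prop where
  continuous_half : ContinuousInSobolev (1 / 2) z
  contDiffOn : ContDiffOn ℝ 1 z (Ici 0)
  init : z 0 = ζ₀
  init_deriv : timeDeriv z 0 = ζ₁
  eqn : ∃ b : H, (profile, b) ∈ neumannToNeumann μ ∧
    ∀ p ∈ dirichletToNeumann μ, ∀ t : ℝ, 0 ≤ t →
      inner ℂ p.1 (timeDeriv z t) - inner ℂ p.1 ζ₁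
        = -(1 / (μ : ℂ)) * (∫ σ in (0 : ℝ)..t, inner ℂ p.2 (z σ))
          + (1 / (μ : ℂ)) * (∫ σ in (0 : ℝ)..t, u σ * inner ℂ p.1 b)

/-- `z` is the weak solution, in `C([0, ∞); W^{1,2}[0, π]) ∩ C¹([0, ∞); L²[0, π])`, of the wave
equation `∂²z/∂t² = ∂²z/∂x²` with `∂z/∂x(t, 0) = u(t)`, `∂z/∂x(t, π) = 0`, `z(0) = ζ₀`,
`∂z/∂t(0) = ζ₁`; here `zx = ∂z/∂x` and the test functions `ψ` range over `W^{1,2}[0, π]`, with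
`dψ = ψ'` and `c = ψ(0)`. -/
structure IsWave (u : ℝ → ℂ) (ζ₀ ζ₁ : H) (z : ℝ → H) : Prop where
  contDiffOn : ContDiffOn ℝ 1 z (Ici 0)
  init : z 0 = ζ₀
  init_deriv : timeDeriv z 0 = ζ₁
  eqn : ∃ zx : ℝ → H, ContinuousOn zx (Ici 0) ∧ (∀ t : ℝ, 0 ≤ t → HasWeakDeriv (z t) (zx t)) ∧
    ∀ (ψ dψ : H) (c : ℂ), HasWeakDeriv ψ dψ → HasValueAtZero ψ c → ∀ t : ℝ, 0 ≤ t →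
      inner ℂ ψ (timeDeriv z t) - inner ℂ ψ ζ₁
        = -(∫ σ in (0 : ℝ)..t, inner ℂ dψ (zx σ)) - ∫ σ in (0 : ℝ)..t, u σ * conj c

end

end WaterWaves

namespace WaterWaves

/-! ### The cosine basis of `L²[0, π]`. -/

noncomputable section

/-! Put `μ = h²`. Every operator in the problem is diagonal in the Neumann cosine basis. Green's
identity against `cos (k x) cosh (h k (y + 1))` shows that `(1/μ) A_μ` has eigenvalues `freq h k ^ 2
= k² tanhc (h k)`, where `tanhc a = tanh a / a`, and that `(1/μ) B_μ 1` has coefficients `-amp k *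
tanhc (h k)`. Both evolution problems thus become one family of forced oscillators, `y'' + freq² y =
-amp k * tanhc (h k) * u`, and the wave equation is its member `h = 0`. Since `u` is only locally
square integrable, the oscillators are solved and their uniqueness proved in integrated form, with
the primitive of `u` (`oscVel_sub`, `eq_oscPos_of_hasDerivWithinAt`).

The limit `μ → 0` is then continuity of the solution in `(h, t)` at `h = 0`, made uniform in time by
compactness of `[0, τ]`. Each coefficient is jointly continuous, so what is needed is smallness of
the `ℓ²` tails, uniform in the parameters (`UniformTails.tendsto_synth`). The terms coming from the
initial data are dominated by fixed `ℓ²` sequences, because `freq h k ≤ k` and `ζ₀` lies in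
`W^{1,2}`.

The control term is the difficulty: one has to bound `∑ |tanhc (h k) ∫ e^{± i freq s} u|²` by
`‖u‖²`, uniformly in `h`. For `h > 0` the frequencies grow only like `√k` and are not uniformly
separated, but the weights `tanhc` make up for the shrinking gaps (`tanhc_mul_tanhc_le`). A large
sieve inequality, obtained from the majorant `e^{-|s|}` and a Schur test, gives the bound
(`sum_norm_sq_integral_exp_le`). Approximating `u` by smooth functions, for which one integration by
parts suffices, turns this bound into uniform tails (`uniformTails_exp`). The norm of `W^{1/2,2}` is
admissible because `√(1 + k²)` is at most a constant times `freq h k ^ 2` for `k ≥ 1`, locally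
uniformly in `h`.

Two points remain. The constant profile is not classical data for the Neumann problem, so `B_μ 1` is
reached by approximation. The weak form of the wave equation requires a dictionary between
distributional derivatives, boundary values and cosine series. -/

lemma memLp_of_continuous {g : ℝ → ℂ} (hg : Continuous g) (a b : ℝ) :
    MemLp g 2 (volume.restrict (Ioo a b)) := by
  obtain ⟨C, hC⟩ := (isCompact_Icc (a := a) (b := b)).exists_bound_of_continuousOn hg.continuousOn
  refine MemLp.of_bound hg.aestronglyMeasurable C ?_
  filter_upwards [ae_restrict_mem measurableSet_Ioo] with x hx using hC x (Ioo_subset_Icc_self hx)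

/-- The element of `L²[0, π]` represented by a continuous function. -/
def ofCont (g : ℝ → ℂ) (hg : Continuous g) : H := (memLp_of_continuous hg 0 Real.pi).toLp g

lemma coeFn_ofCont (g : ℝ → ℂ) (hg : Continuous g) :
    (ofCont g hg : ℝ → ℂ) =ᵐ[volume.restrict (Ioo 0 Real.pi)] g := MemLp.coeFn_toLp _

lemma inner_ofCont_left (g : ℝ → ℂ) (hg : Continuous g) (η : H) :
    inner ℂ (ofCont g hg) η = ∫ x in Ioo 0 Real.pi, η x * conj (g x) := by
  rw [L2.inner_def]
  refine integral_congr_ae ?_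
  filter_upwards [coeFn_ofCont g hg] with x hx
  rw [hx]; rfl

lemma continuous_cosMode (k : ℕ) : Continuous (cosMode k) := by
  unfold cosMode
  split_ifs <;> fun_prop

/-- The Dirichlet sine modes. -/
def sinMode (k : ℕ) (x : ℝ) : ℝ := √(2 / Real.pi) * Real.sin (k * x)

lemma continuous_sinMode (k : ℕ) : Continuous (sinMode k) := by
  unfold sinMode; fun_prop

def cosVec (k : ℕ) : H :=
  ofCont (fun x => (cosMode k x : ℂ)) (Complex.continuous_ofReal.comp (continuous_cosMode k))

def sinVec (k : ℕ) : H :=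
  ofCont (fun x => (sinMode k x : ℂ)) (Complex.continuous_ofReal.comp (continuous_sinMode k))

lemma inner_cosVec (η : H) (k : ℕ) : inner ℂ (cosVec k) η = cosCoeff η k := by
  simp [cosVec, inner_ofCont_left, cosCoeff]

lemma inner_ofCont_ofCont {f g : ℝ → ℝ} (hf : Continuous f) (hg : Continuous g) :
    inner ℂ (ofCont (fun x => (f x : ℂ)) (Complex.continuous_ofReal.comp hf))
      (ofCont (fun x => (g x : ℂ)) (Complex.continuous_ofReal.comp hg))
      = ((∫ x in (0 : ℝ)..Real.pi, f x * g x : ℝ) : ℂ) := by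
  rw [inner_ofCont_left, intervalIntegral.integral_of_le Real.pi_pos.le, integral_Ioc_eq_integral_Ioo,
    ← integral_complex_ofReal]
  refine integral_congr_ae ?_
  filter_upwards [coeFn_ofCont _ (Complex.continuous_ofReal.comp hg)] with x hx
  have hx' : (ofCont (fun x => (g x : ℂ)) (Complex.continuous_ofReal.comp hg)) x = (g x : ℂ) := hx
  rw [hx']; simp [mul_comm]

lemma integral_cos_int_mul (n : ℤ) :
    ∫ x in (0 : ℝ)..Real.pi, Real.cos (n * x) = if n = 0 then Real.pi else 0 := by
  split_ifs with h
  · simp [h]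
  · have h' : (n : ℝ) ≠ 0 := by exact_mod_cast h
    rw [intervalIntegral.integral_comp_mul_left _ h', integral_cos]
    simp [Real.sin_int_mul_pi]

lemma integral_cos_mul_cos (j k : ℕ) : ∫ x in (0 : ℝ)..Real.pi, Real.cos (j * x) * Real.cos (k * x)
    = ((if (j : ℤ) - k = 0 then Real.pi else 0) + (if (j : ℤ) + k = 0 then Real.pi else 0)) / 2 := by
  rw [← integral_cos_int_mul, ← integral_cos_int_mul, ← intervalIntegral.integral_add
    (Continuous.intervalIntegrable (by fun_prop) _ _)
    (Continuous.intervalIntegrable (by fun_prop) _ _), ← intervalIntegral.integral_div]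
  refine intervalIntegral.integral_congr fun x _ => ?_
  push_cast
  rw [sub_mul, add_mul, Real.cos_sub, Real.cos_add]
  ring

lemma integral_sin_mul_sin (j k : ℕ) : ∫ x in (0 : ℝ)..Real.pi, Real.sin (j * x) * Real.sin (k * x)
    = ((if (j : ℤ) - k = 0 then Real.pi else 0) - (if (j : ℤ) + k = 0 then Real.pi else 0)) / 2 := by
  rw [← integral_cos_int_mul, ← integral_cos_int_mul, ← intervalIntegral.integral_sub
    (Continuous.intervalIntegrable (by fun_prop) _ _)
    (Continuous.intervalIntegrable (by fun_prop) _ _), ← intervalIntegral.integral_div]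
  refine intervalIntegral.integral_congr fun x _ => ?_
  push_cast
  rw [sub_mul, add_mul, Real.cos_sub, Real.cos_add]
  ring

/-- The amplitude of the `k`-th cosine mode; equivalently its value at `0`. -/
def amp (k : ℕ) : ℝ := if k = 0 then 1 / √Real.pi else √(2 / Real.pi)

lemma cosMode_eq (k : ℕ) (x : ℝ) : cosMode k x = amp k * Real.cos (k * x) := by
  unfold cosMode amp
  split_ifs with h <;> simp [h]

lemma amp_pos (k : ℕ) : 0 < amp k := by
  unfold amp; split_ifs <;> positivity

lemma amp_le_one (k : ℕ) : amp k ≤ 1 := by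
  unfold amp
  split_ifs
  · rw [div_le_one (by positivity)]
    exact Real.one_le_sqrt.2 (by linarith [Real.pi_gt_three])
  · exact Real.sqrt_le_one.2 ((div_le_one Real.pi_pos).2 (by linarith [Real.pi_gt_three]))

lemma orthonormal_cosVec : Orthonormal ℂ cosVec := by
  rw [orthonormal_iff_ite]
  intro j k
  have hpi : (0 : ℝ) < Real.pi := Real.pi_pos
  rw [cosVec, cosVec, inner_ofCont_ofCont (continuous_cosMode j) (continuous_cosMode k)]
  have h : ∀ x, cosMode j x * cosMode k x
      = amp j * amp k * (Real.cos (j * x) * Real.cos (k * x)) := fun x => by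
    rw [cosMode_eq, cosMode_eq]; ring
  simp_rw [h]
  rw [intervalIntegral.integral_const_mul, integral_cos_mul_cos]
  by_cases hjk : j = k
  · subst hjk
    by_cases hj : j = 0
    · subst hj
      simp only [amp, if_true]
      norm_cast
      simp
      field_simp
      exact (Real.sq_sqrt hpi.le).symm
    · have : ¬ ((j : ℤ) + j = 0) := by omega
      simp only [amp, hj, this, if_false, if_true, sub_self]
      norm_cast
      rw [Real.mul_self_sqrt (by positivity)]
      field_simp
      simp
  · have h1 : ¬ ((j : ℤ) - k = 0) := by omega
    have h2 : ¬ ((j : ℤ) + k = 0) := by omega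
    simp [h1, h2, hjk]

lemma orthonormal_sinVec : Orthonormal ℂ (fun k : ℕ => sinVec (k + 1)) := by
  rw [orthonormal_iff_ite]
  intro j k
  have hpi : (0 : ℝ) < Real.pi := Real.pi_pos
  rw [sinVec, sinVec, inner_ofCont_ofCont (continuous_sinMode _) (continuous_sinMode _)]
  have h : ∀ x, sinMode (j + 1) x * sinMode (k + 1) x
      = 2 / Real.pi * (Real.sin ((j + 1 : ℕ) * x) * Real.sin ((k + 1 : ℕ) * x)) := fun x => by
    rw [sinMode, sinMode, mul_mul_mul_comm, Real.mul_self_sqrt (by positivity)]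
  simp_rw [h]
  rw [intervalIntegral.integral_const_mul, integral_sin_mul_sin]
  have h2 : ¬ (((j + 1 : ℕ) : ℤ) + (k + 1 : ℕ) = 0) := by omega
  by_cases hjk : j = k
  · subst hjk
    simp only [h2, if_false, sub_self, if_true]
    norm_cast
    field_simp
    simp
  · have h1 : ¬ (((j + 1 : ℕ) : ℤ) - (k + 1 : ℕ) = 0) := by omega
    simp only [h1, h2, hjk, if_false]
    simp

lemma integrable_coeFn (η : H) : Integrable η (volume.restrict (Ioo 0 Real.pi)) :=
  (Lp.memLp η).integrable one_le_two

lemma integrable_mul_of_continuous (η : H) {g : ℝ → ℂ} (hg : Continuous g) :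
    Integrable (fun x => η x * g x) (volume.restrict (Ioo 0 Real.pi)) :=
  (Lp.memLp η).integrable_mul (memLp_of_continuous hg 0 Real.pi)

/-- The identity `2 cos x cos ((k+1) x) = cos ((k+2) x) + cos (k x)` lowers the power of `cos x`, so
induction on the power, for all `k` at once, reduces to the coefficients themselves. -/
lemma integral_mul_polynomial_cos_eq_zero {η : H} (h : ∀ k, cosCoeff η k = 0) (p : Polynomial ℝ) :
    ∫ x in Ioo 0 Real.pi, η x * ((p.eval (Real.cos x) : ℝ) : ℂ) = 0 := by
  have hcos : ∀ k : ℕ, ∫ x in Ioo 0 Real.pi, η x * ((Real.cos (k * x) : ℝ) : ℂ) = 0 := fun k => by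
    have := h k
    simp only [cosCoeff, cosMode_eq] at this
    have h2 : ∫ x in Ioo 0 Real.pi, η x * ((amp k * Real.cos (k * x) : ℝ) : ℂ)
      = amp k * ∫ x in Ioo 0 Real.pi, η x * ((Real.cos (k * x) : ℝ) : ℂ) := by
      rw [← integral_const_mul]
      congr 1; ext x; push_cast; ring
    rw [h2] at this
    exact (mul_eq_zero.1 this).resolve_left (by exact_mod_cast (amp_pos k).ne')
  have hpow : ∀ n : ℕ, ∀ k : ℕ,
      ∫ x in Ioo 0 Real.pi, η x * ((Real.cos x ^ n * Real.cos (k * x) : ℝ) : ℂ) = 0 := by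
    intro n
    induction n with
    | zero => intro k; simpa using hcos k
    | succ n ih =>
      have key : ∀ k : ℕ, ∫ x in Ioo 0 Real.pi,
          η x * ((Real.cos x ^ (n + 1) * Real.cos ((k + 1 : ℕ) * x) : ℝ) : ℂ) = 0 := fun k => by
        have : ∀ x : ℝ, η x * ((Real.cos x ^ (n + 1) * Real.cos ((k + 1 : ℕ) * x) : ℝ) : ℂ)
            = η x * ((Real.cos x ^ n * Real.cos ((k + 2 : ℕ) * x) : ℝ) : ℂ) * (1 / 2)
            + η x * ((Real.cos x ^ n * Real.cos (k * x) : ℝ) : ℂ) * (1 / 2) := fun x => by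
          have e1 : ((k + 2 : ℕ) : ℝ) * x = ((k + 1 : ℕ) : ℝ) * x + x := by push_cast; ring
          have e2 : (k : ℝ) * x = ((k + 1 : ℕ) : ℝ) * x - x := by push_cast; ring
          rw [e1, e2, Real.cos_add, Real.cos_sub]
          push_cast; ring
        simp_rw [this]
        rw [integral_add, integral_mul_const, integral_mul_const, ih, ih]
        · simp
        · exact (integrable_mul_of_continuous η (g := fun x => ((Real.cos x ^ n * Real.cos ((k + 2 : ℕ) * x) : ℝ) : ℂ)) (by fun_prop)).mul_const _
        · exact (integrable_mul_of_continuous η (g := fun x => ((Real.cos x ^ n * Real.cos (k * x) : ℝ) : ℂ)) (by fun_prop)).mul_const _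
      intro k
      cases k with
      | zero =>
        have := ih 1
        simpa [pow_succ] using this
      | succ k => exact key k
  induction p using Polynomial.induction_on' with
  | add p q hp hq =>
    have : ∀ x : ℝ, η x * (((p + q).eval (Real.cos x) : ℝ) : ℂ)
        = η x * ((p.eval (Real.cos x) : ℝ) : ℂ) + η x * ((q.eval (Real.cos x) : ℝ) : ℂ) := fun x => by
      rw [Polynomial.eval_add]; push_cast; ring
    simp_rw [this]
    rw [integral_add, hp, hq, add_zero]
    · exact integrable_mul_of_continuous η (by fun_prop)
    · exact integrable_mul_of_continuous η (by fun_prop)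
  | monomial n a =>
    have := hpow n 0
    simp only [Nat.cast_zero, zero_mul, Real.cos_zero, mul_one] at this
    have e : ∀ x : ℝ, η x * (((Polynomial.monomial n a).eval (Real.cos x) : ℝ) : ℂ)
        = η x * ((Real.cos x ^ n : ℝ) : ℂ) * a := fun x => by
      rw [Polynomial.eval_monomial]; push_cast; ring
    simp_rw [e]
    rw [integral_mul_const, this, zero_mul]

/-- Completeness of the cosines: `x ↦ cos x` is injective on `[0, π]`, so Weierstrass approximation
of `g ∘ arccos` on `[-1, 1]` approximates any continuous `g` uniformly by polynomials in `cos x`. -/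
lemma eq_zero_of_cosCoeff_eq_zero {η : H} (h : ∀ k, cosCoeff η k = 0) : η = 0 := by
  have hint := integrable_coeFn η
  have hcont : ∀ g : ℝ → ℝ, Continuous g →
      ∫ x in Ioo 0 Real.pi, η x * ((g x : ℝ) : ℂ) = 0 := by
    intro g hg
    set I := ∫ x in Ioo 0 Real.pi, ‖η x‖ with hI
    have hI0 : 0 ≤ I := integral_nonneg fun _ => norm_nonneg _
    rw [← norm_le_zero_iff]
    refine le_of_forall_pos_le_add fun ε hε => ?_
    obtain ⟨p, hp⟩ := exists_polynomial_near_of_continuousOn (-1) 1 (fun c => g (Real.arccos c))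
      (hg.comp Real.continuous_arccos).continuousOn (ε / (I + 1)) (by positivity)
    have hsub : ∫ x in Ioo 0 Real.pi, η x * ((g x : ℝ) : ℂ)
        = ∫ x in Ioo 0 Real.pi, η x * ((g x - p.eval (Real.cos x) : ℝ) : ℂ) := by
      have e : ∀ x : ℝ, η x * ((g x - p.eval (Real.cos x) : ℝ) : ℂ)
        = η x * ((g x : ℝ) : ℂ) - η x * ((p.eval (Real.cos x) : ℝ) : ℂ) := fun x => by
          push_cast; ring
      simp_rw [e]
      rw [integral_sub, integral_mul_polynomial_cos_eq_zero h, sub_zero]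
      · exact integrable_mul_of_continuous η (by fun_prop)
      · exact integrable_mul_of_continuous η (by fun_prop)
    rw [hsub, zero_add]
    calc _ ≤ ∫ x in Ioo 0 Real.pi, ‖η x‖ * (ε / (I + 1)) := by
          refine norm_integral_le_of_norm_le (hint.norm.mul_const _) ?_
          filter_upwards [ae_restrict_mem measurableSet_Ioo] with x hx
          rw [norm_mul, Complex.norm_real, Real.norm_eq_abs, abs_sub_comm]
          have := hp (Real.cos x) ⟨Real.neg_one_le_cos x, Real.cos_le_one x⟩
          rw [Real.arccos_cos hx.1.le hx.2.le] at this
          exact mul_le_mul_of_nonneg_left this.le (norm_nonneg _)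
      _ = I * (ε / (I + 1)) := by rw [integral_mul_const]
      _ ≤ ε := by
          rw [← mul_div_assoc, div_le_iff₀ (by positivity)]
          nlinarith
  have h0 := isOpen_Ioo.ae_eq_zero_of_integral_contDiff_smul_eq_zero (U := Ioo 0 Real.pi)
    (f := (η : ℝ → ℂ)) (μ := volume.restrict (Ioo 0 Real.pi))
    (hint.locallyIntegrable.locallyIntegrableOn _)
    (fun g hg _ _ => by
      rw [← hcont g hg.continuous]
      congr 1; ext x; rw [Complex.real_smul, mul_comm])
  rw [Lp.eq_zero_iff_ae_eq_zero]
  filter_upwards [h0, ae_restrict_mem measurableSet_Ioo] with x hx hx' using hx hx'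

/-- The cosine Hilbert basis of `L²[0, π]`. -/
def cosBasis : HilbertBasis ℕ ℂ H :=
  HilbertBasis.mkOfOrthogonalEqBot orthonormal_cosVec (by
    rw [Submodule.eq_bot_iff]
    intro η hη
    refine eq_zero_of_cosCoeff_eq_zero fun k => ?_
    rw [← inner_cosVec]
    exact (Submodule.mem_orthogonal _ _).1 hη _ (Submodule.subset_span ⟨k, rfl⟩))

@[simp] lemma cosBasis_apply (k : ℕ) : cosBasis k = cosVec k := by
  simp [cosBasis]

lemma cosBasis_repr (η : H) (k : ℕ) : cosBasis.repr η k = cosCoeff η k := by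
  rw [HilbertBasis.repr_apply_apply, cosBasis_apply, inner_cosVec]

lemma ext_cosCoeff {η ξ : H} (h : ∀ k, cosCoeff η k = cosCoeff ξ k) : η = ξ := by
  apply cosBasis.repr.injective
  ext k
  rw [cosBasis_repr, cosBasis_repr, h]

lemma hasSum_norm_sq_cosCoeff (η : H) : HasSum (fun k => ‖cosCoeff η k‖ ^ 2) (‖η‖ ^ 2) := by
  have h := cosBasis.hasSum_inner_mul_inner η η
  rw [inner_self_eq_norm_sq_to_K] at h
  have e : ∀ k, inner ℂ η (cosBasis k) * inner ℂ (cosBasis k) η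
      = ((‖cosCoeff η k‖ ^ 2 : ℝ) : ℂ) := fun k => by
    rw [← inner_conj_symm η, cosBasis_apply, inner_cosVec, Complex.conj_mul']
    push_cast; rfl
  simp_rw [e] at h
  rw [← Complex.hasSum_ofReal]
  simpa using h

lemma hasSum_inner_cosCoeff (η ξ : H) :
    HasSum (fun k => conj (cosCoeff η k) * cosCoeff ξ k) (inner ℂ η ξ) := by
  have h := cosBasis.hasSum_inner_mul_inner η ξ
  simpa only [cosBasis_apply, ← inner_conj_symm η, inner_cosVec] using h

lemma cosCoeff_add (η ξ : H) (k : ℕ) : cosCoeff (η + ξ) k = cosCoeff η k + cosCoeff ξ k := by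
  simp only [← inner_cosVec, inner_add_right]

lemma cosCoeff_sub (η ξ : H) (k : ℕ) : cosCoeff (η - ξ) k = cosCoeff η k - cosCoeff ξ k := by
  simp only [← inner_cosVec, inner_sub_right]

lemma continuous_cosCoeff (k : ℕ) : Continuous fun η => cosCoeff η k := by
  simp only [← inner_cosVec]; fun_prop

lemma cosCoeff_cosVec (j k : ℕ) : cosCoeff (cosVec j) k = if k = j then 1 else 0 := by
  rw [← inner_cosVec, orthonormal_iff_ite.1 orthonormal_cosVec]

lemma exists_cosCoeff_eq {f : ℕ → ℂ} (hf : Summable fun k => ‖f k‖ ^ 2) :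
    ∃ η : H, ∀ k, cosCoeff η k = f k := by
  have hm : Memℓp f 2 := memℓp_gen (by simpa using hf)
  exact ⟨cosBasis.repr.symm ⟨f, hm⟩, fun k => by rw [← cosBasis_repr]; simp⟩

/-- The element of `L²[0, π]` with prescribed cosine coefficients (`0` if there is none). -/
def synth (f : ℕ → ℂ) : H :=
  open Classical in if h : ∃ η : H, ∀ k, cosCoeff η k = f k then h.choose else 0

lemma cosCoeff_synth {f : ℕ → ℂ} (hf : Summable fun k => ‖f k‖ ^ 2) (k : ℕ) :
    cosCoeff (synth f) k = f k := by
  rw [synth, dif_pos (exists_cosCoeff_eq hf)]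
  exact (exists_cosCoeff_eq hf).choose_spec k

/-- Taking `w = Λ^s η` turns statements about Sobolev norms into statements about norms in `H`. -/
lemma sobolevENorm_eq {s : ℝ} {η w : H}
    (h : ∀ k, ‖cosCoeff w k‖ ^ 2 = (1 + (k : ℝ) ^ 2) ^ s * ‖cosCoeff η k‖ ^ 2) :
    sobolevENorm s η = ‖w‖ₑ := by
  unfold sobolevENorm
  simp_rw [← h]
  rw [← ENNReal.ofReal_tsum_of_nonneg (fun _ => by positivity) (hasSum_norm_sq_cosCoeff w).summable,
    (hasSum_norm_sq_cosCoeff w).tsum_eq, ENNReal.ofReal_rpow_of_nonneg (by positivity) (by norm_num),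
    ← Real.sqrt_eq_rpow, Real.sqrt_sq (norm_nonneg _), ofReal_norm]

end

/-! ### Uniform `ℓ²` tails and convergence of synthesized series. -/

noncomputable section

/-- The `ℓ²` tails of the sequences `f x` are small uniformly in `x ∈ S`. -/
def UniformTails {X : Type*} (S : Set X) (f : X → ℕ → ℂ) : Prop :=
  ∀ ε > 0, ∃ N, ∀ x ∈ S, ∀ m, ∑ k ∈ Finset.Ico N m, ‖f x k‖ ^ 2 ≤ ε

namespace UniformTails

variable {X : Type*} {S : Set X} {f g : X → ℕ → ℂ}

/-- Domination is asked only for `k ≥ 1`: tails ignore finitely many modes, and the mode `k = 0` has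
frequency `0`, where the later bounds fail. -/
lemma of_norm_le {C : ℝ} (hg : UniformTails S g)
    (h : ∀ x ∈ S, ∀ k, 1 ≤ k → ‖f x k‖ ≤ C * ‖g x k‖) : UniformTails S f := by
  intro ε hε
  -- The added `1` keeps the denominator positive when `C = 0`.
  obtain ⟨N, hN⟩ := hg (ε / (C ^ 2 + 1)) (by positivity)
  refine ⟨max N 1, fun x hx m => ?_⟩
  calc ∑ k ∈ Finset.Ico (max N 1) m, ‖f x k‖ ^ 2
      ≤ ∑ k ∈ Finset.Ico (max N 1) m, (C ^ 2 + 1) * ‖g x k‖ ^ 2 := by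
        refine Finset.sum_le_sum fun k hk => ?_
        have hk1 : 1 ≤ k := le_trans (le_max_right _ _) (Finset.mem_Ico.1 hk).1
        have := pow_le_pow_left₀ (norm_nonneg _) (h x hx k hk1) 2
        nlinarith [sq_nonneg ‖g x k‖]
    _ ≤ ∑ k ∈ Finset.Ico N m, (C ^ 2 + 1) * ‖g x k‖ ^ 2 :=
        Finset.sum_le_sum_of_subset_of_nonneg (Finset.Ico_subset_Ico_left (le_max_left _ _))
          fun _ _ _ => by positivity
    _ ≤ (C ^ 2 + 1) * (ε / (C ^ 2 + 1)) := by
        rw [← Finset.mul_sum]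
        exact mul_le_mul_of_nonneg_left (hN x hx m) (by positivity)
    _ = ε := by field_simp

lemma add (hf : UniformTails S f) (hg : UniformTails S g) :
    UniformTails S (fun x k => f x k + g x k) := by
  intro ε hε
  obtain ⟨N, hN⟩ := hf (ε / 4) (by positivity)
  obtain ⟨M, hM⟩ := hg (ε / 4) (by positivity)
  refine ⟨max N M, fun x hx m => ?_⟩
  calc ∑ k ∈ Finset.Ico (max N M) m, ‖f x k + g x k‖ ^ 2
      ≤ ∑ k ∈ Finset.Ico (max N M) m, (2 * ‖f x k‖ ^ 2 + 2 * ‖g x k‖ ^ 2) := by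
        refine Finset.sum_le_sum fun k hk => ?_
        have := pow_le_pow_left₀ (norm_nonneg _) (norm_add_le (f x k) (g x k)) 2
        nlinarith [sq_nonneg (‖f x k‖ - ‖g x k‖)]
    _ = 2 * ∑ k ∈ Finset.Ico (max N M) m, ‖f x k‖ ^ 2
          + 2 * ∑ k ∈ Finset.Ico (max N M) m, ‖g x k‖ ^ 2 := by
        rw [Finset.sum_add_distrib, Finset.mul_sum, Finset.mul_sum]
    _ ≤ 2 * ∑ k ∈ Finset.Ico N m, ‖f x k‖ ^ 2 + 2 * ∑ k ∈ Finset.Ico M m, ‖g x k‖ ^ 2 := by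
        gcongr
        · exact le_max_left _ _
        · exact le_max_right _ _
    _ ≤ ε := by linarith [hN x hx m, hM x hx m]

lemma const {a : ℕ → ℂ} (ha : Summable fun k => ‖a k‖ ^ 2) :
    UniformTails S (fun _ => a) := by
  intro ε hε
  have h := ha.hasSum.tendsto_sum_nat
  obtain ⟨N, hN⟩ := (h.eventually (lt_mem_nhds (sub_lt_self _ hε))).exists
  refine ⟨N, fun x _ m => ?_⟩
  rcases le_total N m with hNm | hNm
  · have := ha.sum_le_tsum (Finset.range m) fun _ _ => by positivity
    rw [← Finset.sum_range_add_sum_Ico _ hNm] at this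
    linarith
  · simp [Finset.Ico_eq_empty_of_le hNm, hε.le]

lemma summable (hf : UniformTails S f) {x : X} (hx : x ∈ S) : Summable fun k => ‖f x k‖ ^ 2 := by
  obtain ⟨N, hN⟩ := hf 1 one_pos
  refine summable_of_sum_range_le (c := ∑ k ∈ Finset.range N, ‖f x k‖ ^ 2 + 1)
    (fun _ => by positivity) fun m => ?_
  rcases le_total N m with hNm | hNm
  · rw [← Finset.sum_range_add_sum_Ico _ hNm]
    linarith [hN x hx m]
  · have := Finset.sum_le_sum_of_subset_of_nonneg (f := fun k => ‖f x k‖ ^ 2)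
      (Finset.range_mono hNm) fun _ _ _ => by positivity
    linarith

/-- By Parseval the squared distance splits at an index `N`: the tail is small uniformly in `x`, and
the head is a finite sum of coefficients that converge. -/
lemma tendsto_synth (hf : UniformTails S f) {l : Filter X} (hS : S ∈ l) {a : ℕ → ℂ}
    (ha : Summable fun k => ‖a k‖ ^ 2) (h : ∀ k, Tendsto (fun x => f x k) l (𝓝 (a k))) :
    Tendsto (fun x => synth (f x)) l (𝓝 (synth a)) := by
  rw [tendsto_iff_norm_sub_tendsto_zero, Metric.tendsto_nhds]
  intro ε hε
  have hδ : 0 < ε ^ 2 / 4 := by positivity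
  -- The limit is treated as a constant family, so that the differences `f x - a` have uniform tails
  -- too.
  obtain ⟨N, hN⟩ := hf.add (const (S := S) (a := fun k => -a k) (by simpa using ha)) (ε ^ 2 / 4) hδ
  simp only [← sub_eq_add_neg] at hN
  have hfin : Tendsto (fun x => ∑ k ∈ Finset.range N, ‖f x k - a k‖ ^ 2) l (𝓝 0) := by
    have : Tendsto (fun x => ∑ k ∈ Finset.range N, ‖f x k - a k‖ ^ 2) l
        (𝓝 (∑ k ∈ Finset.range N, ‖a k - a k‖ ^ 2)) :=
      tendsto_finsetSum _ fun k _ => ((h k).sub_const _).norm.pow 2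
    simpa using this
  filter_upwards [hfin.eventually (gt_mem_nhds hδ), hS] with x hx hxS
  have hcoef : ∀ k, cosCoeff (synth (f x) - synth a) k = f x k - a k := fun k => by
    rw [cosCoeff_sub, cosCoeff_synth (hf.summable hxS), cosCoeff_synth ha]
  have hle : ‖synth (f x) - synth a‖ ^ 2 ≤ ε ^ 2 / 4 + ε ^ 2 / 4 := by
    refine le_of_tendsto (hasSum_norm_sq_cosCoeff (synth (f x) - synth a)).tendsto_sum_nat ?_
    filter_upwards [eventually_ge_atTop N] with m hm
    simp_rw [hcoef]
    rw [← Finset.sum_range_add_sum_Ico _ hm]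
    exact add_le_add hx.le (hN x hxS m)
  rw [Real.dist_eq, sub_zero, abs_of_nonneg (norm_nonneg _)]
  refine lt_of_pow_lt_pow_left₀ 2 hε.le ?_
  have : 0 < ε ^ 2 := by positivity
  linarith

lemma continuousOn_synth [TopologicalSpace X] (hf : UniformTails S f)
    (hc : ∀ k, ContinuousOn (fun x => f x k) S) : ContinuousOn (fun x => synth (f x)) S :=
  fun x₀ hx₀ => hf.tendsto_synth self_mem_nhdsWithin (hf.summable hx₀) fun k => hc k x₀ hx₀

end UniformTails

/-! ### The dispersion relation -/

/-- `tanh a / a`, with value `1` at `a = 0`. -/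
def tanhc (a : ℝ) : ℝ := dslope Real.tanh 0 a

lemma tanhc_zero : tanhc 0 = 1 := by
  have h : HasDerivAt Real.tanh 1 0 := by
    have := (Real.hasDerivAt_sinh 0).div (Real.hasDerivAt_cosh 0) (by simp)
    simp only [Real.cosh_zero, Real.sinh_zero] at this
    have he : Real.tanh = Real.sinh / Real.cosh := by
      ext x; exact Real.tanh_eq_sinh_div_cosh x
    rw [he]
    simpa using this
  rw [tanhc, dslope_same, h.deriv]

lemma tanhc_of_ne {a : ℝ} (ha : a ≠ 0) : tanhc a = Real.tanh a / a := by
  rw [tanhc, dslope_of_ne _ ha, slope_def_field]; simp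

lemma mul_tanhc (a : ℝ) : a * tanhc a = Real.tanh a := by
  rcases eq_or_ne a 0 with rfl | ha
  · simp
  · rw [tanhc_of_ne ha]; field_simp

lemma tanhc_neg (a : ℝ) : tanhc (-a) = tanhc a := by
  rcases eq_or_ne a 0 with rfl | ha
  · simp
  · rw [tanhc_of_ne ha, tanhc_of_ne (neg_ne_zero.2 ha), Real.tanh_neg, neg_div_neg_eq]

lemma tanhc_abs (a : ℝ) : tanhc |a| = tanhc a := by
  rcases abs_choice a with h | h <;> rw [h]
  exact tanhc_neg a

lemma differentiable_tanh : Differentiable ℝ Real.tanh := by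
  have : Real.tanh = fun x => Real.sinh x / Real.cosh x := by
    ext x; exact Real.tanh_eq_sinh_div_cosh x
  rw [this]
  exact Real.differentiable_sinh.div Real.differentiable_cosh fun x => (Real.cosh_pos x).ne'

lemma continuous_tanhc : Continuous tanhc := by
  rw [← continuousOn_univ]
  exact (continuousOn_dslope univ_mem).2
    ⟨differentiable_tanh.continuous.continuousOn, differentiable_tanh 0⟩

lemma tanh_eq_exp (a : ℝ) : Real.tanh a = (Real.exp (2 * a) - 1) / (Real.exp (2 * a) + 1) := by
  rw [Real.tanh_eq_sinh_div_cosh, Real.sinh_eq, Real.cosh_eq, two_mul, Real.exp_add, Real.exp_neg]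
  have := Real.exp_pos a
  field_simp

lemma tanh_le_one (a : ℝ) : Real.tanh a ≤ 1 := by
  rw [tanh_eq_exp, div_le_one (by positivity)]; linarith

lemma tanh_mono : Monotone Real.tanh := by
  intro a b hab
  rw [tanh_eq_exp, tanh_eq_exp, div_le_div_iff₀ (by positivity) (by positivity)]
  have := Real.exp_le_exp.2 (by linarith : 2 * a ≤ 2 * b)
  nlinarith

lemma tanh_le_self {a : ℝ} (ha : 0 ≤ a) : Real.tanh a ≤ a := by
  have h : MonotoneOn (fun x => x * Real.cosh x - Real.sinh x) (Ici 0) := by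
    refine monotoneOn_of_deriv_nonneg (convex_Ici 0) (by fun_prop) (by fun_prop) ?_
    intro x hx
    rw [interior_Ici] at hx
    have hd : HasDerivAt (fun x => x * Real.cosh x - Real.sinh x)
      (1 * Real.cosh x + x * Real.sinh x - Real.cosh x) x :=
      ((hasDerivAt_id x).mul (Real.hasDerivAt_cosh x)).sub (Real.hasDerivAt_sinh x)
    rw [hd.deriv]
    have := Real.sinh_nonneg_iff.2 (le_of_lt hx)
    have := mul_nonneg (le_of_lt hx) this
    linarith
  have := h self_mem_Ici ha ha
  rw [Real.tanh_eq_sinh_div_cosh, div_le_iff₀ (Real.cosh_pos a)]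
  simp at this
  linarith

lemma tanhc_le_one (a : ℝ) : tanhc a ≤ 1 := by
  rw [← tanhc_abs]
  rcases (abs_nonneg a).eq_or_lt with h | h
  · rw [← h, tanhc_zero]
  · rw [tanhc_of_ne h.ne', div_le_one h]
    exact tanh_le_self h.le

/-- For `a ≠ 0` this amounts to `e^{2|a|} ≥ 1 + 2|a|`. It makes `freq h k ^ 2` grow at least
linearly in `k`, which is what pays for half a derivative. -/
lemma inv_one_add_abs_le_tanhc (a : ℝ) : 1 / (1 + |a|) ≤ tanhc a := by
  rw [← tanhc_abs]
  rcases (abs_nonneg a).eq_or_lt with h | h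
  · rw [← h, tanhc_zero]; norm_num
  · rw [tanhc_of_ne h.ne', tanh_eq_exp, div_div, div_le_div_iff₀ (by positivity) (by positivity)]
    have := Real.add_one_le_exp (2 * |a|)
    nlinarith

lemma tanhc_pos (a : ℝ) : 0 < tanhc a :=
  lt_of_lt_of_le (by positivity) (inv_one_add_abs_le_tanhc a)

/-- The frequency of the `k`-th mode of the water waves system with `√μ = h`, rescaled in time;
`h = 0` gives the wave equation. -/
def freq (h : ℝ) (k : ℕ) : ℝ := k * √(tanhc (h * k))

lemma freq_nonneg (h : ℝ) (k : ℕ) : 0 ≤ freq h k := by unfold freq; positivity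

lemma freq_sq (h : ℝ) (k : ℕ) : freq h k ^ 2 = k ^ 2 * tanhc (h * k) := by
  rw [freq, mul_pow, Real.sq_sqrt (tanhc_pos _).le]

lemma freq_zero (k : ℕ) : freq 0 k = k := by simp [freq, tanhc_zero]

lemma freq_le (h : ℝ) (k : ℕ) : freq h k ≤ k := by
  unfold freq
  have := Real.sqrt_le_one.2 (tanhc_le_one (h * k))
  nlinarith [Nat.cast_nonneg (α := ℝ) k]

lemma freq_pos (h : ℝ) {k : ℕ} (hk : 1 ≤ k) : 0 < freq h k := by
  unfold freq
  have : (0 : ℝ) < k := by exact_mod_cast hk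
  have := Real.sqrt_pos.2 (tanhc_pos (h * k))
  positivity

lemma continuous_freq (k : ℕ) : Continuous fun h => freq h k := by
  unfold freq
  have := continuous_tanhc
  fun_prop

/-- Since `n * tanhc (h n) = tanh (|h| n) / |h|` is monotone in `n`, one has `freq h k ^ 2 = k (k
tanhc (h k)) ≤ k (j tanhc (h j))`. -/
lemma freq_sq_sub_ge {h : ℝ} {j k : ℕ} (hkj : k ≤ j) :
    ((j : ℝ) - k) * (j * tanhc (h * j)) ≤ freq h j ^ 2 - freq h k ^ 2 := by
  have hk' : (k : ℝ) ≤ j := by exact_mod_cast hkj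
  have hmono : (k : ℝ) * tanhc (h * k) ≤ j * tanhc (h * j) := by
    rcases eq_or_ne h 0 with rfl | hh
    · simpa [tanhc_zero] using hk'
    · have h0 : 0 < |h| := abs_pos.2 hh
      have e : ∀ n : ℕ, (n : ℝ) * tanhc (h * n) = Real.tanh (|h| * n) / |h| := fun n => by
        rw [← tanhc_abs (h * n), abs_mul, Nat.abs_cast, ← mul_tanhc (|h| * n)]
        field_simp
      rw [e, e]
      gcongr
      exact tanh_mono (by gcongr)
  rw [freq_sq, freq_sq]
  nlinarith [Nat.cast_nonneg (α := ℝ) k]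

/-- The frequencies are separated, up to the weights `tanhc (h k)`, uniformly in `h`. -/
lemma tanhc_mul_tanhc_le (h : ℝ) (j k : ℕ) :
    tanhc (h * j) * tanhc (h * k) * (1 + ((j : ℝ) - k) ^ 2)
      ≤ 4 * (1 + (freq h j - freq h k) ^ 2) := by
  wlog hkj : k ≤ j generalizing j k
  · have := this k j (le_of_not_ge hkj)
    nlinarith
  have hj0 := tanhc_pos (h * j)
  have hk0 := tanhc_pos (h * k)
  have hj1 := tanhc_le_one (h * j)
  have hk1 := tanhc_le_one (h * k)
  have hp1 : tanhc (h * j) * tanhc (h * k) ≤ 1 := mul_le_one₀ hj1 hk0.le hk1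
  have hk' : (k : ℝ) ≤ j := by exact_mod_cast hkj
  -- The weight of the larger index alone already restores the separation; the other weight is at
  -- most `1`.
  have main : tanhc (h * j) * ((j : ℝ) - k) ^ 2 ≤ 4 * (freq h j - freq h k) ^ 2 := by
    rcases Nat.eq_zero_or_pos j with rfl | hj
    · have : k = 0 := by omega
      subst this; simp
    have hf := freq_pos h hj
    -- Factor the difference of squares and bound `freq h j + freq h k` by `2 * freq h j`; one
    -- factor `freq h j` then cancels.
    have hgap : ((j : ℝ) - k) * √(tanhc (h * j)) ≤ 2 * (freq h j - freq h k) := by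
      have h1 := freq_sq_sub_ge (h := h) hkj
      have e : (j : ℝ) * tanhc (h * j) = freq h j * √(tanhc (h * j)) := by
        rw [freq, mul_assoc, Real.mul_self_sqrt hj0.le]
      rw [e] at h1
      have hsq : freq h k ^ 2 ≤ freq h j ^ 2 := by
        have : 0 ≤ ((j : ℝ) - k) * (freq h j * √(tanhc (h * j))) :=
          mul_nonneg (by linarith) (mul_nonneg hf.le (Real.sqrt_nonneg _))
        linarith
      have hle : freq h k ≤ freq h j := (sq_le_sq₀ (freq_nonneg h k) hf.le).1 hsq
      have h2 : freq h j * (((j : ℝ) - k) * √(tanhc (h * j)))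
          ≤ freq h j * (2 * (freq h j - freq h k)) := by
        nlinarith [freq_nonneg h k]
      exact le_of_mul_le_mul_left h2 hf
    have h0 : 0 ≤ ((j : ℝ) - k) * √(tanhc (h * j)) :=
      mul_nonneg (by linarith) (Real.sqrt_nonneg _)
    have := pow_le_pow_left₀ h0 hgap 2
    rw [mul_pow, Real.sq_sqrt hj0.le] at this
    linarith
  have : tanhc (h * j) * tanhc (h * k) * ((j : ℝ) - k) ^ 2
      ≤ tanhc (h * j) * ((j : ℝ) - k) ^ 2 := by
    have : 0 ≤ tanhc (h * j) * ((j : ℝ) - k) ^ 2 := by positivity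
    nlinarith
  nlinarith

end

noncomputable section

/-! ### Uniform admissibility of the boundary control -/

lemma integrable_exp_neg_abs : Integrable fun s : ℝ => Real.exp (-|s|) := by
  rw [← integrableOn_univ, ← Iic_union_Ioi (a := (0 : ℝ)), integrableOn_union]
  constructor
  · refine (integrableOn_exp_Iic 0).congr_fun (fun s hs => ?_) measurableSet_Iic
    simp only [abs_of_nonpos (show s ≤ 0 from hs), neg_neg]
  · refine (integrableOn_exp_neg_Ioi 0).congr_fun (fun s hs => ?_) measurableSet_Ioi
    simp only [abs_of_pos (show 0 < s from hs)]

/-- The majorant `e^{-|s|}` is chosen for this transform: it is positive and of the same shape as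
the Schur kernel, so the two are compared directly through the separation of the frequencies. -/
lemma integral_exp_neg_abs_mul_exp (x : ℝ) :
    ∫ s : ℝ, (Real.exp (-|s|) : ℂ) * Complex.exp (Complex.I * x * s) = 2 / (1 + (x : ℂ) ^ 2) := by
  have hint : Integrable fun s : ℝ => (Real.exp (-|s|) : ℂ) * Complex.exp (Complex.I * x * s) := by
    refine integrable_exp_neg_abs.ofReal.mul_bdd (c := 1) (by fun_prop) (Eventually.of_forall fun s => ?_)
    rw [show Complex.I * x * s = ((x * s : ℝ) : ℂ) * Complex.I by push_cast; ring,
      Complex.norm_exp_ofReal_mul_I]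
  have hne1 : (1 + Complex.I * x : ℂ) ≠ 0 := fun h => by
    have := congrArg Complex.re h; simp at this
  have hne2 : (-1 + Complex.I * x : ℂ) ≠ 0 := fun h => by
    have := congrArg Complex.re h; simp at this
  rw [← intervalIntegral.integral_Iic_add_Ioi (b := 0) hint.integrableOn hint.integrableOn]
  have h1 : ∫ s in Iic (0 : ℝ), (Real.exp (-|s|) : ℂ) * Complex.exp (Complex.I * x * s)
      = 1 / (1 + Complex.I * x) := by
    have := integral_exp_mul_complex_Iic (a := 1 + Complex.I * x) (by simp) 0
    simp only [Complex.ofReal_zero, mul_zero, Complex.exp_zero] at this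
    rw [← this]
    refine setIntegral_congr_fun measurableSet_Iic fun s hs => ?_
    simp only [abs_of_nonpos (show s ≤ 0 from hs), neg_neg, Complex.ofReal_exp]
    rw [← Complex.exp_add]; ring_nf
  have h2 : ∫ s in Ioi (0 : ℝ), (Real.exp (-|s|) : ℂ) * Complex.exp (Complex.I * x * s)
      = - 1 / (-1 + Complex.I * x) := by
    have := integral_exp_mul_complex_Ioi (a := -1 + Complex.I * x) (by simp) 0
    simp only [Complex.ofReal_zero, mul_zero, Complex.exp_zero] at this
    rw [← this]
    refine setIntegral_congr_fun measurableSet_Ioi fun s hs => ?_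
    simp only [abs_of_pos (show 0 < s from hs), Complex.ofReal_exp]
    rw [← Complex.exp_add]; push_cast; ring_nf
  have hne3 : (1 + (x : ℂ) ^ 2) ≠ 0 := by
    have : (1 + (x : ℂ) ^ 2) = - ((1 + Complex.I * x) * (-1 + Complex.I * x)) := by
      ring_nf; rw [Complex.I_sq]; ring
    rw [this]; exact neg_ne_zero.2 (mul_ne_zero hne1 hne2)
  rw [h1, h2]
  field_simp
  ring_nf; rw [Complex.I_sq]; ring

/-- The Schur bound of the kernel `1 / (1 + (j - k)²)`. -/
def schurConst : ℝ := ∑' n : ℤ, 1 / (1 + (n : ℝ) ^ 2)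

lemma summable_schur : Summable fun n : ℤ => 1 / (1 + (n : ℝ) ^ 2) := by
  have h : Summable fun n : ℤ => 1 / (n : ℝ) ^ 2 := Real.summable_one_div_int_pow.2 one_lt_two
  refine Summable.of_norm_bounded_eventually (g := fun n : ℤ => 1 / (n : ℝ) ^ 2) h ?_
  filter_upwards [(Set.finite_singleton (0 : ℤ)).compl_mem_cofinite] with n hn
  have hn' : (n : ℝ) ≠ 0 := by exact_mod_cast hn
  have : 0 < (n : ℝ) ^ 2 := by positivity
  rw [Real.norm_of_nonneg (by positivity)]
  exact one_div_le_one_div_of_le this (by linarith)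

lemma schurConst_pos : 0 < schurConst :=
  summable_schur.tsum_pos (fun _ => by positivity) 0 (by norm_num)

lemma sum_schur_le (F : Finset ℕ) (k : ℕ) :
    ∑ j ∈ F, 1 / (1 + ((j : ℝ) - k) ^ 2) ≤ schurConst := by
  have hinj : Function.Injective fun j : ℕ => (j : ℤ) - k := fun a b h => by simpa using h
  calc ∑ j ∈ F, 1 / (1 + ((j : ℝ) - k) ^ 2)
      = ∑ n ∈ F.map ⟨_, hinj⟩, 1 / (1 + (n : ℝ) ^ 2) := by
        rw [Finset.sum_map]; simp
    _ ≤ schurConst := summable_schur.sum_le_tsum _ fun _ _ => by positivity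

/-- Schur test: `a_j a_k ≤ (a_j² + a_k²) / 2`, followed by the row and column bounds of the
symmetric kernel. -/
lemma sum_sum_schur_le (F : Finset ℕ) (a : ℕ → ℝ) :
    ∑ j ∈ F, ∑ k ∈ F, a j * a k * (1 / (1 + ((j : ℝ) - k) ^ 2))
      ≤ schurConst * ∑ j ∈ F, a j ^ 2 := by
  have h1 : ∀ j k : ℕ, a j * a k * (1 / (1 + ((j : ℝ) - k) ^ 2))
      ≤ a j ^ 2 / 2 * (1 / (1 + ((k : ℝ) - j) ^ 2)) + a k ^ 2 / 2 * (1 / (1 + ((j : ℝ) - k) ^ 2)) := by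
    intro j k
    rw [show ((k : ℝ) - j) ^ 2 = ((j : ℝ) - k) ^ 2 by ring, ← add_mul]
    refine mul_le_mul_of_nonneg_right ?_ (by positivity)
    nlinarith [sq_nonneg (a j - a k)]
  calc _ ≤ ∑ j ∈ F, ∑ k ∈ F, (a j ^ 2 / 2 * (1 / (1 + ((k : ℝ) - j) ^ 2))
            + a k ^ 2 / 2 * (1 / (1 + ((j : ℝ) - k) ^ 2))) :=
        Finset.sum_le_sum fun j _ => Finset.sum_le_sum fun k _ => h1 j k
    _ = ∑ j ∈ F, a j ^ 2 / 2 * ∑ k ∈ F, (1 / (1 + ((k : ℝ) - j) ^ 2))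
          + ∑ k ∈ F, a k ^ 2 / 2 * ∑ j ∈ F, (1 / (1 + ((j : ℝ) - k) ^ 2)) := by
        simp_rw [Finset.sum_add_distrib, Finset.mul_sum]
        congr 1
        exact Finset.sum_comm
    _ ≤ ∑ j ∈ F, a j ^ 2 / 2 * schurConst + ∑ k ∈ F, a k ^ 2 / 2 * schurConst := by
        gcongr with j _ j _
        · exact sum_schur_le F j
        · exact sum_schur_le F j
    _ = schurConst * ∑ j ∈ F, a j ^ 2 := by
        rw [← Finset.sum_mul, ← Finset.sum_div]; ring

/-- On `(0, t]` one has `1 ≤ e^t e^{-|s|}`. Integrating over the whole line gives a quadratic form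
with kernel `2 / (1 + (ν_j - ν_k)²)`, and the weights `β` contained in `d` exchange it for `8 / (1 +
(j - k)²)`, where `8 = 2 * 4`. -/
lemma integral_norm_sq_expSum_le {ν β a : ℕ → ℝ} (ha : ∀ k, 0 ≤ a k)
    (hνβ : ∀ j k, β j * β k * (1 + ((j : ℝ) - k) ^ 2) ≤ 4 * (1 + (ν j - ν k) ^ 2))
    (F : Finset ℕ) (d : ℕ → ℂ) (hd : ∀ k, ‖d k‖ = β k * a k) (t : ℝ) :
    ∫ s in Ioc 0 t, ‖∑ k ∈ F, d k * Complex.exp (Complex.I * ν k * s)‖ ^ 2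
      ≤ 8 * Real.exp t * schurConst * ∑ k ∈ F, a k ^ 2 := by
  set P : ℝ → ℂ := fun s => ∑ k ∈ F, d k * Complex.exp (Complex.I * ν k * s) with hP
  have hPc : Continuous P := by fun_prop
  have hPb : ∀ s, ‖P s‖ ≤ ∑ k ∈ F, ‖d k‖ := fun s => by
    refine (norm_sum_le _ _).trans (Finset.sum_le_sum fun k _ => ?_)
    rw [norm_mul, show Complex.I * ν k * s = ((ν k * s : ℝ) : ℂ) * Complex.I by push_cast; ring,
      Complex.norm_exp_ofReal_mul_I, mul_one]
  have hint : Integrable fun s : ℝ => Real.exp (-|s|) * ‖P s‖ ^ 2 := by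
    refine integrable_exp_neg_abs.mul_bdd (c := (∑ k ∈ F, ‖d k‖) ^ 2) (by fun_prop)
      (Eventually.of_forall fun s => ?_)
    rw [Real.norm_of_nonneg (by positivity)]
    exact pow_le_pow_left₀ (norm_nonneg _) (hPb s) 2
  have step1 : ∫ s in Ioc 0 t, ‖P s‖ ^ 2 ≤ Real.exp t * ∫ s, Real.exp (-|s|) * ‖P s‖ ^ 2 := by
    rw [← integral_const_mul]
    calc _ ≤ ∫ s in Ioc 0 t, Real.exp t * (Real.exp (-|s|) * ‖P s‖ ^ 2) := by
          refine setIntegral_mono_on ?_ (hint.const_mul _).integrableOn measurableSet_Ioc ?_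
          · exact (Continuous.integrableOn_Icc (by fun_prop)).mono_set Ioc_subset_Icc_self
          · intro s hs
            rw [← mul_assoc, ← Real.exp_add, abs_of_pos hs.1]
            exact le_mul_of_one_le_left (by positivity) (Real.one_le_exp (by linarith [hs.2]))
      _ ≤ _ := setIntegral_le_integral (hint.const_mul _)
          (Eventually.of_forall fun s => by positivity)
  have step2 : ((∫ s, Real.exp (-|s|) * ‖P s‖ ^ 2 : ℝ) : ℂ)
      = ∑ j ∈ F, ∑ k ∈ F, d j * conj (d k) * (2 / (1 + ((ν j - ν k : ℝ) : ℂ) ^ 2)) := by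
    have e : ∀ s : ℝ, ((Real.exp (-|s|) * ‖P s‖ ^ 2 : ℝ) : ℂ)
        = ∑ j ∈ F, ∑ k ∈ F, d j * conj (d k)
          * ((Real.exp (-|s|) : ℂ) * Complex.exp (Complex.I * (ν j - ν k : ℝ) * s)) := fun s => by
      have : ((‖P s‖ ^ 2 : ℝ) : ℂ) = P s * conj (P s) := by
        rw [Complex.mul_conj']; push_cast; rfl
      rw [Complex.ofReal_mul, this, hP, map_sum, Finset.sum_mul_sum, Finset.mul_sum]
      refine Finset.sum_congr rfl fun j _ => ?_
      rw [Finset.mul_sum]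
      refine Finset.sum_congr rfl fun k _ => ?_
      rw [map_mul, ← Complex.exp_conj]
      simp only [map_mul, Complex.conj_I, Complex.conj_ofReal]
      rw [show Complex.I * ((ν j - ν k : ℝ) : ℂ) * s
        = Complex.I * ν j * s + -Complex.I * ν k * s by push_cast; ring, Complex.exp_add]
      ring
    have hI : ∀ x : ℝ, Integrable fun s : ℝ =>
        (Real.exp (-|s|) : ℂ) * Complex.exp (Complex.I * x * s) := fun x => by
      refine integrable_exp_neg_abs.ofReal.mul_bdd (c := 1) (by fun_prop)
        (Eventually.of_forall fun s => ?_)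
      rw [show Complex.I * x * s = ((x * s : ℝ) : ℂ) * Complex.I by push_cast; ring,
        Complex.norm_exp_ofReal_mul_I]
    rw [← integral_complex_ofReal]
    simp_rw [e]
    rw [integral_finsetSum _ fun j _ => integrable_finsetSum _ fun k _ => (hI _).const_mul _]
    refine Finset.sum_congr rfl fun j _ => ?_
    rw [integral_finsetSum _ fun k _ => (hI _).const_mul _]
    refine Finset.sum_congr rfl fun k _ => ?_
    rw [integral_const_mul, integral_exp_neg_abs_mul_exp]
  have step3 : ∫ s, Real.exp (-|s|) * ‖P s‖ ^ 2 ≤ 8 * (schurConst * ∑ k ∈ F, a k ^ 2) := by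
    have h0 : 0 ≤ ∫ s, Real.exp (-|s|) * ‖P s‖ ^ 2 := integral_nonneg fun _ => by positivity
    have h1 : ∫ s, Real.exp (-|s|) * ‖P s‖ ^ 2
        = ‖((∫ s, Real.exp (-|s|) * ‖P s‖ ^ 2 : ℝ) : ℂ)‖ := by
      rw [Complex.norm_real, Real.norm_of_nonneg h0]
    rw [h1, step2]
    refine le_trans ?_ (mul_le_mul_of_nonneg_left (sum_sum_schur_le F a) (by norm_num))
    rw [Finset.mul_sum]
    refine (norm_sum_le _ _).trans (Finset.sum_le_sum fun j _ => ?_)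
    rw [Finset.mul_sum]
    refine (norm_sum_le _ _).trans (Finset.sum_le_sum fun k _ => ?_)
    have hn : ‖(2 / (1 + ((ν j - ν k : ℝ) : ℂ) ^ 2))‖ = 2 / (1 + (ν j - ν k) ^ 2) := by
      rw [show (2 / (1 + ((ν j - ν k : ℝ) : ℂ) ^ 2)) = ((2 / (1 + (ν j - ν k) ^ 2) : ℝ) : ℂ) by
        push_cast; ring, Complex.norm_real, Real.norm_of_nonneg (by positivity)]
    rw [norm_mul, norm_mul, RCLike.norm_conj, hn, hd, hd]
    have hk : β j * β k * (2 / (1 + (ν j - ν k) ^ 2)) ≤ 8 * (1 / (1 + ((j : ℝ) - k) ^ 2)) := by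
      rw [mul_div_assoc', mul_one_div, div_le_div_iff₀ (by positivity) (by positivity)]
      linarith [hνβ j k]
    calc _ = a j * a k * (β j * β k * (2 / (1 + (ν j - ν k) ^ 2))) := by ring
      _ ≤ a j * a k * (8 * (1 / (1 + ((j : ℝ) - k) ^ 2))) :=
          mul_le_mul_of_nonneg_left hk (mul_nonneg (ha j) (ha k))
      _ = _ := by ring
  calc _ ≤ Real.exp t * ∫ s, Real.exp (-|s|) * ‖P s‖ ^ 2 := step1
    _ ≤ Real.exp t * (8 * (schurConst * ∑ k ∈ F, a k ^ 2)) :=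
        mul_le_mul_of_nonneg_left step3 (Real.exp_pos t).le
    _ = _ := by ring

/-- The constant of the admissibility estimate. -/
def admConst (t : ℝ) : ℝ := 8 * Real.exp t * schurConst

lemma admConst_pos (t : ℝ) : 0 < admConst t := by
  have := schurConst_pos; unfold admConst; positivity

lemma admConst_mono : Monotone admConst := fun s t h => by
  have := schurConst_pos; unfold admConst; gcongr

/-- A large sieve inequality: for separated frequencies, the nonharmonic Fourier coefficients of a
function on `(0, t]` are square summable. -/
lemma sum_norm_sq_integral_exp_le {ν β : ℕ → ℝ} (hβ : ∀ k, 0 ≤ β k)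
    (hνβ : ∀ j k, β j * β k * (1 + ((j : ℝ) - k) ^ 2) ≤ 4 * (1 + (ν j - ν k) ^ 2))
    (F : Finset ℕ) (t : ℝ) {u : ℝ → ℂ} (hu : MemLp u 2 (volume.restrict (Ioc 0 t))) :
    ∑ k ∈ F, (β k * ‖∫ s in Ioc 0 t, Complex.exp (Complex.I * ν k * s) * u s‖) ^ 2
      ≤ admConst t * ∫ s in Ioc 0 t, ‖u s‖ ^ 2 := by
  set I : ℕ → ℂ := fun k => ∫ s in Ioc 0 t, Complex.exp (Complex.I * ν k * s) * u s with hI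
  set S := ∑ k ∈ F, (β k * ‖I k‖) ^ 2 with hS
  have hu1 : Integrable u (volume.restrict (Ioc 0 t)) := hu.integrable one_le_two
  have hu2 : Integrable (fun s => ‖u s‖ ^ 2) (volume.restrict (Ioc 0 t)) := hu.integrable_norm_pow' 
  have hexp : ∀ k, Integrable (fun s : ℝ => Complex.exp (Complex.I * ν k * s) * u s)
      (volume.restrict (Ioc 0 t)) := fun k =>
    hu1.bdd_mul (c := 1) (by fun_prop) (Eventually.of_forall fun s => by
      rw [show Complex.I * ν k * s = ((ν k * s : ℝ) : ℂ) * Complex.I by push_cast; ring,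
        Complex.norm_exp_ofReal_mul_I])
  -- Duality: with these coefficients the integral of `P * u` is exactly the sum `S` to be bounded.
  set d : ℕ → ℂ := fun k => β k ^ 2 * conj (I k) with hd
  set P : ℝ → ℂ := fun s => ∑ k ∈ F, d k * Complex.exp (Complex.I * ν k * s) with hP
  have hPc : Continuous P := by fun_prop
  have hP2 : ∫ s in Ioc 0 t, ‖P s‖ ^ 2 ≤ admConst t * S :=
    integral_norm_sq_expSum_le (fun k => mul_nonneg (hβ k) (norm_nonneg (I k))) hνβ F d
      (fun k => by
        rw [hd]; simp only [norm_mul, norm_pow, Complex.norm_real, RCLike.norm_conj,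
          Real.norm_of_nonneg (hβ k)]; ring) t
  have hPi : Integrable (fun s => ‖P s‖ ^ 2) (volume.restrict (Ioc 0 t)) :=
    (Continuous.integrableOn_Icc (by fun_prop)).mono_set Ioc_subset_Icc_self
  have hSint : (S : ℂ) = ∫ s in Ioc 0 t, P s * u s := by
    have e : ∀ s, P s * u s = ∑ k ∈ F, d k * (Complex.exp (Complex.I * ν k * s) * u s) := fun s => by
      rw [hP, Finset.sum_mul]; exact Finset.sum_congr rfl fun _ _ => by ring
    simp_rw [e]
    rw [integral_finsetSum _ fun k _ => (hexp k).const_mul _, hS]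
    push_cast
    refine Finset.sum_congr rfl fun k _ => ?_
    rw [integral_const_mul, hd]
    simp only
    rw [mul_assoc, Complex.conj_mul', mul_pow]
  have hC := admConst_pos t
  -- Young's inequality, weighted by `admConst t` so that the part with `P` is at most `S / 2` and
  -- can be absorbed on the left.
  have hSle : S ≤ ∫ s in Ioc 0 t, (‖P s‖ ^ 2 / (2 * admConst t) + admConst t / 2 * ‖u s‖ ^ 2) := by
    have hS0 : 0 ≤ S := Finset.sum_nonneg fun _ _ => by positivity
    calc S = ‖(S : ℂ)‖ := by rw [Complex.norm_real, Real.norm_of_nonneg hS0]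
      _ ≤ _ := by
        rw [hSint]
        refine norm_integral_le_of_norm_le ((hPi.div_const _).add (hu2.const_mul _))
          (Eventually.of_forall fun s => ?_)
        rw [norm_mul, div_add' _ _ _ (by positivity), le_div_iff₀ (by positivity)]
        nlinarith [sq_nonneg (‖P s‖ - admConst t * ‖u s‖)]
  rw [integral_add (hPi.div_const _) (hu2.const_mul _), integral_div, integral_const_mul] at hSle
  have : (∫ s in Ioc 0 t, ‖P s‖ ^ 2) / (2 * admConst t) ≤ S / 2 := by
    rw [div_le_div_iff₀ (by positivity) (by positivity)]
    linarith
  linarith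

end

/-! ### The primitive of the control and its oscillatory integrals. -/

noncomputable section

/-- The primitive of `u` on `[0, ∞)`, extended by `0`. -/
def primitive (u : ℝ → ℂ) (t : ℝ) : ℂ := ∫ s in Ioc 0 t, u s

lemma MemL2Loc.memLp {u : ℝ → ℂ} (hu : MemL2Loc u) (T : ℝ) :
    MemLp u 2 (volume.restrict (Ioc 0 T)) := by
  rcases le_or_gt T 0 with h | h
  · rw [Ioc_eq_empty (not_lt.2 h)]; simp
  · exact hu T h

lemma MemL2Loc.integrableOn {u : ℝ → ℂ} (hu : MemL2Loc u) (T : ℝ) : IntegrableOn u (Ioc 0 T) :=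
  (hu.memLp T).integrable one_le_two

lemma primitive_eq_intervalIntegral {u : ℝ → ℂ} {t : ℝ} (ht : 0 ≤ t) :
    primitive u t = ∫ s in (0 : ℝ)..t, u s := by
  rw [primitive, intervalIntegral.integral_of_le ht]

lemma primitive_of_nonpos {u : ℝ → ℂ} {t : ℝ} (ht : t ≤ 0) : primitive u t = 0 := by
  simp [primitive, Ioc_eq_empty (not_lt.2 ht)]

/-- The set `Ioc 0 t` is empty for `t ≤ 0`, so the primitive is continuous on the whole line
although nothing is known about `u` on the negative axis. -/
lemma continuous_primitive {u : ℝ → ℂ} (hu : MemL2Loc u) : Continuous (primitive u) := by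
  have h1 : ContinuousOn (primitive u) (Ici 0) := by
    intro t ht
    have hT : ContinuousOn (primitive u) (Icc 0 (t + 1)) :=
      intervalIntegral.continuousOn_primitive
        ((hu.integrableOn (t + 1)).congr_set_ae Ioc_ae_eq_Icc.symm)
    refine ((hT t ⟨ht, by linarith⟩).mono_of_mem_nhdsWithin ?_)
    rw [← Ici_inter_Iic]
    exact inter_mem self_mem_nhdsWithin (mem_nhdsWithin_of_mem_nhds (Iic_mem_nhds (by linarith)))
  have h2 : primitive u = fun t => primitive u (max t 0) := by
    ext t
    rcases le_total t 0 with h | h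
    · rw [max_eq_right h, primitive_of_nonpos h, primitive_of_nonpos le_rfl]
    · rw [max_eq_left h]
  rw [h2]
  exact h1.comp_continuous (by fun_prop) fun t => mem_Ici.2 (le_max_right _ _)

/-- Integration by parts against the primitive of an integrable function. -/
lemma integral_mul_eq_sub_integral_deriv_mul_primitive {u : ℝ → ℂ} (hu : MemL2Loc u)
    {κ κ' : ℝ → ℂ} (hκ : ∀ s, HasDerivAt κ (κ' s) s) (hκ' : Continuous κ') (t : ℝ) :
    ∫ s in Ioc 0 t, κ s * u s = κ t * primitive u t - ∫ s in (0 : ℝ)..t, κ' s * primitive u s := by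
  rcases le_total t 0 with h | h
  · rw [Ioc_eq_empty (not_lt.2 h), primitive_of_nonpos h, intervalIntegral.integral_of_ge h]
    rw [setIntegral_congr_fun (g := fun _ => 0) measurableSet_Ioc fun s hs => by
      simp only [primitive_of_nonpos hs.2, mul_zero]]
    simp
  have hui := hu.integrableOn t
  have hκi : IntegrableOn κ' (Ioc 0 t) := hκ'.integrableOn_Icc.mono_set Ioc_subset_Icc_self
  -- As `u` is merely integrable on bounded intervals, the formula comes from Fubini on the triangle
  -- `r ≤ s`.
  set f : ℝ → ℝ → ℂ := fun s r => {p : ℝ × ℝ | p.2 ≤ p.1}.indicator (fun p => κ' p.1 * u p.2) (s, r)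
    with hf
  have hfi : Integrable (Function.uncurry f)
      ((volume.restrict (Ioc 0 t)).prod (volume.restrict (Ioc 0 t))) := by
    have := (Integrable.mul_prod hκi hui).indicator
      (measurableSet_le measurable_snd measurable_fst)
    exact this
  have hswap := integral_integral_swap hfi
  have hl : ∫ s in Ioc 0 t, ∫ r in Ioc 0 t, f s r = ∫ s in (0 : ℝ)..t, κ' s * primitive u s := by
    rw [intervalIntegral.integral_of_le h]
    refine setIntegral_congr_fun measurableSet_Ioc fun s hs => ?_
    have e : ∀ r, f s r = (Iic s).indicator (fun r => κ' s * u r) r := fun r => by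
      simp [hf, indicator]
    simp_rw [e]
    rw [setIntegral_indicator measurableSet_Iic, Ioc_inter_Iic, min_eq_right hs.2,
      integral_const_mul, primitive]
  have hr : ∫ r in Ioc 0 t, ∫ s in Ioc 0 t, f s r = ∫ r in Ioc 0 t, (κ t * u r - κ r * u r) := by
    refine setIntegral_congr_fun measurableSet_Ioc fun r hr => ?_
    have e : ∀ s, f s r = (Ici r).indicator (fun s => κ' s * u r) s := fun r => by
      simp [hf, indicator]
    simp_rw [e]
    have hset : Ioc 0 t ∩ Ici r = Icc r t := by
      ext s; simp only [mem_inter_iff, mem_Ioc, mem_Ici, mem_Icc]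
      exact ⟨fun h => ⟨h.2, h.1.2⟩, fun h => ⟨⟨hr.1.trans_le h.1, h.2⟩, h.1⟩⟩
    rw [setIntegral_indicator measurableSet_Ici, hset, integral_mul_const,
      integral_Icc_eq_integral_Ioc, ← intervalIntegral.integral_of_le hr.2,
      intervalIntegral.integral_eq_sub_of_hasDerivAt (fun s _ => hκ s) (hκ'.intervalIntegrable _ _)]
    ring
  have hκc : Continuous κ := continuous_iff_continuousAt.2 fun s => (hκ s).continuousAt
  obtain ⟨C, hC⟩ := (isCompact_Icc (a := 0) (b := t)).exists_bound_of_continuousOn hκc.continuousOn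
  have hκu : IntegrableOn (fun r => κ r * u r) (Ioc 0 t) := by
    refine hui.bdd_mul (c := C) hκc.aestronglyMeasurable ?_
    filter_upwards [ae_restrict_mem measurableSet_Ioc] with s hs using hC s (Ioc_subset_Icc_self hs)
  rw [hl, hr, integral_sub (hui.const_mul _) hκu, integral_const_mul] at hswap
  rw [hswap, primitive]
  ring

lemma norm_exp_I_mul (x s : ℝ) : ‖Complex.exp (Complex.I * x * s)‖ = 1 := by
  rw [show Complex.I * x * s = ((x * s : ℝ) : ℂ) * Complex.I by push_cast; ring,
    Complex.norm_exp_ofReal_mul_I]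

/-- One integration by parts gains `1 / |x|`: the two boundary terms contribute `2 M`, the remaining
integral at most `T * M`. -/
lemma norm_integral_exp_mul_le {g : ℝ → ℂ} (hg : ContDiff ℝ 1 g) {M T : ℝ}
    (hM : ∀ s, ‖g s‖ ≤ M) (hM' : ∀ s, ‖deriv g s‖ ≤ M) {x t : ℝ} (hx : x ≠ 0)
    (htT : t ≤ T) (hT : 0 ≤ T) :
    ‖∫ s in Ioc 0 t, Complex.exp (Complex.I * x * s) * g s‖ ≤ (2 + T) * M / |x| := by
  have hM0 : 0 ≤ M := (norm_nonneg _).trans (hM 0)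
  rcases lt_or_ge t 0 with h | h
  · rw [Ioc_eq_empty (not_lt.2 h.le)]; simp; positivity
  have hxc : (Complex.I * x : ℂ) ≠ 0 := mul_ne_zero Complex.I_ne_zero (by exact_mod_cast hx)
  set e : ℝ → ℂ := fun s => Complex.exp (Complex.I * x * s) with he
  have hd : ∀ s : ℝ, HasDerivAt (fun s : ℝ => e s / (Complex.I * x)) (e s) s := fun s => by
    have h1 : HasDerivAt (fun s : ℝ => Complex.I * x * (s : ℂ)) (Complex.I * x * 1) s :=
      (Complex.ofRealCLM.hasDerivAt (x := s)).const_mul _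
    have := h1.cexp.div_const (Complex.I * x)
    rwa [mul_one, mul_div_assoc, div_self hxc, mul_one] at this
  have hgd : ∀ s, HasDerivAt g (deriv g s) s := fun s =>
    (hg.differentiable one_ne_zero).differentiableAt.hasDerivAt
  have hgc : Continuous (deriv g) := hg.continuous_deriv le_rfl
  have hparts := intervalIntegral.integral_mul_deriv_eq_deriv_mul (a := 0) (b := t)
    (fun s _ => hgd s) (fun s _ => hd s) (hgc.intervalIntegrable _ _)
    ((by fun_prop : Continuous e).intervalIntegrable _ _)
  have hnorm : ∀ s, ‖e s / (Complex.I * x)‖ = 1 / |x| := fun s => by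
    rw [norm_div, he]; simp only [norm_exp_I_mul]; simp
  have hint : ‖∫ s in (0 : ℝ)..t, deriv g s * (e s / (Complex.I * x))‖ ≤ M * (1 / |x|) * |t - 0| := by
    refine intervalIntegral.norm_integral_le_of_norm_le_const fun s _ => ?_
    rw [norm_mul, hnorm]
    exact mul_le_mul_of_nonneg_right (hM' s) (by positivity)
  rw [sub_zero, abs_of_nonneg h] at hint
  have hb : ∀ s, ‖g s * (e s / (Complex.I * x))‖ ≤ M * (1 / |x|) := fun s => by
    rw [norm_mul, hnorm]
    exact mul_le_mul_of_nonneg_right (hM s) (by positivity)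
  rw [← intervalIntegral.integral_of_le h]
  simp_rw [mul_comm _ (g _)]
  rw [hparts]
  calc _ ≤ M * (1 / |x|) + M * (1 / |x|) + M * (1 / |x|) * t :=
        (norm_sub_le _ _).trans (add_le_add ((norm_sub_le _ _).trans (add_le_add (hb _) (hb _))) hint)
    _ ≤ M * (1 / |x|) + M * (1 / |x|) + M * (1 / |x|) * T := by gcongr
    _ = _ := by ring

lemma exists_smooth_approx {u : ℝ → ℂ} (hu : MemL2Loc u) (T : ℝ) {δ : ℝ} (hδ : 0 < δ) :
    ∃ g : ℝ → ℂ, ContDiff ℝ ∞ g ∧ HasCompactSupport g ∧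
      ∫ s in Ioc 0 T, ‖u s - g s‖ ^ 2 ≤ δ := by
  have hd := Lp.dense_hasCompactSupport_contDiff (E := ℝ) (F := ℂ)
    (μ := volume.restrict (Ioc 0 T)) (p := 2) (by simp)
  obtain ⟨f, hf, g, hfg, hgs, hg⟩ := Metric.dense_iff.1 hd ((hu.memLp T).toLp u) (√δ)
    (Real.sqrt_pos.2 hδ)
  refine ⟨g, hg, hgs, ?_⟩
  rw [Metric.mem_ball, dist_comm, dist_eq_norm] at hf
  have h2 : ‖(hu.memLp T).toLp u - f‖ ^ 2 ≤ δ := by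
    have := pow_le_pow_left₀ (norm_nonneg _) hf.le 2
    rwa [Real.sq_sqrt hδ.le] at this
  rw [← inner_self_eq_norm_sq (𝕜 := ℂ), L2.inner_def] at h2
  refine le_trans (le_of_eq ?_) h2
  have e : (∫ a in Ioc 0 T, inner ℂ (((hu.memLp T).toLp u - f : Lp ℂ 2 (volume.restrict (Ioc 0 T))) a)
        (((hu.memLp T).toLp u - f : Lp ℂ 2 (volume.restrict (Ioc 0 T))) a))
      = ((∫ s in Ioc 0 T, ‖u s - g s‖ ^ 2 : ℝ) : ℂ) := by
    rw [← integral_complex_ofReal]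
    refine integral_congr_ae ?_
    filter_upwards [hfg, (hu.memLp T).coeFn_toLp, Lp.coeFn_sub ((hu.memLp T).toLp u) f]
      with s h1 h2 h3
    rw [h3, Pi.sub_apply, h1, h2, inner_self_eq_norm_sq_to_K]
    push_cast; rfl
  rw [e]; simp

/-- Write `u = (u - g) + g` with `g` smooth. The large sieve bounds the whole sum for `u - g`
uniformly in `h` and `t ≤ T`, while the coefficients of `g` decay like `1 / freq`, so that their
weighted tails are dominated by those of `1 / k`. The cases `c = 1` and `c = -1` give the two
exponentials of a sine or cosine. -/
lemma uniformTails_exp {u : ℝ → ℂ} (hu : MemL2Loc u) (T : ℝ) {c : ℝ} (hc : c ^ 2 = 1) :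
    UniformTails {p : ℝ × ℝ | p.2 ≤ T} (fun p k => tanhc (p.1 * k) *
      ∫ s in Ioc 0 p.2, Complex.exp (Complex.I * (c * freq p.1 k : ℝ) * s) * u s) := by
  wlog hT : 0 ≤ T generalizing T
  · intro ε hε
    obtain ⟨N, hN⟩ := this 0 le_rfl ε hε
    exact ⟨N, fun x hx => hN x (le_trans hx (le_of_not_ge hT))⟩
  have hcabs : |c| = 1 := by
    rw [← Real.sqrt_sq_eq_abs, hc, Real.sqrt_one]
  intro ε hε
  have hA := admConst_pos T
  -- After multiplication by `admConst T` this error is exactly `ε / 4`.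
  obtain ⟨g, hg, hgs, hug⟩ := exists_smooth_approx hu T (δ := ε / (4 * admConst T)) (by positivity)
  obtain ⟨M₁, hM₁⟩ := hg.continuous.bounded_above_of_compact_support hgs
  obtain ⟨M₂, hM₂⟩ := (hg.continuous_deriv (by simp)).bounded_above_of_compact_support hgs.deriv
  set M := max M₁ M₂ with hM
  have hsum : Summable fun k : ℕ => ‖((1 / k : ℝ) : ℂ)‖ ^ 2 := by
    have : ∀ k : ℕ, ‖((1 / k : ℝ) : ℂ)‖ ^ 2 = 1 / (k : ℝ) ^ 2 := fun k => by
      rw [Complex.norm_real, Real.norm_of_nonneg (by positivity), div_pow, one_pow]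
    simp_rw [this]
    exact Real.summable_one_div_nat_pow.2 one_lt_two
  have htail := (UniformTails.const (S := (univ : Set Unit)) hsum).of_norm_le
    (f := fun _ k => (((2 + T) * M / k : ℝ) : ℂ)) (C := |(2 + T) * M|) (by
      intro _ _ k _
      rw [Complex.norm_real, Complex.norm_real, Real.norm_eq_abs, Real.norm_eq_abs, ← abs_mul]
      rw [mul_one_div])
  obtain ⟨N, hN⟩ := htail (ε / 4) (by positivity)
  refine ⟨max N 1, fun p hp m => ?_⟩
  obtain ⟨h, t⟩ := p
  simp only [mem_ofPred_eq] at hp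
  simp only
  set v : ℝ → ℂ := fun s => u s - g s with hv
  have hgm : MemLp g 2 (volume.restrict (Ioc 0 t)) :=
    (hg.continuous.memLp_of_hasCompactSupport hgs).restrict _
  have hvm : MemLp v 2 (volume.restrict (Ioc 0 t)) := (hu.memLp t).sub hgm
  have hvT : MemLp v 2 (volume.restrict (Ioc 0 T)) :=
    (hu.memLp T).sub ((hg.continuous.memLp_of_hasCompactSupport hgs).restrict _)
  have hbdd : ∀ (x : ℝ) {w : ℝ → ℂ}, MemLp w 2 (volume.restrict (Ioc 0 t)) →
      Integrable (fun s : ℝ => Complex.exp (Complex.I * x * s) * w s) (volume.restrict (Ioc 0 t)) :=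
    fun x w hw => (hw.integrable one_le_two).bdd_mul (c := 1) (by fun_prop)
      (Eventually.of_forall fun s => (norm_exp_I_mul x s).le)
  have hadm := sum_norm_sq_integral_exp_le (ν := fun k => c * freq h k) (β := fun k => tanhc (h * k))
    (fun k => (tanhc_pos _).le) (fun j k => by
      rw [← mul_sub, mul_pow, hc, one_mul]
      exact tanhc_mul_tanhc_le h j k) (Finset.Ico (max N 1) m) t hvm
  have hadm' : admConst t * ∫ s in Ioc 0 t, ‖v s‖ ^ 2 ≤ ε / 4 := by
    calc _ ≤ admConst T * ∫ s in Ioc 0 T, ‖v s‖ ^ 2 := by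
          refine mul_le_mul (admConst_mono hp) ?_ (integral_nonneg fun _ => by positivity) hA.le
          exact setIntegral_mono_set (hvT.integrable_norm_pow' ) (Eventually.of_forall fun s => by positivity)
            (Ioc_subset_Ioc_right hp).eventuallyLE
      _ ≤ admConst T * (ε / (4 * admConst T)) := by gcongr
      _ = ε / 4 := by field_simp
  have hNm := (Finset.sum_le_sum_of_subset_of_nonneg (f := fun k : ℕ => ‖(((2 + T) * M / k : ℝ) : ℂ)‖ ^ 2)
    (Finset.Ico_subset_Ico_left (le_max_left N 1)) fun _ _ _ => by positivity).trans (hN () trivial m)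
  calc _ ≤ ∑ k ∈ Finset.Ico (max N 1) m,
        (2 * (tanhc (h * k) * ‖∫ s in Ioc 0 t, Complex.exp (Complex.I * (c * freq h k : ℝ) * s) * v s‖) ^ 2
          + 2 * ‖(((2 + T) * M / k : ℝ) : ℂ)‖ ^ 2) := by
        refine Finset.sum_le_sum fun k hk => ?_
        have hk1 : 1 ≤ k := (le_max_right _ _).trans (Finset.mem_Ico.1 hk).1
        have hk0 : (0 : ℝ) < k := by exact_mod_cast hk1
        have hsplit : ∫ s in Ioc 0 t, Complex.exp (Complex.I * (c * freq h k : ℝ) * s) * u s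
            = (∫ s in Ioc 0 t, Complex.exp (Complex.I * (c * freq h k : ℝ) * s) * v s)
              + ∫ s in Ioc 0 t, Complex.exp (Complex.I * (c * freq h k : ℝ) * s) * g s := by
          rw [← integral_add (hbdd _ hvm) (hbdd _ hgm)]
          congr 1; ext s; rw [hv]; ring
        have hf := freq_pos h hk1
        have hb := norm_integral_exp_mul_le (x := c * freq h k) (hg.of_le (by simp))
          (fun s => (hM₁ s).trans (le_max_left _ _)) (fun s => (hM₂ s).trans (le_max_right _ _))
          (mul_ne_zero (fun h0 => by simp [h0] at hcabs) hf.ne') hp hT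
        rw [abs_mul, hcabs, one_mul, abs_of_pos hf] at hb
        have hM0 : 0 ≤ M := (norm_nonneg (g 0)).trans ((hM₁ 0).trans (le_max_left _ _))
        have ht0 := tanhc_pos (h * k)
        have hfk : tanhc (h * k) * ((2 + T) * M / freq h k) ≤ (2 + T) * M / k := by
          rw [mul_div_assoc', div_le_div_iff₀ hf hk0]
          -- This is `tanhc ≤ √tanhc`, valid because `tanhc ≤ 1`.
          have : tanhc (h * k) * k ≤ freq h k := by
            rw [freq, mul_comm]
            refine mul_le_mul_of_nonneg_left ?_ hk0.le
            exact Real.le_sqrt_of_sq_le (by nlinarith [tanhc_le_one (h * k)])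
          have := mul_le_mul_of_nonneg_left this (show 0 ≤ (2 + T) * M by positivity)
          linarith
        rw [hsplit, norm_mul, Complex.norm_real, Real.norm_of_nonneg ht0.le, Complex.norm_real,
          Real.norm_of_nonneg (by positivity)]
        set A := ∫ s in Ioc 0 t, Complex.exp (Complex.I * (c * freq h k : ℝ) * s) * v s
        set B := ∫ s in Ioc 0 t, Complex.exp (Complex.I * (c * freq h k : ℝ) * s) * g s
        have h3 : tanhc (h * k) * ‖A + B‖ ≤ tanhc (h * k) * ‖A‖ + (2 + T) * M / k := by
          have := mul_le_mul_of_nonneg_left (norm_add_le A B) ht0.le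
          have := mul_le_mul_of_nonneg_left hb ht0.le
          linarith
        have := pow_le_pow_left₀ (by positivity) h3 2
        nlinarith [sq_nonneg (tanhc (h * k) * ‖A‖ - (2 + T) * M / k)]
    _ ≤ 2 * (ε / 4) + 2 * (ε / 4) := by
        rw [Finset.sum_add_distrib, ← Finset.mul_sum, ← Finset.mul_sum]
        gcongr
        exact hadm.trans hadm'
    _ = ε := by ring

end

noncomputable section

/-! ### The scalar oscillators -/

/-- The solution of `y'' + w² y = β U'`, `y(0) = a`, `y'(0) = b`. -/
def oscPos (w β : ℝ) (a b : ℂ) (U : ℝ → ℂ) (t : ℝ) : ℂ :=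
  Real.cos (w * t) * a + (t * Real.sinc (w * t) : ℝ) * b
    + β * ∫ s in (0 : ℝ)..t, (Real.cos (w * (t - s)) : ℂ) * U s

/-- The derivative of `oscPos`. -/
def oscVel (w β : ℝ) (a b : ℂ) (U : ℝ → ℂ) (t : ℝ) : ℂ :=
  -(w * Real.sin (w * t) : ℝ) * a + Real.cos (w * t) * b
    + β * (U t - w * ∫ s in (0 : ℝ)..t, (Real.sin (w * (t - s)) : ℂ) * U s)

section Oscillator

variable {w β : ℝ} {a b : ℂ} {U : ℝ → ℂ}

lemma oscPos_zero : oscPos w β a b U 0 = a := by simp [oscPos]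

lemma oscVel_zero (hU : U 0 = 0) : oscVel w β a b U 0 = b := by simp [oscVel, hU]

lemma hasDerivAt_ofReal_cos_mul (w t : ℝ) :
    HasDerivAt (fun t : ℝ => (Real.cos (w * t) : ℂ)) (-(w * Real.sin (w * t) : ℝ)) t := by
  have h : HasDerivAt (fun t : ℝ => Real.cos (w * t)) (-Real.sin (w * t) * (w * 1)) t :=
    ((hasDerivAt_id t).const_mul w).cos
  convert h.ofReal_comp using 1
  push_cast; ring

lemma hasDerivAt_ofReal_sin_mul (w t : ℝ) :
    HasDerivAt (fun t : ℝ => (Real.sin (w * t) : ℂ)) (w * Real.cos (w * t) : ℝ) t := by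
  have h : HasDerivAt (fun t : ℝ => Real.sin (w * t)) (Real.cos (w * t) * (w * 1)) t :=
    ((hasDerivAt_id t).const_mul w).sin
  convert h.ofReal_comp using 1
  push_cast; ring

/-- The function `t sinc (w t)` is `sin (w t) / w` continued to `w = 0`, so the zero mode needs no
separate formula. -/
lemma hasDerivAt_mul_sinc (w t : ℝ) :
    HasDerivAt (fun t : ℝ => t * Real.sinc (w * t)) (Real.cos (w * t)) t := by
  rcases eq_or_ne w 0 with rfl | hw
  · simpa using hasDerivAt_id' t
  · have e : (fun t : ℝ => t * Real.sinc (w * t)) = fun t => Real.sin (w * t) / w := by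
      ext t
      rcases eq_or_ne t 0 with rfl | ht
      · simp
      · rw [Real.sinc_of_ne_zero (mul_ne_zero hw ht)]; field_simp
    rw [e]
    have h : HasDerivAt (fun t : ℝ => Real.sin (w * t)) (Real.cos (w * t) * (w * 1)) t :=
      ((hasDerivAt_id t).const_mul w).sin
    exact (h.div_const w).congr_deriv (by field_simp)

lemma mul_sinc_eq (w t : ℝ) : w * (t * Real.sinc (w * t)) = Real.sin (w * t) := by
  rcases eq_or_ne (w * t) 0 with h | h
  · rw [← mul_assoc, h]; simp
  · rw [Real.sinc_of_ne_zero h]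
    have := left_ne_zero_of_mul h
    have := right_ne_zero_of_mul h
    field_simp

/-- The addition formula takes `t` out of the integrand, after which the fundamental theorem of
calculus differentiates the Duhamel term. -/
lemma integral_cos_sub_mul (hU : Continuous U) (w t : ℝ) :
    ∫ s in (0 : ℝ)..t, (Real.cos (w * (t - s)) : ℂ) * U s
      = Real.cos (w * t) * (∫ s in (0 : ℝ)..t, (Real.cos (w * s) : ℂ) * U s)
        + Real.sin (w * t) * ∫ s in (0 : ℝ)..t, (Real.sin (w * s) : ℂ) * U s := by
  rw [← intervalIntegral.integral_const_mul, ← intervalIntegral.integral_const_mul,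
    ← intervalIntegral.integral_add (Continuous.intervalIntegrable (by fun_prop) _ _)
      (Continuous.intervalIntegrable (by fun_prop) _ _)]
  refine intervalIntegral.integral_congr fun s _ => ?_
  rw [mul_sub, Real.cos_sub]
  push_cast; ring

lemma integral_sin_sub_mul (hU : Continuous U) (w t : ℝ) :
    ∫ s in (0 : ℝ)..t, (Real.sin (w * (t - s)) : ℂ) * U s
      = Real.sin (w * t) * (∫ s in (0 : ℝ)..t, (Real.cos (w * s) : ℂ) * U s)
        - Real.cos (w * t) * ∫ s in (0 : ℝ)..t, (Real.sin (w * s) : ℂ) * U s := by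
  rw [← intervalIntegral.integral_const_mul, ← intervalIntegral.integral_const_mul,
    ← intervalIntegral.integral_sub (Continuous.intervalIntegrable (by fun_prop) _ _)
      (Continuous.intervalIntegrable (by fun_prop) _ _)]
  refine intervalIntegral.integral_congr fun s _ => ?_
  rw [mul_sub, Real.sin_sub]
  push_cast; ring

lemma hasDerivAt_integral_cos_sub_mul (hU : Continuous U) (w t : ℝ) :
    HasDerivAt (fun t => ∫ s in (0 : ℝ)..t, (Real.cos (w * (t - s)) : ℂ) * U s)
      (U t - w * ∫ s in (0 : ℝ)..t, (Real.sin (w * (t - s)) : ℂ) * U s) t := by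
  have hC : HasDerivAt (fun t => ∫ s in (0 : ℝ)..t, (Real.cos (w * s) : ℂ) * U s)
    ((Real.cos (w * t) : ℂ) * U t) t :=
    (show Continuous fun s : ℝ => (Real.cos (w * s) : ℂ) * U s by fun_prop).integral_hasStrictDerivAt 0 t
      |>.hasDerivAt
  have hS : HasDerivAt (fun t => ∫ s in (0 : ℝ)..t, (Real.sin (w * s) : ℂ) * U s)
    ((Real.sin (w * t) : ℂ) * U t) t :=
    (show Continuous fun s : ℝ => (Real.sin (w * s) : ℂ) * U s by fun_prop).integral_hasStrictDerivAt 0 t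
      |>.hasDerivAt
  have h := ((hasDerivAt_ofReal_cos_mul w t).mul hC).add ((hasDerivAt_ofReal_sin_mul w t).mul hS)
  refine (h.congr_deriv ?_).congr_of_eventuallyEq
    (Eventually.of_forall fun t => integral_cos_sub_mul hU w t)
  rw [integral_sin_sub_mul hU]
  have hcs : (Real.cos (w * t) : ℂ) ^ 2 + (Real.sin (w * t) : ℂ) ^ 2 = 1 := by
    exact_mod_cast Real.cos_sq_add_sin_sq (w * t)
  push_cast at hcs ⊢
  linear_combination U t * hcs

lemma hasDerivAt_integral_sin_sub_mul (hU : Continuous U) (w t : ℝ) :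
    HasDerivAt (fun t => ∫ s in (0 : ℝ)..t, (Real.sin (w * (t - s)) : ℂ) * U s)
      (w * ∫ s in (0 : ℝ)..t, (Real.cos (w * (t - s)) : ℂ) * U s) t := by
  have hC : HasDerivAt (fun t => ∫ s in (0 : ℝ)..t, (Real.cos (w * s) : ℂ) * U s)
    ((Real.cos (w * t) : ℂ) * U t) t :=
    (show Continuous fun s : ℝ => (Real.cos (w * s) : ℂ) * U s by fun_prop).integral_hasStrictDerivAt 0 t
      |>.hasDerivAt
  have hS : HasDerivAt (fun t => ∫ s in (0 : ℝ)..t, (Real.sin (w * s) : ℂ) * U s)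
    ((Real.sin (w * t) : ℂ) * U t) t :=
    (show Continuous fun s : ℝ => (Real.sin (w * s) : ℂ) * U s by fun_prop).integral_hasStrictDerivAt 0 t
      |>.hasDerivAt
  have h := ((hasDerivAt_ofReal_sin_mul w t).mul hC).sub ((hasDerivAt_ofReal_cos_mul w t).mul hS)
  refine (h.congr_deriv ?_).congr_of_eventuallyEq
    (Eventually.of_forall fun t => integral_sin_sub_mul hU w t)
  rw [integral_cos_sub_mul hU]
  push_cast
  ring

lemma hasDerivAt_oscPos (hU : Continuous U) (t : ℝ) :
    HasDerivAt (oscPos w β a b U) (oscVel w β a b U t) t :=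
  (((hasDerivAt_ofReal_cos_mul w t).mul_const a).add
    ((hasDerivAt_mul_sinc w t).ofReal_comp.mul_const b)).add
    ((hasDerivAt_integral_cos_sub_mul hU w t).const_mul (β : ℂ))

lemma continuous_oscPos (hU : Continuous U) : Continuous (oscPos w β a b U) :=
  continuous_iff_continuousAt.2 fun t => (hasDerivAt_oscPos hU t).continuousAt

/-- The integrated oscillator equation, meaningful for merely continuous `U`: although `oscVel` need
not be differentiable, `oscVel - β U` is, with derivative `-w² oscPos`. -/
lemma oscVel_sub (hU : Continuous U) (t : ℝ) :
    oscVel w β a b U t - b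
      = -(w : ℂ) ^ 2 * (∫ s in (0 : ℝ)..t, oscPos w β a b U s) + β * U t := by
  have hd : ∀ t, HasDerivAt (fun t => -(w * Real.sin (w * t) : ℂ) * a + Real.cos (w * t) * b
      - β * w * ∫ s in (0 : ℝ)..t, (Real.sin (w * (t - s)) : ℂ) * U s)
      (-(w : ℂ) ^ 2 * oscPos w β a b U t) t := fun t => by
    have h := ((((hasDerivAt_ofReal_sin_mul w t).const_mul (w : ℂ)).neg.mul_const a).add
      ((hasDerivAt_ofReal_cos_mul w t).mul_const b)).sub
      ((hasDerivAt_integral_sin_sub_mul hU w t).const_mul (β * w : ℂ))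
    refine h.congr_deriv ?_
    rw [oscPos]
    have := congrArg (fun x : ℝ => (x : ℂ)) (mul_sinc_eq w t)
    push_cast at this ⊢
    linear_combination (w : ℂ) * b * this
  rw [← intervalIntegral.integral_const_mul, intervalIntegral.integral_eq_sub_of_hasDerivAt
    (fun s _ => hd s) (((continuous_oscPos hU).const_mul _).intervalIntegrable _ _), oscVel]
  simp
  ring

/-- Uniqueness for the integrated oscillator equation. -/
lemma eq_oscPos_of_hasDerivWithinAt (hU : Continuous U) {y : ℝ → ℂ} (h0 : y 0 = a)
    (hy : ∀ t, 0 ≤ t → HasDerivWithinAt y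
      (b - (w : ℂ) ^ 2 * (∫ s in (0 : ℝ)..t, y s) + β * U t) (Ici 0) t) {t : ℝ} (ht : 0 ≤ t) :
    y t = oscPos w β a b U t := by
  set x := oscPos w β a b U with hx
  have hyc : ContinuousOn y (Ici 0) := fun t ht => (hy t ht).continuousWithinAt
  -- Freezing the difference at its value in `0` for negative times makes it continuous on the line.
  set d : ℝ → ℂ := fun t => y (max t 0) - x (max t 0) with hd
  have hdc : Continuous d :=
    (hyc.comp_continuous (by fun_prop) fun t => mem_Ici.2 (le_max_right _ _)).sub
      ((continuous_oscPos hU).comp (by fun_prop))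
  set D : ℝ → ℂ := fun t => ∫ s in (0 : ℝ)..t, d s with hD
  have hDd : ∀ t, HasDerivAt D (d t) t := fun t => (hdc.integral_hasStrictDerivAt 0 t).hasDerivAt
  have hde : ∀ t, 0 ≤ t → d t = y t - x t := fun t ht => by simp [hd, ht]
  have hDe : ∀ t, 0 ≤ t → D t = (∫ s in (0 : ℝ)..t, y s) - ∫ s in (0 : ℝ)..t, x s := fun t ht => by
    rw [← intervalIntegral.integral_sub]
    · refine intervalIntegral.integral_congr fun s hs => ?_
      rw [uIcc_of_le ht] at hs
      exact hde s hs.1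
    · exact (hyc.mono (by rw [uIcc_of_le ht]; exact Icc_subset_Ici_self)).intervalIntegrable
    · exact (continuous_oscPos hU).intervalIntegrable _ _
  have hdd : ∀ t, 0 ≤ t → HasDerivWithinAt d (-(w : ℂ) ^ 2 * D t) (Ici t) t := fun t ht => by
    have h1 : HasDerivWithinAt (fun t => y t - x t) (-(w : ℂ) ^ 2 * D t) (Ici 0) t := by
      refine ((hy t ht).sub (hasDerivAt_oscPos hU t).hasDerivWithinAt).congr_deriv ?_
      rw [hDe t ht]
      linear_combination -(oscVel_sub (w := w) (β := β) (a := a) (b := b) hU t)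
    exact (h1.congr (fun s hs => hde s hs) (hde t ht)).mono (Ici_subset_Ici.2 ht)
  -- In the difference the term `β U` cancels, so `(D, d)` solves the linear system `D' = d`, `d' =
  -- -w² D` with zero data; the Lipschitz uniqueness theorem applies.
  let L : ℂ × ℂ →L[ℝ] ℂ × ℂ := (ContinuousLinearMap.snd ℝ ℂ ℂ).prod
    ((-(w ^ 2)) • ContinuousLinearMap.fst ℝ ℂ ℂ)
  have huniq := ODE_solution_unique_of_mem_Icc_right (v := fun _ => L) (s := fun _ => univ)
    (f := fun t => (D t, d t)) (g := fun _ => 0) (a := 0) (b := t) (K := ‖L‖₊)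
    (fun t _ => L.lipschitz.lipschitzOnWith)
    ((continuous_iff_continuousAt.2 fun t => (hDd t).continuousAt).prodMk hdc).continuousOn
    (fun t ht => by
      refine ((hDd t).hasDerivWithinAt.prodMk (hdd t ht.1)).congr_deriv ?_
      simp [L])
    (fun _ _ => trivial) continuousOn_const
    (fun t _ => by simpa using hasDerivWithinAt_const t (Ici t) (0 : ℂ × ℂ)) (fun _ _ => trivial)
    (by simp [hD, hd, h0, hx, oscPos_zero])
  have := huniq (right_mem_Icc.2 ht)
  have h2 : d t = 0 := congrArg Prod.snd this
  rw [hde t ht] at h2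
  exact sub_eq_zero.1 h2

end Oscillator

end

noncomputable section

/-! ### The evolution in `L²[0, π]` -/

/-- The `k`-th cosine coefficient of the solution at time `t`. -/
def posCoeff (u : ℝ → ℂ) (ζ₀ ζ₁ : H) (h t : ℝ) (k : ℕ) : ℂ :=
  oscPos (freq h k) (-(amp k * tanhc (h * k))) (cosCoeff ζ₀ k) (cosCoeff ζ₁ k) (primitive u) t

/-- The `k`-th cosine coefficient of the velocity at time `t`. -/
def velCoeff (u : ℝ → ℂ) (ζ₀ ζ₁ : H) (h t : ℝ) (k : ℕ) : ℂ :=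
  oscVel (freq h k) (-(amp k * tanhc (h * k))) (cosCoeff ζ₀ k) (cosCoeff ζ₁ k) (primitive u) t

section Evolution

variable {u : ℝ → ℂ} {ζ₀ ζ₁ : H}

lemma continuous_velCoeff (hu : MemL2Loc u) (k : ℕ) :
    Continuous fun p : ℝ × ℝ => velCoeff u ζ₀ ζ₁ p.1 p.2 k := by
  have hU := continuous_primitive hu
  have hf := continuous_freq k
  have ht := continuous_tanhc
  have hint : Continuous fun p : ℝ × ℝ => ∫ s in (0 : ℝ)..p.2,
      (Real.sin (freq p.1 k * (p.2 - s)) : ℂ) * primitive u s :=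
    intervalIntegral.continuous_parametric_intervalIntegral_of_continuous
      (f := fun (p : ℝ × ℝ) s => (Real.sin (freq p.1 k * (p.2 - s)) : ℂ) * primitive u s)
      (by unfold Function.uncurry; fun_prop) continuous_snd
  unfold velCoeff oscVel
  fun_prop

lemma continuous_posCoeff (hu : MemL2Loc u) (k : ℕ) :
    Continuous fun p : ℝ × ℝ => posCoeff u ζ₀ ζ₁ p.1 p.2 k := by
  have hU := continuous_primitive hu
  have hf := continuous_freq k
  have ht := continuous_tanhc
  have hs := Real.continuous_sinc
  have hint : Continuous fun p : ℝ × ℝ => ∫ s in (0 : ℝ)..p.2,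
      (Real.cos (freq p.1 k * (p.2 - s)) : ℂ) * primitive u s :=
    intervalIntegral.continuous_parametric_intervalIntegral_of_continuous
      (f := fun (p : ℝ × ℝ) s => (Real.cos (freq p.1 k * (p.2 - s)) : ℂ) * primitive u s)
      (by unfold Function.uncurry; fun_prop) continuous_snd
  unfold posCoeff oscPos
  fun_prop

lemma integrable_exp_mul (hu : MemL2Loc u) (x t : ℝ) :
    Integrable (fun s : ℝ => Complex.exp (Complex.I * x * s) * u s) (volume.restrict (Ioc 0 t)) :=
  (hu.integrableOn t).bdd_mul (c := 1) (by fun_prop)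
    (Eventually.of_forall fun s => (norm_exp_I_mul x s).le)

/-- Integration by parts trades the primitive for `u` itself against `cos (w (t - s))`; splitting
the cosine into exponentials produces the integrals controlled by `uniformTails_exp`. -/
lemma primitive_sub_integral_sin (hu : MemL2Loc u) (w t : ℝ) :
    primitive u t - w * (∫ s in (0 : ℝ)..t, (Real.sin (w * (t - s)) : ℂ) * primitive u s)
      = Complex.exp (Complex.I * w * t) / 2
          * (∫ s in Ioc 0 t, Complex.exp (Complex.I * ((-1) * w : ℝ) * s) * u s)
        + Complex.exp (-(Complex.I * w * t)) / 2
          * ∫ s in Ioc 0 t, Complex.exp (Complex.I * (1 * w : ℝ) * s) * u s := by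
  have hκ : ∀ s : ℝ, HasDerivAt (fun s : ℝ => (Real.cos (w * (t - s)) : ℂ))
      ((w * Real.sin (w * (t - s)) : ℝ) : ℂ) s := fun s => by
    have h : HasDerivAt (fun s : ℝ => Real.cos (w * (t - s)))
      (-Real.sin (w * (t - s)) * (w * -1)) s :=
      (((hasDerivAt_id s).const_sub t).const_mul w).cos
    exact (h.congr_deriv (by ring)).ofReal_comp
  have hp := integral_mul_eq_sub_integral_deriv_mul_primitive hu hκ (by fun_prop) t
  rw [← integral_const_mul, ← integral_const_mul, ← integral_add
    ((integrable_exp_mul hu _ _).const_mul _) ((integrable_exp_mul hu _ _).const_mul _)]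
  rw [← intervalIntegral.integral_const_mul]
  simp only [sub_self, mul_zero, Real.cos_zero, Complex.ofReal_one, one_mul] at hp
  rw [← one_mul (primitive u t)]
  simp only [one_mul]
  calc _ = ∫ s in Ioc 0 t, (Real.cos (w * (t - s)) : ℂ) * u s := by
        rw [hp]; congr 2; ext s; push_cast; ring
    _ = _ := by
        congr 1; ext s
        rw [Complex.ofReal_cos, Complex.cos, show ((w * (t - s) : ℝ) : ℂ) * Complex.I
          = Complex.I * w * t + Complex.I * ((-1) * w : ℝ) * s by push_cast; ring,
          show -((w * (t - s) : ℝ) : ℂ) * Complex.I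
          = -(Complex.I * w * t) + Complex.I * w * s by push_cast; ring,
          Complex.exp_add, Complex.exp_add]
        ring

/-- The counterpart for the position, with kernel `sin (w (t - s))`; the factor `w` in front is why
only positions multiplied by their frequency are estimated. -/
lemma mul_integral_cos (hu : MemL2Loc u) (w t : ℝ) :
    w * (∫ s in (0 : ℝ)..t, (Real.cos (w * (t - s)) : ℂ) * primitive u s)
      = Complex.exp (Complex.I * w * t) / (2 * Complex.I)
          * (∫ s in Ioc 0 t, Complex.exp (Complex.I * ((-1) * w : ℝ) * s) * u s)
        + -Complex.exp (-(Complex.I * w * t)) / (2 * Complex.I)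
          * ∫ s in Ioc 0 t, Complex.exp (Complex.I * (1 * w : ℝ) * s) * u s := by
  have hκ : ∀ s : ℝ, HasDerivAt (fun s : ℝ => (Real.sin (w * (t - s)) : ℂ))
      ((-(w * Real.cos (w * (t - s))) : ℝ) : ℂ) s := fun s => by
    have h : HasDerivAt (fun s : ℝ => Real.sin (w * (t - s)))
      (Real.cos (w * (t - s)) * (w * -1)) s :=
      (((hasDerivAt_id s).const_sub t).const_mul w).sin
    exact (h.congr_deriv (by ring)).ofReal_comp
  have hp := integral_mul_eq_sub_integral_deriv_mul_primitive hu hκ (by fun_prop) t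
  rw [← integral_const_mul, ← integral_const_mul, ← integral_add
    ((integrable_exp_mul hu _ _).const_mul _) ((integrable_exp_mul hu _ _).const_mul _)]
  rw [← intervalIntegral.integral_const_mul]
  simp only [sub_self, mul_zero, Real.sin_zero, Complex.ofReal_zero, zero_mul, zero_sub,
    ← intervalIntegral.integral_neg] at hp
  calc _ = ∫ s in Ioc 0 t, (Real.sin (w * (t - s)) : ℂ) * u s := by
        rw [hp]; congr 1; ext s; push_cast; ring
    _ = _ := by
        congr 1; ext s
        rw [Complex.ofReal_sin, Complex.sin, show ((w * (t - s) : ℝ) : ℂ) * Complex.I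
          = Complex.I * w * t + Complex.I * ((-1) * w : ℝ) * s by push_cast; ring,
          show -((w * (t - s) : ℝ) : ℂ) * Complex.I
          = -(Complex.I * w * t) + Complex.I * w * s by push_cast; ring,
          Complex.exp_add, Complex.exp_add]
        have := Complex.I_mul_I
        field_simp
        rw [Complex.I_sq]
        ring

/-- A sequence dominating all the mode coefficients. -/
lemma uniformTails_expSum (hu : MemL2Loc u) (T : ℝ) {e₁ e₂ : ℝ × ℝ → ℕ → ℂ}
    (h₁ : ∀ p k, ‖e₁ p k‖ ≤ 1) (h₂ : ∀ p k, ‖e₂ p k‖ ≤ 1) :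
    UniformTails {p : ℝ × ℝ | p.2 ≤ T} (fun p k =>
      e₁ p k * (tanhc (p.1 * k) *
        ∫ s in Ioc 0 p.2, Complex.exp (Complex.I * ((-1) * freq p.1 k : ℝ) * s) * u s)
      + e₂ p k * (tanhc (p.1 * k) *
        ∫ s in Ioc 0 p.2, Complex.exp (Complex.I * (1 * freq p.1 k : ℝ) * s) * u s)) :=
  ((uniformTails_exp hu T (c := -1) (by norm_num)).of_norm_le (C := 1) fun p _ k _ => by
      rw [norm_mul]; exact mul_le_mul_of_nonneg_right (h₁ p k) (norm_nonneg _)).add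
    ((uniformTails_exp hu T (c := 1) (by norm_num)).of_norm_le (C := 1) fun p _ k _ => by
      rw [norm_mul]; exact mul_le_mul_of_nonneg_right (h₂ p k) (norm_nonneg _))

lemma norm_exp_I_mul_mul (x t : ℝ) : ‖Complex.exp (-(Complex.I * x * t))‖ = 1 := by
  rw [Complex.exp_neg, norm_inv, norm_exp_I_mul, inv_one]

lemma norm_amp_le (k : ℕ) : ‖(-(amp k : ℂ))‖ ≤ 1 := by
  rw [norm_neg, Complex.norm_real, Real.norm_of_nonneg (amp_pos k).le]; exact amp_le_one k

/-- The regularity of `ζ₀` enters here: its contribution carries a factor `freq h k ≤ k`. -/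
lemma uniformTails_velCoeff (hu : MemL2Loc u) (hζ₀ : Summable fun k : ℕ => ‖k * cosCoeff ζ₀ k‖ ^ 2)
    (T : ℝ) : UniformTails {p : ℝ × ℝ | p.2 ≤ T} (fun p k => velCoeff u ζ₀ ζ₁ p.1 p.2 k) := by
  have h0 : UniformTails {p : ℝ × ℝ | p.2 ≤ T}
      (fun p k => -(freq p.1 k * Real.sin (freq p.1 k * p.2) : ℝ) * cosCoeff ζ₀ k) :=
    (UniformTails.const hζ₀).of_norm_le (C := 1) fun p _ k _ => by
      rw [norm_mul, norm_mul, norm_neg, Complex.norm_real, one_mul, norm_mul,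
        Real.norm_of_nonneg (freq_nonneg _ _), Real.norm_eq_abs, Complex.norm_natCast]
      refine mul_le_mul_of_nonneg_right ?_ (norm_nonneg _)
      calc _ ≤ (k : ℝ) * 1 := mul_le_mul (freq_le _ _) (Real.abs_sin_le_one _) (abs_nonneg _)
            (Nat.cast_nonneg _)
        _ = k := mul_one _
  have h1 : UniformTails {p : ℝ × ℝ | p.2 ≤ T}
      (fun p k => Real.cos (freq p.1 k * p.2) * cosCoeff ζ₁ k) :=
    (UniformTails.const (hasSum_norm_sq_cosCoeff ζ₁).summable).of_norm_le (C := 1) fun p _ k _ => by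
      rw [norm_mul, Complex.norm_real]
      exact mul_le_mul_of_nonneg_right (Real.abs_cos_le_one _) (norm_nonneg _)
  have h2 := uniformTails_expSum hu T
    (e₁ := fun p k => -(amp k : ℂ) * (Complex.exp (Complex.I * freq p.1 k * p.2) / 2))
    (e₂ := fun p k => -(amp k : ℂ) * (Complex.exp (-(Complex.I * freq p.1 k * p.2)) / 2))
    (fun p k => by
      rw [norm_mul, norm_div, norm_exp_I_mul, Complex.norm_two]
      linarith [norm_amp_le k])
    (fun p k => by
      rw [norm_mul, norm_div, norm_exp_I_mul_mul, Complex.norm_two]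
      linarith [norm_amp_le k])
  refine ((h0.add h1).add h2).of_norm_le (C := 1) fun p _ k _ => ?_
  rw [one_mul, velCoeff, oscVel, primitive_sub_integral_sin hu]
  refine le_of_eq (congrArg norm ?_)
  push_cast; ring

/-- Multiplied by its frequency, a position has the same structure as a velocity, so any weight
dominated by the frequencies is allowed. It is applied with `halfWeight` for bounded `h`, and with
`k` itself for `h = 0`, where the frequency equals `k`. -/
lemma uniformTails_posCoeff (hu : MemL2Loc u) (hζ₀ : Summable fun k : ℕ => ‖k * cosCoeff ζ₀ k‖ ^ 2)
    {T C : ℝ} {S : Set (ℝ × ℝ)} (hS : S ⊆ {p : ℝ × ℝ | p.2 ≤ T}) (W : ℕ → ℝ)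
    (hW : ∀ p ∈ S, ∀ k, 1 ≤ k → |W k| ≤ C * freq p.1 k) :
    UniformTails S (fun p k => W k * posCoeff u ζ₀ ζ₁ p.1 p.2 k) := by
  have h0 : UniformTails S (fun p k => (freq p.1 k * Real.cos (freq p.1 k * p.2) : ℝ) * cosCoeff ζ₀ k) :=
    (UniformTails.const hζ₀).of_norm_le (C := 1) fun p _ k _ => by
      rw [norm_mul, norm_mul, Complex.norm_real, one_mul, norm_mul,
        Real.norm_of_nonneg (freq_nonneg _ _), Real.norm_eq_abs, Complex.norm_natCast]
      refine mul_le_mul_of_nonneg_right ?_ (norm_nonneg _)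
      calc _ ≤ (k : ℝ) * 1 := mul_le_mul (freq_le _ _) (Real.abs_cos_le_one _) (abs_nonneg _)
            (Nat.cast_nonneg _)
        _ = k := mul_one _
  have h1 : UniformTails S (fun p k => Real.sin (freq p.1 k * p.2) * cosCoeff ζ₁ k) :=
    (UniformTails.const (hasSum_norm_sq_cosCoeff ζ₁).summable).of_norm_le (C := 1) fun p _ k _ => by
      rw [norm_mul, Complex.norm_real]
      exact mul_le_mul_of_nonneg_right (Real.abs_sin_le_one _) (norm_nonneg _)
  have h2 := (uniformTails_expSum hu T
    (e₁ := fun p k => -(amp k : ℂ) * (Complex.exp (Complex.I * freq p.1 k * p.2) / (2 * Complex.I)))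
    (e₂ := fun p k => -(amp k : ℂ) * (-Complex.exp (-(Complex.I * freq p.1 k * p.2)) / (2 * Complex.I)))
    (fun p k => by
      rw [norm_mul, norm_div, norm_exp_I_mul, norm_mul, Complex.norm_two, Complex.norm_I]
      linarith [norm_amp_le k])
    (fun p k => by
      rw [norm_mul, norm_div, norm_neg (Complex.exp _), norm_exp_I_mul_mul, norm_mul,
        Complex.norm_two, Complex.norm_I]
      linarith [norm_amp_le k]))
  have h2' : UniformTails S _ := fun ε hε => (h2 ε hε).imp fun N hN p hp => hN p (hS hp)
  refine ((h0.add h1).add h2').of_norm_le (C := C) fun p hp k hk => ?_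
  have hf := freq_pos p.1 hk
  rw [norm_mul, Complex.norm_real, Real.norm_eq_abs]
  refine (mul_le_mul_of_nonneg_right (hW p hp k hk) (norm_nonneg _)).trans (le_of_eq ?_)
  rw [mul_assoc]
  congr 1
  rw [← Real.norm_of_nonneg hf.le, ← Complex.norm_real, ← norm_mul, Complex.norm_real,
    Real.norm_of_nonneg hf.le, posCoeff, oscPos, ← mul_sinc_eq]
  refine congrArg norm ?_
  have hm := mul_integral_cos hu (freq p.1 k) p.2
  push_cast at hm ⊢
  linear_combination (-(amp k : ℂ) * tanhc (p.1 * k)) * hm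

lemma continuous_slice {Y : Type*} [TopologicalSpace Y] {f : ℝ → ℝ → Y}
    (hf : Continuous fun p : ℝ × ℝ => f p.1 p.2) (h : ℝ) : Continuous (f h) :=
  hf.comp (Continuous.prodMk continuous_const continuous_id)

lemma continuous_of_continuousOn_strips {Y : Type*} [TopologicalSpace Y] {f : ℝ × ℝ → Y}
    (hf : ∀ T, ContinuousOn f {p : ℝ × ℝ | |p.1| ≤ T ∧ p.2 ≤ T}) : Continuous f := by
  refine continuous_iff_continuousAt.2 fun p => (hf (max (|p.1| + 1) (p.2 + 1))).continuousAt ?_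
  have h1 : ∀ᶠ q : ℝ × ℝ in 𝓝 p, |q.1| < |p.1| + 1 :=
    (continuous_fst.abs.tendsto p).eventually (gt_mem_nhds (by linarith))
  have h2 : ∀ᶠ q : ℝ × ℝ in 𝓝 p, q.2 < p.2 + 1 :=
    (continuous_snd.tendsto p).eventually (gt_mem_nhds (by linarith))
  filter_upwards [h1, h2] with q h1 h2
  exact ⟨h1.le.trans (le_max_left _ _), h2.le.trans (le_max_right _ _)⟩

/-- The velocity of the solution, as an element of `L²[0, π]`. -/
def velH (u : ℝ → ℂ) (ζ₀ ζ₁ : H) (h t : ℝ) : H := synth (velCoeff u ζ₀ ζ₁ h t)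

/-- The solution, as an element of `L²[0, π]`. -/
def posH (u : ℝ → ℂ) (ζ₀ ζ₁ : H) (h t : ℝ) : H := synth (posCoeff u ζ₀ ζ₁ h t)

/-- The weight of the norm of `W^{1/2,2}[0, π]`. -/
def halfWeight (k : ℕ) : ℝ := √((1 + (k : ℝ) ^ 2) ^ (1 / 2 : ℝ))

/-- The image of the solution under `(1 - d²/dx²)^{1/4}`. -/
def halfH (u : ℝ → ℂ) (ζ₀ ζ₁ : H) (h t : ℝ) : H :=
  synth (fun k => halfWeight k * posCoeff u ζ₀ ζ₁ h t k)

/-- The series with coefficients `k ⟨z, φ_k⟩`, where `z` solves the wave equation. -/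
def gradH (u : ℝ → ℂ) (ζ₀ ζ₁ : H) (t : ℝ) : H :=
  synth (fun k => (k : ℝ) * posCoeff u ζ₀ ζ₁ 0 t k)

/-- For `k ≥ 1`, `√(1 + k²) ≤ 2 k`, and the lower bound on `tanhc` gives `1 ≤ (1 + T) k tanhc (h
k)`; the product of the two is `2 (1 + T) freq h k ^ 2`. -/
lemma halfWeight_le {h : ℝ} {T : ℝ} (hT : |h| ≤ T) {k : ℕ} (hk : 1 ≤ k) :
    |halfWeight k| ≤ √(2 * (1 + T)) * freq h k := by
  have hT0 : 0 ≤ T := (abs_nonneg h).trans hT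
  have hk1 : (1 : ℝ) ≤ k := by exact_mod_cast hk
  rw [halfWeight, abs_of_nonneg (Real.sqrt_nonneg _)]
  refine Real.sqrt_le_iff.2 ⟨mul_nonneg (Real.sqrt_nonneg _) (freq_nonneg _ _), ?_⟩
  rw [mul_pow, Real.sq_sqrt (by positivity), freq_sq, ← Real.sqrt_eq_rpow]
  have h1 : √(1 + (k : ℝ) ^ 2) ≤ 2 * k := Real.sqrt_le_iff.2 ⟨by positivity, by nlinarith⟩
  have h2 : 1 ≤ (1 + T) * (k * tanhc (h * k)) := by
    have h3 := inv_one_add_abs_le_tanhc (h * k)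
    rw [abs_mul, Nat.abs_cast] at h3
    have h4 : 1 ≤ (1 + |h| * k) * tanhc (h * k) := by
      rw [div_le_iff₀ (by positivity)] at h3; linarith
    have h5 : 1 + |h| * k ≤ (1 + T) * k := by nlinarith
    have := tanhc_pos (h * k)
    nlinarith
  nlinarith

lemma one_le_halfWeight (k : ℕ) : 1 ≤ halfWeight k :=
  Real.one_le_sqrt.2 (Real.one_le_rpow (by nlinarith [sq_nonneg (k : ℝ)]) (by norm_num))

variable (hu : MemL2Loc u) (hζ₀ : Summable fun k : ℕ => ‖k * cosCoeff ζ₀ k‖ ^ 2)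

include hu hζ₀

lemma uniformTails_halfWeight (T : ℝ) : UniformTails {p : ℝ × ℝ | |p.1| ≤ T ∧ p.2 ≤ T}
    (fun p k => halfWeight k * posCoeff u ζ₀ ζ₁ p.1 p.2 k) :=
  uniformTails_posCoeff hu hζ₀ (fun _ h => h.2) halfWeight fun _ h _ hk => halfWeight_le h.1 hk

lemma uniformTails_pos (T : ℝ) : UniformTails {p : ℝ × ℝ | |p.1| ≤ T ∧ p.2 ≤ T}
    (fun p k => posCoeff u ζ₀ ζ₁ p.1 p.2 k) :=
  (uniformTails_halfWeight hu hζ₀ T).of_norm_le (C := 1) fun p _ k _ => by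
    rw [one_mul, norm_mul, Complex.norm_real]
    exact le_mul_of_one_le_left (norm_nonneg _) ((one_le_halfWeight k).trans (le_abs_self _))

lemma uniformTails_grad (T : ℝ) : UniformTails {t : ℝ | t ≤ T}
    (fun t k => (k : ℝ) * posCoeff u ζ₀ ζ₁ 0 t k) := by
  have := uniformTails_posCoeff (ζ₁ := ζ₁) hu hζ₀ (T := T) (C := 1)
    (S := {p : ℝ × ℝ | p.1 = 0 ∧ p.2 ≤ T}) (fun _ h => h.2) (fun k => (k : ℝ)) fun p hp k _ => by
      rw [hp.1, freq_zero]; simp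
  exact fun ε hε => (this ε hε).imp fun N hN t ht => hN (0, t) ⟨rfl, ht⟩

/-- Continuity is joint in `(h, t)` and includes `h = 0`; together with `continuous_halfH` this is
the convergence claim in substance. -/
lemma continuous_velH : Continuous fun p : ℝ × ℝ => velH u ζ₀ ζ₁ p.1 p.2 :=
  continuous_of_continuousOn_strips fun T =>
    ((uniformTails_velCoeff hu hζ₀ T).continuousOn_synth
      fun k => (continuous_velCoeff hu k).continuousOn).mono fun _ h => h.2

lemma continuous_halfH : Continuous fun p : ℝ × ℝ => halfH u ζ₀ ζ₁ p.1 p.2 :=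
  continuous_of_continuousOn_strips fun T =>
    (uniformTails_halfWeight hu hζ₀ T).continuousOn_synth
      fun k => (continuous_const.mul (continuous_posCoeff hu k)).continuousOn

lemma continuous_posH (h : ℝ) : Continuous fun t : ℝ => posH u ζ₀ ζ₁ h t := by
  have : Continuous fun p : ℝ × ℝ => posH u ζ₀ ζ₁ p.1 p.2 :=
    continuous_of_continuousOn_strips fun T =>
      (uniformTails_pos hu hζ₀ T).continuousOn_synth fun k => (continuous_posCoeff hu k).continuousOn
  exact continuous_slice this h

lemma continuous_gradH : Continuous (gradH u ζ₀ ζ₁) := by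
  refine continuous_iff_continuousAt.2 fun t => ?_
  refine ((uniformTails_grad hu hζ₀ (t + 1)).continuousOn_synth fun k => ?_).continuousAt
    (Iic_mem_nhds (lt_add_one t))
  exact (continuous_const.mul ((continuous_posCoeff hu k).comp
    (by fun_prop : Continuous fun t : ℝ => ((0 : ℝ), t)))).continuousOn

lemma cosCoeff_velH (h t : ℝ) (k : ℕ) :
    cosCoeff (velH u ζ₀ ζ₁ h t) k = velCoeff u ζ₀ ζ₁ h t k :=
  cosCoeff_synth ((uniformTails_velCoeff hu hζ₀ t).summable (x := (h, t)) (le_refl t)) k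

lemma cosCoeff_posH (h t : ℝ) (k : ℕ) :
    cosCoeff (posH u ζ₀ ζ₁ h t) k = posCoeff u ζ₀ ζ₁ h t k :=
  cosCoeff_synth ((uniformTails_pos hu hζ₀ (max |h| t)).summable (x := (h, t))
    ⟨le_max_left _ _, le_max_right _ _⟩) k

lemma cosCoeff_halfH (h t : ℝ) (k : ℕ) :
    cosCoeff (halfH u ζ₀ ζ₁ h t) k = halfWeight k * posCoeff u ζ₀ ζ₁ h t k :=
  cosCoeff_synth ((uniformTails_halfWeight hu hζ₀ (max |h| t)).summable (x := (h, t))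
    ⟨le_max_left _ _, le_max_right _ _⟩) k

lemma cosCoeff_gradH (t : ℝ) (k : ℕ) :
    cosCoeff (gradH u ζ₀ ζ₁ t) k = (k : ℝ) * posCoeff u ζ₀ ζ₁ 0 t k :=
  cosCoeff_synth ((uniformTails_grad hu hζ₀ t).summable (x := t) (le_refl t)) k

omit hu hζ₀ in
lemma cosCoeff_intervalIntegral {z : ℝ → H} (hz : Continuous z) (a b : ℝ) (k : ℕ) :
    cosCoeff (∫ s in a..b, z s) k = ∫ s in a..b, cosCoeff (z s) k := by
  simp only [← inner_cosVec]
  exact ((innerSL ℂ (cosVec k)).intervalIntegral_comp_comm (hz.intervalIntegrable a b)).symm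

omit hu hζ₀ in
lemma posCoeff_zero (h : ℝ) (k : ℕ) : posCoeff u ζ₀ ζ₁ h 0 k = cosCoeff ζ₀ k := oscPos_zero

omit hζ₀ in
lemma hasDerivAt_posCoeff (h t : ℝ) (k : ℕ) :
    HasDerivAt (fun t => posCoeff u ζ₀ ζ₁ h t k) (velCoeff u ζ₀ ζ₁ h t k) t :=
  hasDerivAt_oscPos (continuous_primitive hu) t

lemma posH_zero (h : ℝ) : posH u ζ₀ ζ₁ h 0 = ζ₀ :=
  ext_cosCoeff fun k => by rw [cosCoeff_posH hu hζ₀, posCoeff_zero]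

lemma velH_zero (h : ℝ) : velH u ζ₀ ζ₁ h 0 = ζ₁ :=
  ext_cosCoeff fun k => by
    rw [cosCoeff_velH hu hζ₀, velCoeff, oscVel_zero (primitive_of_nonpos le_rfl)]

/-- Differentiability in the norm of `H` is not read off the coefficients. They serve only to
identify `posH` with `ζ₀ + ∫ velH`, and continuity of `velH` then gives the derivative. -/
lemma hasDerivAt_posH (h t : ℝ) : HasDerivAt (posH u ζ₀ ζ₁ h) (velH u ζ₀ ζ₁ h t) t := by
  have hv : Continuous (velH u ζ₀ ζ₁ h) := continuous_slice (continuous_velH hu hζ₀) h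
  have e : posH u ζ₀ ζ₁ h = fun t => ζ₀ + ∫ s in (0 : ℝ)..t, velH u ζ₀ ζ₁ h s := by
    ext1 t
    refine ext_cosCoeff fun k => ?_
    rw [cosCoeff_add, cosCoeff_intervalIntegral hv, cosCoeff_posH hu hζ₀]
    simp_rw [cosCoeff_velH hu hζ₀]
    have hc : Continuous fun t => velCoeff u ζ₀ ζ₁ h t k :=
      continuous_slice (f := fun h t => velCoeff u ζ₀ ζ₁ h t k) (continuous_velCoeff hu k) h
    rw [intervalIntegral.integral_eq_sub_of_hasDerivAt
      (fun s _ => hasDerivAt_posCoeff hu h s k) (hc.intervalIntegrable _ _), posCoeff_zero]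
    ring
  rw [e]
  exact ((hv.integral_hasStrictDerivAt 0 t).hasDerivAt).const_add ζ₀

lemma contDiff_posH (h : ℝ) : ContDiff ℝ 1 (posH u ζ₀ ζ₁ h) := by
  rw [contDiff_one_iff_deriv]
  refine ⟨fun t => (hasDerivAt_posH hu hζ₀ h t).differentiableAt, ?_⟩
  rw [show deriv (posH u ζ₀ ζ₁ h) = velH u ζ₀ ζ₁ h from
    funext fun t => (hasDerivAt_posH hu hζ₀ h t).deriv]
  exact continuous_slice (continuous_velH hu hζ₀) h

lemma timeDeriv_posH (h : ℝ) {t : ℝ} (ht : 0 ≤ t) :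
    timeDeriv (posH u ζ₀ ζ₁ h) t = velH u ζ₀ ζ₁ h t :=
  (hasDerivAt_posH hu hζ₀ h t).hasDerivWithinAt.derivWithin (uniqueDiffOn_Ici 0 t ht)

lemma sobolevENorm_posH_sub (h t h' t' : ℝ) :
    sobolevENorm (1 / 2) (posH u ζ₀ ζ₁ h t - posH u ζ₀ ζ₁ h' t')
      = ‖halfH u ζ₀ ζ₁ h t - halfH u ζ₀ ζ₁ h' t'‖ₑ := by
  refine sobolevENorm_eq fun k => ?_
  rw [cosCoeff_sub, cosCoeff_sub, cosCoeff_halfH hu hζ₀, cosCoeff_halfH hu hζ₀,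
    cosCoeff_posH hu hζ₀, cosCoeff_posH hu hζ₀, ← mul_sub, norm_mul, mul_pow, Complex.norm_real,
    Real.norm_eq_abs, sq_abs, halfWeight, Real.sq_sqrt (by positivity)]

lemma sobolevENorm_posH (h t : ℝ) :
    sobolevENorm (1 / 2) (posH u ζ₀ ζ₁ h t) = ‖halfH u ζ₀ ζ₁ h t‖ₑ := by
  refine sobolevENorm_eq fun k => ?_
  rw [cosCoeff_halfH hu hζ₀, cosCoeff_posH hu hζ₀, norm_mul, mul_pow, Complex.norm_real,
    Real.norm_eq_abs, sq_abs, halfWeight, Real.sq_sqrt (by positivity)]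

lemma continuousInSobolev_posH (h : ℝ) : ContinuousInSobolev (1 / 2) (posH u ζ₀ ζ₁ h) := by
  intro t _
  refine ⟨by rw [sobolevENorm_posH hu hζ₀]; exact enorm_lt_top, ?_⟩
  simp_rw [sobolevENorm_posH_sub hu hζ₀]
  have hc : Continuous fun r => ‖halfH u ζ₀ ζ₁ h r - halfH u ζ₀ ζ₁ h t‖ₑ :=
    ((continuous_slice (continuous_halfH hu hζ₀) h).sub continuous_const).enorm
  have := hc.tendsto t
  simp only [sub_self, enorm_zero] at this
  exact this.mono_left nhdsWithin_le_nhds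

omit hu hζ₀ in
/-- Uniform convergence on compact time intervals of a jointly continuous family. -/
lemma tendsto_iSup_enorm_sub {F : ℝ × ℝ → H} (hF : Continuous F) (τ : ℝ) :
    Tendsto (fun h : ℝ => ⨆ t ∈ Icc 0 τ, ‖F (h, t) - F (0, t)‖ₑ) (𝓝 0) (𝓝 0) := by
  have hG : Continuous fun p : ℝ × ℝ => ‖F p - F (0, p.2)‖ₑ :=
    (hF.sub (hF.comp (by fun_prop))).enorm
  refine ENNReal.tendsto_nhds_zero.2 fun ε hε => ?_
  have hopen : IsOpen {p : ℝ × ℝ | ‖F p - F (0, p.2)‖ₑ < ε} := isOpen_lt hG continuous_const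
  -- Tube lemma: the open set contains `{0} × [0, τ]`, hence a neighbourhood of `h = 0` times `[0,
  -- τ]`.
  obtain ⟨v, w, hv, -, h0v, hw, hvw⟩ := generalized_tube_lemma (s := {(0 : ℝ)})
    isCompact_singleton (isCompact_Icc (a := (0 : ℝ)) (b := τ)) hopen (by
      rintro ⟨x, t⟩ ⟨hx, -⟩
      simp only [mem_singleton_iff] at hx
      simp [hx, hε])
  filter_upwards [hv.mem_nhds (singleton_subset_iff.1 h0v)] with h hh
  exact iSup₂_le fun t ht => (hvw ⟨hh, hw ht⟩ : ‖F (h, t) - F (0, t)‖ₑ < ε).le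

end Evolution

end

noncomputable section

/-! ### Green's identity on the rectangle -/

lemma hasDerivAt_slice_fst {F : ℝ × ℝ → ℂ} {p : ℝ × ℝ} (hF : DifferentiableAt ℝ F p) :
    HasDerivAt (fun x => F (x, p.2)) (fderiv ℝ F p (1, 0)) p.1 :=
  HasFDerivAt.comp_hasDerivAt (l := F) (f := fun x => (x, p.2)) p.1 hF.hasFDerivAt
    ((hasDerivAt_id p.1).prodMk (hasDerivAt_const p.1 p.2))

lemma hasDerivAt_slice_snd {F : ℝ × ℝ → ℂ} {p : ℝ × ℝ} (hF : DifferentiableAt ℝ F p) :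
    HasDerivAt (fun y => F (p.1, y)) (fderiv ℝ F p (0, 1)) p.2 :=
  HasFDerivAt.comp_hasDerivAt (l := F) (f := fun y => (p.1, y)) p.2 hF.hasFDerivAt
    ((hasDerivAt_const p.2 p.1).prodMk (hasDerivAt_id p.2))

lemma contDiff_fderiv_apply {F : ℝ × ℝ → ℂ} (hF : ContDiff ℝ 2 F) (v : ℝ × ℝ) :
    ContDiff ℝ 1 fun p => fderiv ℝ F p v :=
  (hF.fderiv_right (m := 1) (by norm_num)).clm_apply contDiff_const

lemma divergence_rectangle {P Q : ℝ × ℝ → ℂ} (hP : ContDiff ℝ 1 P) (hQ : ContDiff ℝ 1 Q)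
    (hdiv : ∀ x ∈ Ioo 0 Real.pi, ∀ y ∈ Ioo (-1 : ℝ) 0,
      deriv (fun x' => P (x', y)) x + deriv (fun y' => Q (x, y')) y = 0) :
    (∫ x in (0 : ℝ)..Real.pi, Q (x, 0)) - (∫ x in (0 : ℝ)..Real.pi, Q (x, -1))
      + (∫ y in (-1 : ℝ)..0, P (Real.pi, y)) - (∫ y in (-1 : ℝ)..0, P (0, y)) = 0 := by
  have hPd := hP.differentiable one_ne_zero
  have hQd := hQ.differentiable one_ne_zero
  rw [← integral2_divergence_prod_of_hasFDerivAt P Q (fderiv ℝ P) (fderiv ℝ Q) 0 (-1) Real.pi 0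
    hP.continuous.continuousOn hQ.continuous.continuousOn (fun p _ => (hPd p).hasFDerivAt)
    (fun p _ => (hQd p).hasFDerivAt)]
  · rw [intervalIntegral.integral_of_le Real.pi_pos.le, integral_Ioc_eq_integral_Ioo]
    rw [setIntegral_congr_fun (g := fun _ => 0) measurableSet_Ioo]
    · simp
    intro x hx
    simp only
    rw [intervalIntegral.integral_of_le (by norm_num), integral_Ioc_eq_integral_Ioo]
    rw [setIntegral_congr_fun (g := fun _ => 0) measurableSet_Ioo]
    · simp
    intro y hy
    have h1 := (hasDerivAt_slice_fst (hPd (x, y))).deriv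
    have h2 := (hasDerivAt_slice_snd (hQd (x, y))).deriv
    simp only at h1 h2 ⊢
    rw [← h1, ← h2, hdiv x hx y hy]
  · refine ContinuousOn.integrableOn_compact (isCompact_uIcc.prod isCompact_uIcc)
      (Continuous.continuousOn ?_)
    exact ((hP.continuous_fderiv one_ne_zero).clm_apply continuous_const).add
      ((hQ.continuous_fderiv one_ne_zero).clm_apply continuous_const)

/-- The function `cos (k x) cosh (h k (y + 1))` satisfies the same equation, with zero normal
derivative on the bottom and both walls. Only the top and the Neumann data of `f` on the left wall
survive in Green's identity. -/
lemma IsPotential.green {h : ℝ} {f : ℝ → ℝ → ℂ} (hf : IsPotential (h ^ 2) f) (k : ℕ) :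
    Real.cosh (h * k) * (∫ x in (0 : ℝ)..Real.pi, deriv (f x) 0 * Real.cos (k * x))
      = (h * k * Real.sinh (h * k) : ℝ) * (∫ x in (0 : ℝ)..Real.pi, f x 0 * Real.cos (k * x))
        + (h ^ 2 : ℝ) * ∫ y in (-1 : ℝ)..0,
            deriv (fun x' => f x' y) 0 * Real.cosh (h * k * (y + 1)) := by
  set F : ℝ × ℝ → ℂ := fun p => f p.1 p.2 with hF
  have hF2 : ContDiff ℝ 2 F := hf.contDiff
  have hFd : Differentiable ℝ F := hF2.differentiable two_ne_zero
  set a : ℝ := h * k with ha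
  set Fx : ℝ × ℝ → ℂ := fun p => fderiv ℝ F p (1, 0) with hFx
  set Fy : ℝ × ℝ → ℂ := fun p => fderiv ℝ F p (0, 1) with hFy
  have hFxc : ContDiff ℝ 1 Fx := contDiff_fderiv_apply hF2 _
  have hFyc : ContDiff ℝ 1 Fy := contDiff_fderiv_apply hF2 _
  have hfx : ∀ x y, HasDerivAt (fun x' => f x' y) (Fx (x, y)) x := fun x y =>
    hasDerivAt_slice_fst (hFd (x, y))
  have hfy : ∀ x y, HasDerivAt (fun y' => f x y') (Fy (x, y)) y := fun x y =>
    hasDerivAt_slice_snd (hFd (x, y))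
  have hfxx : ∀ x y, HasDerivAt (fun x' => Fx (x', y)) (iteratedDeriv 2 (fun x' => f x' y) x) x := by
    intro x y
    have h1 := hasDerivAt_slice_fst ((hFxc.differentiable one_ne_zero) (x, y))
    refine h1.congr_deriv ?_
    rw [iteratedDeriv_succ, iteratedDeriv_one, show deriv (fun x' => f x' y) = fun x' => Fx (x', y) from
      funext fun x' => (hfx x' y).deriv]
    exact h1.deriv.symm
  have hfyy : ∀ x y, HasDerivAt (fun y' => Fy (x, y')) (iteratedDeriv 2 (f x) y) y := by
    intro x y
    have h1 := hasDerivAt_slice_snd ((hFyc.differentiable one_ne_zero) (x, y))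
    refine h1.congr_deriv ?_
    rw [iteratedDeriv_succ, iteratedDeriv_one, show deriv (f x) = fun y' => Fy (x, y') from
      funext fun y' => (hfy x y').deriv]
    exact h1.deriv.symm
  set c : ℝ → ℂ := fun x => (Real.cos (k * x) : ℂ) with hc
  set s : ℝ → ℂ := fun x => (Real.sin (k * x) : ℂ) with hs
  set C : ℝ → ℂ := fun y => (Real.cosh (a * (y + 1)) : ℂ) with hC
  set S : ℝ → ℂ := fun y => (Real.sinh (a * (y + 1)) : ℂ) with hS
  have hcd : ∀ x, HasDerivAt c (-(k * s x)) x := fun x =>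
    (hasDerivAt_ofReal_cos_mul (k : ℝ) x).congr_deriv (by simp [hs])
  have hsd : ∀ x, HasDerivAt s (k * c x) x := fun x =>
    (hasDerivAt_ofReal_sin_mul (k : ℝ) x).congr_deriv (by simp [hc])
  have hCd : ∀ y, HasDerivAt C (a * S y) y := fun y => by
    have : HasDerivAt (fun y : ℝ => Real.cosh (a * (y + 1))) (Real.sinh (a * (y + 1)) * (a * 1)) y :=
      (((hasDerivAt_id y).add_const 1).const_mul a).cosh
    exact this.ofReal_comp.congr_deriv (by rw [hS]; push_cast; ring)
  have hSd : ∀ y, HasDerivAt S (a * C y) y := fun y => by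
    have : HasDerivAt (fun y : ℝ => Real.sinh (a * (y + 1))) (Real.cosh (a * (y + 1)) * (a * 1)) y :=
      (((hasDerivAt_id y).add_const 1).const_mul a).sinh
    exact this.ofReal_comp.congr_deriv (by rw [hC]; push_cast; ring)
  have hcc : ContDiff ℝ 1 c :=
    Complex.ofRealCLM.contDiff.comp (Real.contDiff_cos.comp (contDiff_const.mul contDiff_id))
  have hsc : ContDiff ℝ 1 s :=
    Complex.ofRealCLM.contDiff.comp (Real.contDiff_sin.comp (contDiff_const.mul contDiff_id))
  have hCc : ContDiff ℝ 1 C := Complex.ofRealCLM.contDiff.comp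
    (Real.contDiff_cosh.comp (contDiff_const.mul (contDiff_id.add contDiff_const)))
  have hSc : ContDiff ℝ 1 S := Complex.ofRealCLM.contDiff.comp
    (Real.contDiff_sinh.comp (contDiff_const.mul (contDiff_id.add contDiff_const)))
  have hc2 : ContDiff ℝ 1 fun p : ℝ × ℝ => c p.1 := hcc.comp contDiff_fst
  have hs2 : ContDiff ℝ 1 fun p : ℝ × ℝ => s p.1 := hsc.comp contDiff_fst
  have hC2 : ContDiff ℝ 1 fun p : ℝ × ℝ => C p.2 := hCc.comp contDiff_snd
  have hS2 : ContDiff ℝ 1 fun p : ℝ × ℝ => S p.2 := hSc.comp contDiff_snd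
  have hF1 : ContDiff ℝ 1 F := hF2.of_le (by norm_num)
  set P : ℝ × ℝ → ℂ := fun p =>
    ((h ^ 2 : ℝ) : ℂ) * ((Fx p * c p.1 + F p * (k * s p.1)) * C p.2) with hP
  set Q : ℝ × ℝ → ℂ := fun p => c p.1 * (Fy p * C p.2 - F p * (a * S p.2)) with hQ
  have hPc : ContDiff ℝ 1 P := contDiff_const.mul
    (((hFxc.mul hc2).add (hF1.mul (contDiff_const.mul hs2))).mul hC2)
  have hQc : ContDiff ℝ 1 Q := hc2.mul ((hFyc.mul hC2).sub (hF1.mul (contDiff_const.mul hS2)))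
  have key := divergence_rectangle hPc hQc (by
    intro x hx y hy
    have h1 := (((((hfxx x y).mul (hcd x)).add ((hfx x y).mul ((hsd x).const_mul (k : ℂ)))).mul_const
      (C y)).const_mul ((h ^ 2 : ℝ) : ℂ)).deriv
    have h2 := ((((hfyy x y).mul (hCd y)).sub ((hfy x y).mul ((hSd y).const_mul (a : ℂ)))).const_mul
      (c x)).deriv
    have hlap := hf.laplace x hx y hy
    have e1 : deriv (fun x' => P (x', y)) x = _ := h1
    have e2 : deriv (fun y' => Q (x, y')) y = _ := h2
    rw [e1, e2]
    rw [ha]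
    push_cast at hlap ⊢
    -- The products of first derivatives cancel, as do the second derivatives of the test function.
    linear_combination (c x * C y) * hlap)
  have hright : ∫ y in (-1 : ℝ)..0, P (Real.pi, y) = 0 := by
    rw [intervalIntegral.integral_of_le (by norm_num), integral_Ioc_eq_integral_Ioo,
      setIntegral_congr_fun (g := fun _ => 0) measurableSet_Ioo]
    · simp
    intro y hy
    have h0 : Fx (Real.pi, y) = 0 := by rw [← (hfx Real.pi y).deriv]; exact hf.right y hy
    have h1 : s Real.pi = 0 := by simp only [hs, Real.sin_nat_mul_pi, Complex.ofReal_zero]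
    simp [hP, h0, h1]
  have hbot : ∫ x in (0 : ℝ)..Real.pi, Q (x, -1) = 0 := by
    rw [intervalIntegral.integral_of_le Real.pi_pos.le, integral_Ioc_eq_integral_Ioo,
      setIntegral_congr_fun (g := fun _ => 0) measurableSet_Ioo]
    · simp
    intro x hx
    have h0 : Fy (x, -1) = 0 := by rw [← (hfy x (-1)).deriv]; exact hf.bottom x hx
    have h1 : S (-1) = 0 := by simp [hS]
    simp [hQ, h0, h1]
  have hleft : ∫ y in (-1 : ℝ)..0, P (0, y)
      = (h ^ 2 : ℝ) * ∫ y in (-1 : ℝ)..0, deriv (fun x' => f x' y) 0 * Real.cosh (a * (y + 1)) := by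
    rw [← intervalIntegral.integral_const_mul]
    refine intervalIntegral.integral_congr fun y _ => ?_
    have h0 : c 0 = 1 := by simp [hc]
    have h1 : s 0 = 0 := by simp [hs]
    simp only [hP, h0, h1, (hfx 0 y).deriv, hC]
    ring
  have htop : ∫ x in (0 : ℝ)..Real.pi, Q (x, 0)
      = Real.cosh a * (∫ x in (0 : ℝ)..Real.pi, deriv (f x) 0 * Real.cos (k * x))
        - (a * Real.sinh a : ℝ) * ∫ x in (0 : ℝ)..Real.pi, f x 0 * Real.cos (k * x) := by
    have i1 : Continuous fun x : ℝ => (Real.cosh a : ℂ) * (Fy (x, 0) * (Real.cos (k * x) : ℂ)) :=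
      continuous_const.mul ((hFyc.continuous.comp (by fun_prop)).mul hcc.continuous)
    have i2 : Continuous fun x : ℝ => ((a * Real.sinh a : ℝ) : ℂ) * (f x 0 * (Real.cos (k * x) : ℂ)) :=
      continuous_const.mul ((hF1.continuous.comp (f := fun x : ℝ => (x, (0 : ℝ))) (by fun_prop)).mul
        hcc.continuous)
    have e : ∀ x, deriv (f x) 0 = Fy (x, 0) := fun x => (hfy x 0).deriv
    simp_rw [e]
    rw [← intervalIntegral.integral_const_mul, ← intervalIntegral.integral_const_mul,
      ← intervalIntegral.integral_sub (i1.intervalIntegrable _ _) (i2.intervalIntegrable _ _)]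
    refine intervalIntegral.integral_congr fun x _ => ?_
    have h0 : C 0 = (Real.cosh a : ℂ) := by simp [hC]
    have h1 : S 0 = (Real.sinh a : ℂ) := by simp [hS]
    simp only [hQ, h0, h1, hF, hc]
    push_cast; ring
  rw [hright, hbot, hleft, htop] at key
  linear_combination key

end

noncomputable section

/-! ### The graphs of the Dirichlet to Neumann and Neumann to Neumann maps -/

lemma cosCoeff_of_ae_eq {η : H} {g : ℝ → ℂ} (h : (η : ℝ → ℂ) =ᵐ[volume.restrict (Ioo 0 Real.pi)] g)
    (k : ℕ) : cosCoeff η k = amp k * ∫ x in (0 : ℝ)..Real.pi, g x * Real.cos (k * x) := by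
  rw [intervalIntegral.integral_of_le Real.pi_pos.le, integral_Ioc_eq_integral_Ioo,
    ← integral_const_mul, cosCoeff]
  refine integral_congr_ae ?_
  filter_upwards [h] with x hx
  rw [hx, cosMode_eq]; push_cast; ring

lemma integral_zero_pi_congr {f g : ℝ → ℂ} (h : ∀ x ∈ Ioo 0 Real.pi, f x = g x) :
    ∫ x in (0 : ℝ)..Real.pi, f x * Real.cos (k * x) = ∫ x in (0 : ℝ)..Real.pi, g x * Real.cos (k * x) := by
  rw [intervalIntegral.integral_of_le Real.pi_pos.le, intervalIntegral.integral_of_le Real.pi_pos.le,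
    integral_Ioc_eq_integral_Ioo, integral_Ioc_eq_integral_Ioo]
  exact setIntegral_congr_fun measurableSet_Ioo fun x hx => by simp only [h x hx]

/-- The eigenvalues of `A_μ`, `μ = h²`. -/
lemma freq_sq_mul (h : ℝ) (k : ℕ) :
    h ^ 2 * freq h k ^ 2 = h * k * Real.sinh (h * k) / Real.cosh (h * k) := by
  rw [mul_div_assoc, ← Real.tanh_eq_sinh_div_cosh, ← mul_tanhc, freq_sq]; ring

/-- The relation is closed in the pair, so it passes from the classical graph to its closure; on the
classical graph it is Green's identity without the left wall. -/
lemma cosCoeff_of_mem_dirichletToNeumann {h : ℝ} {p : H × H} (hp : p ∈ dirichletToNeumann (h ^ 2))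
    (k : ℕ) : cosCoeff p.2 k = (h ^ 2 * freq h k ^ 2 : ℝ) * cosCoeff p.1 k := by
  have hclosed : IsClosed {p : H × H | cosCoeff p.2 k = (h ^ 2 * freq h k ^ 2 : ℝ) * cosCoeff p.1 k} :=
    isClosed_eq ((continuous_cosCoeff k).comp continuous_snd)
      (continuous_const.mul ((continuous_cosCoeff k).comp continuous_fst))
  refine closure_minimal ?_ hclosed hp
  rintro q ⟨η, f, hf, h1, h2⟩
  have hg := hf.toIsPotential.green k
  have hleft : ∫ y in (-1 : ℝ)..0, deriv (fun x' => f x' y) 0 * Real.cosh (h * k * (y + 1)) = 0 := by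
    rw [intervalIntegral.integral_of_le (by norm_num), integral_Ioc_eq_integral_Ioo,
      setIntegral_congr_fun (g := fun _ => 0) measurableSet_Ioo]
    · simp
    intro y hy
    simp only [hf.left y hy, zero_mul]
  have hc : (Real.cosh (h * k) : ℂ) ≠ 0 := by exact_mod_cast (Real.cosh_pos _).ne'
  rw [mem_ofPred_eq, cosCoeff_of_ae_eq h2, cosCoeff_of_ae_eq h1, freq_sq_mul,
    ← integral_zero_pi_congr hf.top, Complex.ofReal_div]
  rw [hleft, mul_zero, add_zero] at hg
  rw [div_mul_eq_mul_div, eq_div_iff hc]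
  linear_combination (amp k : ℂ) * hg

/-- Separation of variables gives the classical solution explicitly. These eigenpairs supply the
test functions for uniqueness. -/
lemma cosVec_mem_dirichletToNeumann (h : ℝ) (k : ℕ) :
    (cosVec k, ((h ^ 2 * freq h k ^ 2 : ℝ) : ℂ) • cosVec k) ∈ dirichletToNeumann (h ^ 2) := by
  refine subset_closure ⟨fun x => (cosMode k x : ℂ),
    fun x y => ((amp k * Real.cos (k * x) * (Real.cosh (h * k * (y + 1)) / Real.cosh (h * k)) : ℝ) : ℂ),
    ?_, coeFn_ofCont _ (Complex.continuous_ofReal.comp (continuous_cosMode k)), ?_⟩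
  · have hc := (Real.cosh_pos (h * k)).ne'
    have hcos : ∀ x : ℝ, HasDerivAt (fun x : ℝ => Real.cos (k * x)) (-(k * Real.sin (k * x))) x :=
      fun x => (((hasDerivAt_id x).const_mul (k : ℝ)).cos).congr_deriv (by simp; ring)
    have hsin : ∀ x : ℝ, HasDerivAt (fun x : ℝ => Real.sin (k * x)) (k * Real.cos (k * x)) x :=
      fun x => (((hasDerivAt_id x).const_mul (k : ℝ)).sin).congr_deriv (by simp; ring)
    have hcosh : ∀ y : ℝ, HasDerivAt (fun y : ℝ => Real.cosh (h * k * (y + 1)))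
      (h * k * Real.sinh (h * k * (y + 1))) y := fun y =>
      ((((hasDerivAt_id y).add_const 1).const_mul (h * k)).cosh).congr_deriv (by simp; ring)
    have hsinh : ∀ y : ℝ, HasDerivAt (fun y : ℝ => Real.sinh (h * k * (y + 1)))
      (h * k * Real.cosh (h * k * (y + 1))) y := fun y =>
      ((((hasDerivAt_id y).add_const 1).const_mul (h * k)).sinh).congr_deriv (by simp; ring)
    have hx : ∀ x y : ℝ, HasDerivAt (fun x : ℝ => ((amp k * Real.cos (k * x)
        * (Real.cosh (h * k * (y + 1)) / Real.cosh (h * k)) : ℝ) : ℂ))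
        ((amp k * -(k * Real.sin (k * x)) * (Real.cosh (h * k * (y + 1)) / Real.cosh (h * k)) : ℝ) : ℂ) x :=
      fun x y => (((hcos x).const_mul (amp k)).mul_const _).ofReal_comp
    have hxx : ∀ x y : ℝ, HasDerivAt (fun x : ℝ => ((amp k * -(k * Real.sin (k * x))
        * (Real.cosh (h * k * (y + 1)) / Real.cosh (h * k)) : ℝ) : ℂ))
        ((amp k * -(k * (k * Real.cos (k * x))) * (Real.cosh (h * k * (y + 1)) / Real.cosh (h * k)) : ℝ) : ℂ) x :=
      fun x y => (((((hsin x).const_mul (k : ℝ)).neg).const_mul (amp k)).mul_const _).ofReal_comp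
    have hy : ∀ x y : ℝ, HasDerivAt (fun y : ℝ => ((amp k * Real.cos (k * x)
        * (Real.cosh (h * k * (y + 1)) / Real.cosh (h * k)) : ℝ) : ℂ))
        ((amp k * Real.cos (k * x) * (h * k * Real.sinh (h * k * (y + 1)) / Real.cosh (h * k)) : ℝ) : ℂ) y :=
      fun x y => (((hcosh y).div_const _).const_mul _).ofReal_comp
    have hyy : ∀ x y : ℝ, HasDerivAt (fun y : ℝ => ((amp k * Real.cos (k * x)
        * (h * k * Real.sinh (h * k * (y + 1)) / Real.cosh (h * k)) : ℝ) : ℂ))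
        ((amp k * Real.cos (k * x) * (h * k * (h * k * Real.cosh (h * k * (y + 1))) / Real.cosh (h * k)) : ℝ) : ℂ) y :=
      fun x y => ((((hsinh y).const_mul (h * k)).div_const _).const_mul _).ofReal_comp
    have hsm : ContDiff ℝ 2 fun p : ℝ × ℝ => amp k * Real.cos (k * p.1)
        * (Real.cosh (h * k * (p.2 + 1)) / Real.cosh (h * k)) := by fun_prop
    exact
    { contDiff := Complex.ofRealCLM.contDiff.comp hsm
      laplace := fun x _ y _ => by
        rw [iteratedDeriv_succ, iteratedDeriv_one, iteratedDeriv_succ, iteratedDeriv_one,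
          funext fun x => (hx x y).deriv, funext fun y => (hy x y).deriv, (hxx x y).deriv,
          (hyy x y).deriv]
        push_cast; ring
      bottom := fun x _ => by rw [(hy x (-1)).deriv]; simp
      right := fun y _ => by
        rw [(hx Real.pi y).deriv, Real.sin_nat_mul_pi]; simp
      top := fun x _ => by
        simp only [zero_add, mul_one, div_self hc, cosMode_eq]
      left := fun y _ => by rw [(hx 0 y).deriv]; simp }
  · have hd : ∀ x : ℝ, deriv (fun y : ℝ => ((amp k * Real.cos (k * x)
        * (Real.cosh (h * k * (y + 1)) / Real.cosh (h * k)) : ℝ) : ℂ)) 0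
        = ((h ^ 2 * freq h k ^ 2 : ℝ) : ℂ) * (cosMode k x : ℂ) := fun x => by
      have hcosh : HasDerivAt (fun y : ℝ => Real.cosh (h * k * (y + 1)))
        (h * k * Real.sinh (h * k * (0 + 1))) 0 :=
        ((((hasDerivAt_id (0 : ℝ)).add_const 1).const_mul (h * k)).cosh).congr_deriv (by simp; ring)
      rw [(((hcosh.div_const (Real.cosh (h * k))).const_mul (amp k * Real.cos (k * x))).ofReal_comp).deriv,
        freq_sq_mul, cosMode_eq, zero_add, mul_one]
      push_cast; ring
    simp only [hd]
    filter_upwards [Lp.coeFn_smul ((h ^ 2 * freq h k ^ 2 : ℝ) : ℂ) (cosVec k), coeFn_ofCont _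
      (Complex.continuous_ofReal.comp (continuous_cosMode k))] with x h1 h2
    rw [h1, Pi.smul_apply, smul_eq_mul]
    congr 1

/-- The vertical profile `cosh (a (y + 1))`. -/
def coshVec (a : ℝ) : V :=
  (memLp_of_continuous (g := fun y : ℝ => (Real.cosh (a * (y + 1)) : ℂ)) (by fun_prop) (-1) 0).toLp _

lemma inner_coshVec {a : ℝ} {v : V} {w : ℝ → ℂ}
    (h : (v : ℝ → ℂ) =ᵐ[volume.restrict (Ioo (-1) 0)] w) :
    inner ℂ (coshVec a) v = ∫ y in Ioo (-1 : ℝ) 0, w y * Real.cosh (a * (y + 1)) := by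
  rw [L2.inner_def]
  refine integral_congr_ae ?_
  filter_upwards [MemLp.coeFn_toLp (memLp_of_continuous
    (g := fun y : ℝ => (Real.cosh (a * (y + 1)) : ℂ)) (by fun_prop) (-1) 0), h] with x h1 h2
  rw [coshVec, h1, h2, RCLike.inner_apply, Complex.conj_ofReal]

lemma IsNeumannSolution.cosCoeff_eq {h : ℝ} {v : ℝ → ℂ} {f : ℝ → ℝ → ℂ}
    (hf : IsNeumannSolution (h ^ 2) v f) {b : H}
    (hb : (b : ℝ → ℂ) =ᵐ[volume.restrict (Ioo 0 Real.pi)] fun x => deriv (f x) 0) (k : ℕ) :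
    cosCoeff b k = -((amp k * h ^ 2 / Real.cosh (h * k) : ℝ) : ℂ)
      * ∫ y in Ioo (-1 : ℝ) 0, v y * Real.cosh (h * k * (y + 1)) := by
  have hg := hf.toIsPotential.green k
  have hleft : ∫ y in (-1 : ℝ)..0, deriv (fun x' => f x' y) 0 * Real.cosh (h * k * (y + 1))
      = -∫ y in Ioo (-1 : ℝ) 0, v y * Real.cosh (h * k * (y + 1)) := by
    rw [intervalIntegral.integral_of_le (by norm_num), integral_Ioc_eq_integral_Ioo, ← integral_neg]
    exact setIntegral_congr_fun measurableSet_Ioo fun y hy => by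
      simp only [hf.left y hy]; ring
  have hc : (Real.cosh (h * k) : ℂ) ≠ 0 := by exact_mod_cast (Real.cosh_pos _).ne'
  rw [integral_zero_pi_congr (g := fun _ => 0) hf.top, hleft] at hg
  simp only [zero_mul, intervalIntegral.integral_zero, mul_zero, zero_add] at hg
  rw [cosCoeff_of_ae_eq hb, Complex.ofReal_div, Complex.ofReal_mul, neg_mul,
    div_mul_eq_mul_div, ← neg_div, eq_div_iff hc]
  linear_combination (amp k : ℂ) * hg

lemma cosCoeff_of_mem_neumannToNeumann {h : ℝ} {p : V × H} (hp : p ∈ neumannToNeumann (h ^ 2))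
    (k : ℕ) : cosCoeff p.2 k = -((amp k * h ^ 2 / Real.cosh (h * k) : ℝ) : ℂ)
      * inner ℂ (coshVec (h * k)) p.1 := by
  have hclosed : IsClosed {p : V × H | cosCoeff p.2 k
      = -((amp k * h ^ 2 / Real.cosh (h * k) : ℝ) : ℂ) * inner ℂ (coshVec (h * k)) p.1} :=
    isClosed_eq ((continuous_cosCoeff k).comp continuous_snd) (by fun_prop)
  refine closure_minimal ?_ hclosed hp
  rintro q ⟨v, f, hf, h1, h2⟩
  rw [mem_ofPred_eq, hf.cosCoeff_eq h2, inner_coshVec h1]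

lemma integral_cosh_mul (a : ℝ) :
    ∫ y in Ioo (-1 : ℝ) 0, Real.cosh (a * (y + 1)) = Real.cosh a * tanhc a := by
  rw [← integral_Ioc_eq_integral_Ioo, ← intervalIntegral.integral_of_le (by norm_num)]
  rcases eq_or_ne a 0 with rfl | ha
  · simp [tanhc_zero]
  · have hd : ∀ y ∈ uIcc (-1 : ℝ) 0, HasDerivAt (fun y : ℝ => Real.sinh (a * (y + 1)) / a)
      (Real.cosh (a * (y + 1))) y := fun y _ =>
      (((((hasDerivAt_id y).add_const 1).const_mul a).sinh).div_const a).congr_deriv (by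
        simp; field_simp)
    rw [intervalIntegral.integral_eq_sub_of_hasDerivAt hd
      (Continuous.intervalIntegrable (by fun_prop) _ _), tanhc_of_ne ha, Real.tanh_eq_sinh_div_cosh]
    have := (Real.cosh_pos a).ne'
    simp
    field_simp

/-- All coefficients being prescribed, at most one `b` is paired with the profile, so the
existential in `IsWaterWave` leaves no freedom. -/
lemma cosCoeff_of_profile_mem {h : ℝ} {b : H} (hb : (profile, b) ∈ neumannToNeumann (h ^ 2)) (k : ℕ) :
    cosCoeff b k = -((amp k * h ^ 2 * tanhc (h * k) : ℝ) : ℂ) := by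
  rw [cosCoeff_of_mem_neumannToNeumann hb, inner_coshVec (v := profile) (w := fun _ => 1)
    (MemLp.coeFn_toLp (memLp_const (1 : ℂ)))]
  simp only [one_mul]
  rw [integral_complex_ofReal, integral_cosh_mul]
  have hc := (Real.cosh_pos (h * k)).ne'
  rw [neg_mul, ← Complex.ofReal_mul]
  congr 2
  field_simp

end

noncomputable section

/-! ### The Neumann to Neumann map at the constant profile -/

lemma IsNeumannSolution.add {μ : ℝ} {v w : ℝ → ℂ} {f g : ℝ → ℝ → ℂ} (hf : IsNeumannSolution μ v f)
    (hg : IsNeumannSolution μ w g) :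
    IsNeumannSolution μ (fun y => v y + w y) (fun x y => f x y + g x y) := by
  have hslice1 : ∀ {f : ℝ → ℝ → ℂ}, ContDiff ℝ 2 (fun p : ℝ × ℝ => f p.1 p.2) → ∀ y,
      ContDiff ℝ 2 (fun x => f x y) := fun h y =>
    h.comp (contDiff_id.prodMk contDiff_const)
  have hslice2 : ∀ {f : ℝ → ℝ → ℂ}, ContDiff ℝ 2 (fun p : ℝ × ℝ => f p.1 p.2) → ∀ x,
      ContDiff ℝ 2 (f x) := fun h x => h.comp (contDiff_const.prodMk contDiff_id)
  have f1 := fun y x => ((hslice1 hf.contDiff y).differentiable two_ne_zero) x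
  have g1 := fun y x => ((hslice1 hg.contDiff y).differentiable two_ne_zero) x
  have f2 := fun x y => ((hslice2 hf.contDiff x).differentiable two_ne_zero) y
  have g2 := fun x y => ((hslice2 hg.contDiff x).differentiable two_ne_zero) y
  exact
  { contDiff := hf.contDiff.add hg.contDiff
    laplace := fun x hx y hy => by
      rw [iteratedDeriv_fun_add (hslice1 hf.contDiff y).contDiffAt (hslice1 hg.contDiff y).contDiffAt,
        iteratedDeriv_fun_add (hslice2 hf.contDiff x).contDiffAt (hslice2 hg.contDiff x).contDiffAt]
      linear_combination hf.laplace x hx y hy + hg.laplace x hx y hy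
    bottom := fun x hx => by
      rw [deriv_fun_add (f2 x _) (g2 x _), hf.bottom x hx, hg.bottom x hx, add_zero]
    right := fun y hy => by
      rw [deriv_fun_add (f1 y _) (g1 y _), hf.right y hy, hg.right y hy, add_zero]
    top := fun x hx => by rw [hf.top x hx, hg.top x hx, add_zero]
    left := fun y hy => by
      rw [deriv_fun_add (f1 y _) (g1 y _), hf.left y hy, hg.left y hy]; ring }

lemma IsNeumannSolution.const_mul {μ : ℝ} {v : ℝ → ℂ} {f : ℝ → ℝ → ℂ}
    (hf : IsNeumannSolution μ v f) (c : ℂ) :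
    IsNeumannSolution μ (fun y => c * v y) (fun x y => c * f x y) where
  contDiff := contDiff_const.mul hf.contDiff
  laplace := fun x hx y hy => by
    rw [iteratedDeriv_const_mul_field, iteratedDeriv_const_mul_field]
    linear_combination c * hf.laplace x hx y hy
  bottom := fun x hx => by rw [deriv_const_mul_field, hf.bottom x hx, mul_zero]
  right := fun y hy => by rw [deriv_const_mul_field, hf.right y hy, mul_zero]
  top := fun x hx => by rw [hf.top x hx, mul_zero]
  left := fun y hy => by rw [deriv_const_mul_field, hf.left y hy]; ring

/-- The wall velocities for which the Neumann problem has a classical solution. -/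
def classicalWall (μ : ℝ) : Submodule ℝ (ℝ → ℝ) where
  carrier := {v | ∃ f, IsNeumannSolution μ (fun y => (v y : ℂ)) f}
  add_mem' := by
    rintro v w ⟨f, hf⟩ ⟨g, hg⟩
    exact ⟨_, by simpa using hf.add hg⟩
  zero_mem' := ⟨fun _ _ => 0, by
    refine ⟨⟨contDiff_const, ?_, ?_, ?_⟩, ?_, ?_⟩ <;> simp⟩
  smul_mem' := by
    rintro c v ⟨f, hf⟩
    exact ⟨_, by simpa using hf.const_mul c⟩

/-- Separated solution `A cosh (r (π - x)) sin (σ y)` with `h r = σ`. An odd multiple `σ` of `π/2`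
makes the derivative vanish at `y = -1`, and the sine vanishes on the top. -/
lemma sin_mem_classicalWall {h : ℝ} (hh : 0 < h) (m : ℕ) :
    (fun y => Real.sin ((2 * m + 1) * (Real.pi / 2 * y))) ∈ classicalWall (h ^ 2) := by
  set σ : ℝ := (2 * m + 1) * (Real.pi / 2) with hσ
  have hσ0 : 0 < σ := by positivity
  set r : ℝ := σ / h with hr
  have hr0 : 0 < r := by positivity
  have hS : Real.sinh (r * Real.pi) ≠ 0 := (Real.sinh_pos_iff.2 (by positivity)).ne'
  -- Normalizes the slope at `x = 0` to `-sin (σ y)`.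
  set A : ℝ := 1 / (r * Real.sinh (r * Real.pi)) with hA
  have hsin : ∀ y : ℝ, HasDerivAt (fun y : ℝ => Real.sin (σ * y)) (σ * Real.cos (σ * y)) y :=
    fun y => (((hasDerivAt_id y).const_mul σ).sin).congr_deriv (by simp; ring)
  have hcos : ∀ y : ℝ, HasDerivAt (fun y : ℝ => Real.cos (σ * y)) (-(σ * Real.sin (σ * y))) y :=
    fun y => (((hasDerivAt_id y).const_mul σ).cos).congr_deriv (by simp; ring)
  have hcosh : ∀ x : ℝ, HasDerivAt (fun x : ℝ => Real.cosh (r * (Real.pi - x)))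
    (-(r * Real.sinh (r * (Real.pi - x)))) x := fun x =>
    ((((hasDerivAt_id x).const_sub Real.pi).const_mul r).cosh).congr_deriv (by simp; ring)
  have hsinh : ∀ x : ℝ, HasDerivAt (fun x : ℝ => Real.sinh (r * (Real.pi - x)))
    (-(r * Real.cosh (r * (Real.pi - x)))) x := fun x =>
    ((((hasDerivAt_id x).const_sub Real.pi).const_mul r).sinh).congr_deriv (by simp; ring)
  have hx : ∀ x y : ℝ, HasDerivAt (fun x : ℝ =>
      ((A * Real.cosh (r * (Real.pi - x)) * Real.sin (σ * y) : ℝ) : ℂ))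
      ((A * -(r * Real.sinh (r * (Real.pi - x))) * Real.sin (σ * y) : ℝ) : ℂ) x :=
    fun x y => (((hcosh x).const_mul A).mul_const _).ofReal_comp
  have hxx : ∀ x y : ℝ, HasDerivAt (fun x : ℝ =>
      ((A * -(r * Real.sinh (r * (Real.pi - x))) * Real.sin (σ * y) : ℝ) : ℂ))
      ((A * -(r * -(r * Real.cosh (r * (Real.pi - x)))) * Real.sin (σ * y) : ℝ) : ℂ) x :=
    fun x y => (((((hsinh x).const_mul r).neg).const_mul A).mul_const _).ofReal_comp
  have hy : ∀ x y : ℝ, HasDerivAt (fun y : ℝ =>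
      ((A * Real.cosh (r * (Real.pi - x)) * Real.sin (σ * y) : ℝ) : ℂ))
      ((A * Real.cosh (r * (Real.pi - x)) * (σ * Real.cos (σ * y)) : ℝ) : ℂ) y :=
    fun x y => ((hsin y).const_mul _).ofReal_comp
  have hyy : ∀ x y : ℝ, HasDerivAt (fun y : ℝ =>
      ((A * Real.cosh (r * (Real.pi - x)) * (σ * Real.cos (σ * y)) : ℝ) : ℂ))
      ((A * Real.cosh (r * (Real.pi - x)) * (σ * -(σ * Real.sin (σ * y))) : ℝ) : ℂ) y :=
    fun x y => (((hcos y).const_mul σ).const_mul _).ofReal_comp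
  have hsm : ContDiff ℝ 2 fun p : ℝ × ℝ =>
    A * Real.cosh (r * (Real.pi - p.1)) * Real.sin (σ * p.2) := by fun_prop
  have hcos0 : Real.cos (σ * -1) = 0 := by
    rw [mul_neg_one, Real.cos_neg, Real.cos_eq_zero_iff]
    exact ⟨m, by rw [hσ]; push_cast; ring⟩
  refine ⟨fun x y => ((A * Real.cosh (r * (Real.pi - x)) * Real.sin (σ * y) : ℝ) : ℂ), ?_⟩
  exact
  { contDiff := Complex.ofRealCLM.contDiff.comp hsm
    laplace := fun x _ y _ => by
      rw [iteratedDeriv_succ, iteratedDeriv_one, iteratedDeriv_succ, iteratedDeriv_one,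
        funext fun x => (hx x y).deriv, funext fun y => (hy x y).deriv, (hxx x y).deriv,
        (hyy x y).deriv, ← Complex.ofReal_mul, ← Complex.ofReal_add]
      norm_cast
      have : h * r = σ := by rw [hr]; field_simp
      rw [← this]; ring
    bottom := fun x _ => by rw [(hy x (-1)).deriv, hcos0]; simp
    right := fun y _ => by rw [(hx Real.pi y).deriv]; simp
    top := fun x _ => by simp
    left := fun y _ => by
      have e : (2 * (m : ℝ) + 1) * (Real.pi / 2 * y) = σ * y := by rw [hσ]; ring
      rw [(hx 0 y).deriv, sub_zero, ← Complex.ofReal_neg]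
      simp only [e]
      congr 1
      rw [hA]; field_simp }

/-- Multiplication by `sin² θ = (1 - cos 2θ) / 2` moves the odd index `2 m + 1` by `±2`, hence stays
in the span of the available sines. -/
lemma sin_pow_mul_sin_mem_classicalWall {h : ℝ} (hh : 0 < h) (n m : ℕ) :
    (fun y => Real.sin (Real.pi / 2 * y) ^ (2 * n) * Real.sin ((2 * m + 1) * (Real.pi / 2 * y)))
      ∈ classicalWall (h ^ 2) := by
  induction n generalizing m with
  | zero => simpa using sin_mem_classicalWall hh m
  | succ n ih =>
    have hsq : ∀ θ : ℝ, Real.sin θ ^ 2 = 1 / 2 - Real.cos (2 * θ) / 2 := fun θ => Real.sin_sq_eq_half_sub θ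
    have key : ∀ m' : ℝ, ∀ θ : ℝ, Real.sin θ ^ (2 * (n + 1)) * Real.sin ((2 * m' + 1) * θ)
        = (1 / 2) * (Real.sin θ ^ (2 * n) * Real.sin ((2 * m' + 1) * θ))
          - (1 / 4) * (Real.sin θ ^ (2 * n) * Real.sin ((2 * (m' + 1) + 1) * θ))
          - (1 / 4) * (Real.sin θ ^ (2 * n) * Real.sin ((2 * (m' - 1) + 1) * θ)) := fun m' θ => by
      have e1 : (2 * (m' + 1) + 1) * θ = (2 * m' + 1) * θ + 2 * θ := by ring
      have e2 : (2 * (m' - 1) + 1) * θ = (2 * m' + 1) * θ - 2 * θ := by ring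
      rw [e1, e2, Real.sin_add, Real.sin_sub, mul_add 2 n 1, pow_add, mul_one, hsq]
      ring
    cases m with
    | zero =>
      have h0 := ih 0
      have h1 := ih 1
      -- At `m = 0` the lower neighbour is `sin (-θ) = -sin θ`, so its coefficient `1/4` joins the
      -- `1/2`.
      convert Submodule.sub_mem _ (Submodule.smul_mem _ (3 / 4 : ℝ) h0)
        (Submodule.smul_mem _ (1 / 4 : ℝ) h1) using 1
      ext y
      have e2 : (2 * ((0 : ℝ) - 1) + 1) * (Real.pi / 2 * y) = -(Real.pi / 2 * y) := by ring
      simp only [Pi.sub_apply, Pi.smul_apply, smul_eq_mul, CharP.cast_eq_zero]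
      rw [key 0, e2, Real.sin_neg]
      norm_num
      ring
    | succ m =>
      convert Submodule.sub_mem _ (Submodule.sub_mem _ (Submodule.smul_mem _ (1 / 2 : ℝ) (ih (m + 1)))
        (Submodule.smul_mem _ (1 / 4 : ℝ) (ih (m + 2)))) (Submodule.smul_mem _ (1 / 4 : ℝ) (ih m)) using 1
      ext y
      simp only [Pi.sub_apply, Pi.smul_apply, smul_eq_mul]
      rw [key]
      push_cast
      ring_nf

lemma odd_polynomial_sin_mem_classicalWall {h : ℝ} (hh : 0 < h) (p : Polynomial ℝ) :
    (fun y => (p.eval (Real.sin (Real.pi / 2 * y)) - p.eval (-Real.sin (Real.pi / 2 * y))) / 2)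
      ∈ classicalWall (h ^ 2) := by
  induction p using Polynomial.induction_on' with
  | add p q hp hq =>
    convert Submodule.add_mem _ hp hq using 1
    ext y; simp; ring
  | monomial n a =>
    rcases Nat.even_or_odd' n with ⟨m, rfl | rfl⟩
    · convert Submodule.zero_mem _ using 1
      ext y; simp [Even.neg_pow (even_two_mul m)]
    · convert Submodule.smul_mem _ a (sin_pow_mul_sin_mem_classicalWall hh m 0) using 1
      ext y
      simp only [Polynomial.eval_monomial, Odd.neg_pow (odd_two_mul_add_one m), Pi.smul_apply,
        smul_eq_mul, CharP.cast_eq_zero, mul_zero, zero_add, one_mul, pow_succ]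
      ring

/-- The constant `1` is not itself classical: `f = 0` on the top forces the wall data to tend to `0`
at the corner. It is therefore approached boundedly and pointwise by odd polynomials in `sin (π y /
2)`, a function that is negative on `(-1, 0)`. -/
lemma exists_classicalWall_tendsto_one {h : ℝ} (hh : 0 < h) :
    ∃ v : ℕ → ℝ → ℝ, (∀ n, v n ∈ classicalWall (h ^ 2)) ∧ (∀ n, Continuous (v n)) ∧
      (∀ n y, |v n y| ≤ 2) ∧
      ∀ y ∈ Ioo (-1 : ℝ) 0, Tendsto (fun n => v n y) atTop (𝓝 1) := by
  -- Odd truncations of `-n s`, tending to `1` for every `s < 0`; taking the odd part of an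
  -- approximating polynomial does not increase the error.
  set φ : ℕ → ℝ → ℝ := fun n s => max (-1) (min 1 (-(n * s))) with hφ
  have hφc : ∀ n, Continuous (φ n) := fun n => by fun_prop
  have hφ1 : ∀ n s, |φ n s| ≤ 1 := fun n s =>
    abs_le.2 ⟨le_max_left _ _, max_le (by norm_num) (min_le_left _ _)⟩
  have hφodd : ∀ n s, φ n (-s) = -φ n s := fun n s => by
    simp only [hφ]
    rcases le_total (n * s) (-1) with h1 | h1 <;> rcases le_total (n * s) 1 with h2 | h2
    all_goals
      simp only [mul_neg, neg_neg, max_def, min_def]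
      split_ifs <;> linarith
  choose p hp using fun n : ℕ => exists_polynomial_near_of_continuousOn (-1) 1 (φ n)
    (hφc n).continuousOn (1 / (n + 1 : ℝ)) (by positivity)
  set s : ℝ → ℝ := fun y => Real.sin (Real.pi / 2 * y) with hs
  have hs1 : ∀ y, s y ∈ Icc (-1 : ℝ) 1 := fun y => ⟨Real.neg_one_le_sin _, Real.sin_le_one _⟩
  have hs2 : ∀ y, -s y ∈ Icc (-1 : ℝ) 1 := fun y => ⟨by linarith [(hs1 y).2], by linarith [(hs1 y).1]⟩
  set v : ℕ → ℝ → ℝ := fun n y => ((p n).eval (s y) - (p n).eval (-s y)) / 2 with hv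
  have hclose : ∀ n y, |v n y - φ n (s y)| ≤ 1 / (n + 1 : ℝ) := fun n y => by
    have h1 := abs_le.1 (hp n _ (hs1 y)).le
    have h2 := abs_le.1 (hp n _ (hs2 y)).le
    rw [hφodd] at h2
    rw [abs_le]
    simp only [hv]
    constructor <;> linarith [h1.1, h1.2, h2.1, h2.2]
  refine ⟨v, fun n => odd_polynomial_sin_mem_classicalWall hh (p n), fun n => by fun_prop,
    fun n y => ?_, fun y hy => ?_⟩
  · have h1 := abs_le.1 (hclose n y)
    have h2 := abs_le.1 (hφ1 n (s y))
    have h3 : 1 / (n + 1 : ℝ) ≤ 1 := by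
      rw [div_le_one (by positivity)]; linarith [Nat.cast_nonneg (α := ℝ) n]
    rw [abs_le]
    constructor <;> linarith [h1.1, h1.2, h2.1, h2.2]
  · have hsy : s y < 0 := Real.sin_neg_of_neg_of_neg_pi_lt
      (mul_neg_of_pos_of_neg (by positivity) hy.2) (by nlinarith [Real.pi_pos, hy.1])
    have hφt : ∀ᶠ n : ℕ in atTop, φ n (s y) = 1 := by
      have : Tendsto (fun n : ℕ => (n : ℝ) * (-s y)) atTop atTop :=
        tendsto_natCast_atTop_atTop.atTop_mul_const (by linarith)
      filter_upwards [this.eventually_ge_atTop 1] with n hn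
      simp only [hφ]
      rw [min_eq_left (by linarith), max_eq_right (by norm_num)]
    rw [tendsto_iff_norm_sub_tendsto_zero]
    refine squeeze_zero' (Eventually.of_forall fun _ => norm_nonneg _) ?_
      tendsto_one_div_add_atTop_nhds_zero_nat
    filter_upwards [hφt] with n hn
    have := hclose n y
    rwa [hn] at this

lemma tendsto_toLp_of_bounded {v : ℕ → ℝ → ℝ} {C : ℝ} (hv : ∀ n, Continuous (v n))
    (hb : ∀ n y, |v n y| ≤ C)
    (ht : ∀ y ∈ Ioo (-1 : ℝ) 0, Tendsto (fun n => v n y) atTop (𝓝 1)) :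
    Tendsto (fun n => (memLp_of_continuous (g := fun y => (v n y : ℂ))
      (Complex.continuous_ofReal.comp (hv n)) (-1) 0).toLp _) atTop (𝓝 profile) := by
  rw [tendsto_iff_norm_sub_tendsto_zero]
  have hsq : Tendsto (fun n => ‖(memLp_of_continuous (g := fun y => (v n y : ℂ))
      (Complex.continuous_ofReal.comp (hv n)) (-1) 0).toLp _ - profile‖ ^ 2) atTop (𝓝 0) := by
    have e : ∀ n, ‖(memLp_of_continuous (g := fun y => (v n y : ℂ))
        (Complex.continuous_ofReal.comp (hv n)) (-1) 0).toLp _ - profile‖ ^ 2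
        = ∫ y in Ioo (-1 : ℝ) 0, (v n y - 1) ^ 2 := fun n => by
      rw [← inner_self_eq_norm_sq (𝕜 := ℂ), L2.inner_def]
      have e2 : (∫ a in Ioo (-1 : ℝ) 0, inner ℂ (((memLp_of_continuous (g := fun y => (v n y : ℂ))
        (Complex.continuous_ofReal.comp (hv n)) (-1) 0).toLp _ - profile : V) a)
        (((memLp_of_continuous (g := fun y => (v n y : ℂ))
        (Complex.continuous_ofReal.comp (hv n)) (-1) 0).toLp _ - profile : V) a))
        = ((∫ y in Ioo (-1 : ℝ) 0, (v n y - 1) ^ 2 : ℝ) : ℂ) := by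
        rw [← integral_complex_ofReal]
        refine integral_congr_ae ?_
        filter_upwards [MemLp.coeFn_toLp (memLp_of_continuous (g := fun y => (v n y : ℂ))
          (Complex.continuous_ofReal.comp (hv n)) (-1) 0),
          MemLp.coeFn_toLp (memLp_const (1 : ℂ)), Lp.coeFn_sub ((memLp_of_continuous
          (g := fun y => (v n y : ℂ)) (Complex.continuous_ofReal.comp (hv n)) (-1) 0).toLp _) profile]
          with y h1 h2 h3
        rw [h3, Pi.sub_apply, h1, profile, h2, inner_self_eq_norm_sq_to_K,
          ← Complex.ofReal_one, ← Complex.ofReal_sub, Complex.norm_real, Real.norm_eq_abs]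
        norm_cast
        rw [sq_abs]
        rfl
      rw [e2]; simp
    simp_rw [e]
    have key : Tendsto (fun n => ∫ y in Ioo (-1 : ℝ) 0, (v n y - 1) ^ 2) atTop
        (𝓝 (∫ y in Ioo (-1 : ℝ) 0, (0 : ℝ))) := by
      refine tendsto_integral_of_dominated_convergence (fun _ => (C + 1) ^ 2) (fun n => ?_)
        (integrable_const _) (fun n => Eventually.of_forall fun y => ?_) ?_
      · have := hv n
        exact Continuous.aestronglyMeasurable (by fun_prop)
      · rw [norm_pow]
        refine pow_le_pow_left₀ (norm_nonneg _) ((norm_sub_le _ _).trans ?_) 2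
        rw [norm_one]
        exact add_le_add_left (hb n y) 1
      · filter_upwards [ae_restrict_mem measurableSet_Ioo] with y hy
        simpa using ((ht y hy).sub_const 1).pow 2
    simpa using key
  have := hsq.sqrt
  simpa [Real.sqrt_sq (norm_nonneg _)] using this

lemma continuous_deriv_top {μ : ℝ} {f : ℝ → ℝ → ℂ} (hf : IsPotential μ f) :
    Continuous fun x => deriv (f x) 0 := by
  have hd := hf.contDiff.differentiable two_ne_zero
  have e : ∀ x, deriv (f x) 0 = fderiv ℝ (fun p : ℝ × ℝ => f p.1 p.2) (x, 0) (0, 1) := fun x =>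
    (hasDerivAt_slice_snd (hd (x, 0))).deriv
  simp_rw [e]
  exact (contDiff_fderiv_apply hf.contDiff _).continuous.comp (by fun_prop)

lemma tanhc_le_inv {a : ℝ} (ha : 0 < a) : tanhc a ≤ 1 / a := by
  rw [tanhc_of_ne ha.ne']
  exact div_le_div_of_nonneg_right (tanh_le_one a) ha.le

/-- `B_μ 1` exists. -/
lemma exists_profile_mem_neumannToNeumann {h : ℝ} (hh : 0 < h) :
    ∃ b : H, (profile, b) ∈ neumannToNeumann (h ^ 2) := by
  obtain ⟨v, hv, hvc, hvb, hvt⟩ := exists_classicalWall_tendsto_one hh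
  choose f hf using hv
  set β : ℕ → H := fun n => ofCont (fun x => deriv (f n x) 0)
    (continuous_deriv_top (hf n).toIsPotential) with hβ
  have hβc : ∀ n k, cosCoeff (β n) k = -((amp k * h ^ 2 / Real.cosh (h * k) : ℝ) : ℂ)
      * ∫ y in Ioo (-1 : ℝ) 0, (v n y : ℂ) * Real.cosh (h * k * (y + 1)) := fun n k =>
    (hf n).cosCoeff_eq (coeFn_ofCont _ _) k
  set a : ℕ → ℂ := fun k => -((amp k * h ^ 2 / Real.cosh (h * k) : ℝ) : ℂ)
    * ∫ y in Ioo (-1 : ℝ) 0, ((1 : ℝ) : ℂ) * Real.cosh (h * k * (y + 1)) with ha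
  have hci : ∀ k : ℕ, Integrable (fun y => Real.cosh (h * k * (y + 1)))
      (volume.restrict (Ioo (-1 : ℝ) 0)) := fun k =>
    (Continuous.integrableOn_Icc (by fun_prop)).mono_set Ioo_subset_Icc_self
  have hlim : ∀ k, Tendsto (fun n => cosCoeff (β n) k) atTop (𝓝 (a k)) := fun k => by
    simp_rw [hβc]
    refine Tendsto.const_mul _ (tendsto_integral_of_dominated_convergence
      (fun y => 2 * Real.cosh (h * k * (y + 1)))
      (fun n => ?_) ((hci k).const_mul 2) (fun n => Eventually.of_forall fun y => ?_) ?_)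
    · have := hvc n
      exact Continuous.aestronglyMeasurable (by fun_prop)
    · rw [norm_mul, Complex.norm_real, Complex.norm_real, Real.norm_eq_abs,
        Real.norm_of_nonneg (Real.cosh_pos _).le]
      exact mul_le_mul_of_nonneg_right (hvb n y) (Real.cosh_pos _).le
    · filter_upwards [ae_restrict_mem measurableSet_Ioo] with y hy
      exact ((Complex.continuous_ofReal.tendsto _).comp (hvt y hy)).mul_const _
  -- A bound by `2 h / k`, uniform in `n`, gives uniform tails; convergence of each coefficient then
  -- becomes convergence of the images in `H`.
  have hbd : ∀ n (k : ℕ), 1 ≤ k → ‖cosCoeff (β n) k‖ ≤ 2 * h * ‖((1 / k : ℝ) : ℂ)‖ := fun n k hk => by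
    have hk0 : (0 : ℝ) < k := by exact_mod_cast hk
    have hc := Real.cosh_pos (h * k)
    have hI : ‖∫ y in Ioo (-1 : ℝ) 0, (v n y : ℂ) * Real.cosh (h * k * (y + 1))‖
        ≤ 2 * (Real.cosh (h * k) * tanhc (h * k)) := by
      rw [← integral_cosh_mul, ← integral_const_mul]
      refine norm_integral_le_of_norm_le ((hci k).const_mul 2) (Eventually.of_forall fun y => ?_)
      rw [norm_mul, Complex.norm_real, Complex.norm_real, Real.norm_eq_abs,
        Real.norm_of_nonneg (Real.cosh_pos _).le]
      exact mul_le_mul_of_nonneg_right (hvb n y) (Real.cosh_pos _).le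
    have hA : ‖-((amp k * h ^ 2 / Real.cosh (h * k) : ℝ) : ℂ)‖ ≤ h ^ 2 / Real.cosh (h * k) := by
      rw [norm_neg, Complex.norm_real, Real.norm_of_nonneg
        (div_nonneg (mul_nonneg (amp_pos k).le (sq_nonneg h)) hc.le)]
      exact div_le_div_of_nonneg_right (mul_le_of_le_one_left (sq_nonneg h) (amp_le_one k)) hc.le
    rw [hβc, norm_mul, Complex.norm_real, Real.norm_of_nonneg (by positivity)]
    calc _ ≤ h ^ 2 / Real.cosh (h * k) * (2 * (Real.cosh (h * k) * tanhc (h * k))) :=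
          mul_le_mul hA hI (norm_nonneg _) (by positivity)
      _ = 2 * h ^ 2 * tanhc (h * k) := by field_simp
      _ ≤ 2 * h ^ 2 * (1 / (h * k)) :=
          mul_le_mul_of_nonneg_left (tanhc_le_inv (by positivity)) (by positivity)
      _ = 2 * h * (1 / k) := by field_simp
  have hsum : Summable fun k : ℕ => ‖((1 / k : ℝ) : ℂ)‖ ^ 2 := by
    have : ∀ k : ℕ, ‖((1 / k : ℝ) : ℂ)‖ ^ 2 = 1 / (k : ℝ) ^ 2 := fun k => by
      rw [Complex.norm_real, Real.norm_of_nonneg (by positivity), div_pow, one_pow]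
    simp_rw [this]
    exact Real.summable_one_div_nat_pow.2 one_lt_two
  have htails : UniformTails (univ : Set ℕ) (fun n k => cosCoeff (β n) k) :=
    (UniformTails.const hsum).of_norm_le (C := 2 * h) fun n _ k hk => hbd n k hk
  have hasum : Summable fun k => ‖a k‖ ^ 2 := by
    refine (((UniformTails.const (S := (univ : Set Unit)) hsum).of_norm_le (f := fun _ => a)
      (C := 2 * h) fun _ _ k hk => ?_)).summable (x := ()) trivial
    exact le_of_tendsto (hlim k).norm (Eventually.of_forall fun n => hbd n k hk)
  have ht := htails.tendsto_synth univ_mem hasum hlim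
  have hsynth : ∀ n, synth (fun k => cosCoeff (β n) k) = β n := fun n =>
    ext_cosCoeff fun k => cosCoeff_synth (hasSum_norm_sq_cosCoeff (β n)).summable k
  simp_rw [hsynth] at ht
  refine ⟨synth a, mem_closure_of_tendsto ((tendsto_toLp_of_bounded hvc hvb hvt).prodMk_nhds ht)
    (Eventually.of_forall fun n => ?_)⟩
  exact ⟨fun y => (v n y : ℂ), f n, hf n,
    MemLp.coeFn_toLp (memLp_of_continuous (Complex.continuous_ofReal.comp (hvc n)) (-1) 0),
    coeFn_ofCont _ (continuous_deriv_top (hf n).toIsPotential)⟩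

end

noncomputable section

/-! ### Weak derivatives and cosine series -/

lemma inner_ofCont_real (χ : ℝ → ℝ) (hχ : Continuous χ) (η : H) :
    inner ℂ (ofCont (fun x => (χ x : ℂ)) (Complex.continuous_ofReal.comp hχ)) η
      = ∫ x in Ioo 0 Real.pi, ((χ x : ℝ) : ℂ) * η x := by
  rw [inner_ofCont_left]
  congr 1; ext x; rw [Complex.conj_ofReal, mul_comm]

lemma hasDerivAt_sinMode (k : ℕ) (x : ℝ) : HasDerivAt (sinMode k) (k * cosMode k x) x := by
  have h : HasDerivAt (sinMode k) (√(2 / Real.pi) * (Real.cos (k * x) * (k * 1))) x :=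
    (((hasDerivAt_id x).const_mul (k : ℝ)).sin).const_mul _
  refine h.congr_deriv ?_
  rcases Nat.eq_zero_or_pos k with rfl | hk
  · simp
  · rw [cosMode, if_neg hk.ne']; ring

lemma hasDerivAt_cosMode (k : ℕ) (x : ℝ) : HasDerivAt (cosMode k) (-(k * sinMode k x)) x := by
  have h : HasDerivAt (fun x => amp k * Real.cos (k * x)) (amp k * (-Real.sin (k * x) * (k * 1))) x :=
    (((hasDerivAt_id x).const_mul (k : ℝ)).cos).const_mul _
  rw [show cosMode k = fun x => amp k * Real.cos (k * x) from funext (cosMode_eq k)]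
  refine h.congr_deriv ?_
  rcases Nat.eq_zero_or_pos k with rfl | hk
  · simp
  · rw [amp, if_neg hk.ne', sinMode]; ring

lemma exists_bound_deriv_smoothTransition :
    ∃ M, 0 ≤ M ∧ ∀ z, |deriv Real.smoothTransition z| ≤ M := by
  have hc : Continuous (deriv Real.smoothTransition) :=
    (Real.smoothTransition.contDiff (n := 1)).continuous_deriv le_rfl
  obtain ⟨M, hM⟩ := (isCompact_Icc (a := (0 : ℝ)) (b := 1)).exists_bound_of_continuousOn hc.continuousOn
  refine ⟨M, (norm_nonneg _).trans (hM 0 (by simp)), fun z => ?_⟩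
  have hM0 : 0 ≤ M := (norm_nonneg _).trans (hM 0 (by simp))
  rcases lt_or_ge z 0 with h0 | h0
  · have : Real.smoothTransition =ᶠ[𝓝 z] fun _ => 0 := by
      filter_upwards [gt_mem_nhds h0] with y hy using Real.smoothTransition.zero_of_nonpos hy.le
    rw [this.deriv_eq]; simpa using hM0
  · rcases lt_or_ge 1 z with h1 | h1
    · have : Real.smoothTransition =ᶠ[𝓝 z] fun _ => 1 := by
        filter_upwards [lt_mem_nhds h1] with y hy using Real.smoothTransition.one_of_one_le hy.le
      rw [this.deriv_eq]; simpa using hM0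
    · exact hM z ⟨h0, h1⟩

lemma deriv_smoothTransition_of_one_lt {z : ℝ} (hz : 1 < z) : deriv Real.smoothTransition z = 0 := by
  have : Real.smoothTransition =ᶠ[𝓝 z] fun _ => 1 := by
    filter_upwards [lt_mem_nhds hz] with y hy using Real.smoothTransition.one_of_one_le hy.le
  rw [this.deriv_eq]; simp

/-- A test function need only vanish linearly at the end points. -/
lemma HasWeakDeriv.integral_eq {η dη : H} (h : HasWeakDeriv η dη) {g : ℝ → ℝ} (hg : ContDiff ℝ ∞ g)
    {L : ℝ} (hL0 : ∀ x ∈ Ioo 0 Real.pi, |g x| ≤ L * x)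
    (hL1 : ∀ x ∈ Ioo 0 Real.pi, |g x| ≤ L * (Real.pi - x))
    (hL2 : ∀ x ∈ Ioo 0 Real.pi, |deriv g x| ≤ L) :
    ∫ x in Ioo 0 Real.pi, ((deriv g x : ℝ) : ℂ) * η x
      = -∫ x in Ioo 0 Real.pi, ((g x : ℝ) : ℂ) * dη x := by
  obtain ⟨M, hM0, hM⟩ := exists_bound_deriv_smoothTransition
  set S := Real.smoothTransition with hS
  have hSd : ∀ z, HasDerivAt S (deriv S z) z := fun z =>
    ((Real.smoothTransition.contDiff (n := 1)).differentiable one_ne_zero z).hasDerivAt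
  have hS01 : ∀ z, |S z| ≤ 1 := fun z => by
    rw [abs_of_nonneg (Real.smoothTransition.nonneg z)]; exact Real.smoothTransition.le_one z
  -- A cutoff that vanishes within `1/n` of the end points and equals `1` at distance at least `2/n`
  -- from them.
  set ρ : ℕ → ℝ → ℝ := fun n x => S (n * x - 1) * S (n * (Real.pi - x) - 1) with hρ
  have hρc : ∀ n, ContDiff ℝ ∞ (ρ n) := fun n =>
    (Real.smoothTransition.contDiff.comp (by fun_prop)).mul
      (Real.smoothTransition.contDiff.comp (by fun_prop))
  set ρ' : ℕ → ℝ → ℝ := fun n x => deriv S (n * x - 1) * n * S (n * (Real.pi - x) - 1)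
    + S (n * x - 1) * (deriv S (n * (Real.pi - x) - 1) * -n) with hρ'
  have hρd : ∀ n x, HasDerivAt (ρ n) (ρ' n x) x := fun n x => by
    have h1 : HasDerivAt (fun x : ℝ => (n : ℝ) * x - 1) n x := by
      simpa using ((hasDerivAt_id x).const_mul (n : ℝ)).sub_const 1
    have h2 : HasDerivAt (fun x : ℝ => (n : ℝ) * (Real.pi - x) - 1) (-n) x := by
      simpa using (((hasDerivAt_id x).const_sub Real.pi).const_mul (n : ℝ)).sub_const 1
    exact ((hSd _).comp x h1).mul ((hSd _).comp x h2)
  have hgd : ∀ x, HasDerivAt g (deriv g x) x := fun x =>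
    ((hg.differentiable (by simp)) x).hasDerivAt
  have hχd : ∀ n x, deriv (fun x => ρ n x * g x) x = ρ' n x * g x + ρ n x * deriv g x :=
    fun n x => ((hρd n x).mul (hgd x)).deriv
  have hsupp : ∀ n : ℕ, 1 ≤ n → tsupport (fun x => ρ n x * g x)
      ⊆ Icc (1 / n : ℝ) (Real.pi - 1 / n) := fun n hn => by
    have hn0 : (0 : ℝ) < n := by exact_mod_cast hn
    refine closure_minimal (fun x hx => ?_) isClosed_Icc
    have hx' : ρ n x ≠ 0 := left_ne_zero_of_mul hx
    constructor
    · by_contra hlt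
      refine left_ne_zero_of_mul hx' (Real.smoothTransition.zero_of_nonpos ?_)
      rw [not_le, lt_div_iff₀ hn0] at hlt
      linarith
    · by_contra hlt
      refine right_ne_zero_of_mul hx' (Real.smoothTransition.zero_of_nonpos ?_)
      have : (Real.pi - x) < 1 / n := by linarith
      rw [lt_div_iff₀ hn0] at this
      linarith
  have hweak : ∀ n : ℕ, 1 ≤ n →
      ∫ x in Ioo 0 Real.pi, ((ρ' n x * g x + ρ n x * deriv g x : ℝ) : ℂ) * η x
        = -∫ x in Ioo 0 Real.pi, ((ρ n x * g x : ℝ) : ℂ) * dη x := fun n hn => by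
    have hn0 : (0 : ℝ) < n := by exact_mod_cast hn
    have := h (fun x => ρ n x * g x) ((hρc n).mul hg)
      (isCompact_Icc.of_isClosed_subset (isClosed_tsupport _) (hsupp n hn))
      ((hsupp n hn).trans fun x hx => ⟨lt_of_lt_of_le (by positivity) hx.1,
        lt_of_le_of_lt hx.2 (by linarith [show (0 : ℝ) < 1 / n by positivity])⟩)
    simp_rw [hχd] at this
    exact this
  have hev : ∀ x ∈ Ioo 0 Real.pi, ∀ᶠ n : ℕ in atTop, ρ n x = 1 ∧ ρ' n x = 0 := fun x hx => by
    have t1 : Tendsto (fun n : ℕ => (n : ℝ) * x) atTop atTop :=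
      tendsto_natCast_atTop_atTop.atTop_mul_const hx.1
    have t2 : Tendsto (fun n : ℕ => (n : ℝ) * (Real.pi - x)) atTop atTop :=
      tendsto_natCast_atTop_atTop.atTop_mul_const (by linarith [hx.2])
    filter_upwards [t1.eventually_gt_atTop 2, t2.eventually_gt_atTop 2] with n h1 h2
    have e1 := Real.smoothTransition.one_of_one_le (show 1 ≤ n * x - 1 by linarith)
    have e2 := Real.smoothTransition.one_of_one_le (show 1 ≤ n * (Real.pi - x) - 1 by linarith)
    have e3 := deriv_smoothTransition_of_one_lt (show 1 < n * x - 1 by linarith)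
    have e4 := deriv_smoothTransition_of_one_lt (show 1 < n * (Real.pi - x) - 1 by linarith)
    constructor
    · simp only [hρ, hS, e1, e2, mul_one]
    · simp only [hρ', hS, e3, e4]; ring
  have hρ1 : ∀ n x, |ρ n x| ≤ 1 := fun n x => by
    rw [hρ]; simp only [abs_mul]
    exact mul_le_one₀ (hS01 _) (abs_nonneg _) (hS01 _)
  -- The derivative of the cutoff has size `M n` but lives where `n d ≤ 2`; there `|g| ≤ L d` keeps
  -- the product bounded, as dominated convergence requires.
  have hedge : ∀ (n : ℕ) (d : ℝ), 0 < d → ∀ x, |g x| ≤ L * d →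
      |deriv S (n * d - 1) * n * g x| ≤ 2 * M * L := fun n d hd x hx => by
    have hL : 0 ≤ L := by
      by_contra hneg
      have : L * d < 0 := mul_neg_of_neg_of_pos (not_le.1 hneg) hd
      linarith [abs_nonneg (g x)]
    rcases lt_or_ge 1 (n * d - 1) with h1 | h1
    · rw [deriv_smoothTransition_of_one_lt h1]; simp; positivity
    · rw [abs_mul, abs_mul, Nat.abs_cast]
      calc _ ≤ M * n * (L * d) := by gcongr; exact hM _
        _ = M * L * (n * d) := by ring
        _ ≤ M * L * 2 := mul_le_mul_of_nonneg_left (by linarith) (by positivity)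
        _ = 2 * M * L := by ring
  have hbound : ∀ n, ∀ x ∈ Ioo 0 Real.pi, |ρ' n x * g x + ρ n x * deriv g x|
      ≤ 4 * M * L + L := fun n x hx => by
    have h1 := hedge n x hx.1 x (hL0 x hx)
    have h2 := hedge n (Real.pi - x) (by linarith [hx.2]) x (hL1 x hx)
    have e : ρ' n x * g x + ρ n x * deriv g x
        = (deriv S (n * x - 1) * n * g x) * S (n * (Real.pi - x) - 1)
          - (deriv S (n * (Real.pi - x) - 1) * n * g x) * S (n * x - 1) + ρ n x * deriv g x := by
      simp only [hρ']; ring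
    rw [e]
    have b1 : |(deriv S (n * x - 1) * n * g x) * S (n * (Real.pi - x) - 1)| ≤ 2 * M * L := by
      rw [abs_mul]; exact (mul_le_of_le_one_right (abs_nonneg _) (hS01 _)).trans h1
    have b2 : |(deriv S (n * (Real.pi - x) - 1) * n * g x) * S (n * x - 1)| ≤ 2 * M * L := by
      rw [abs_mul]; exact (mul_le_of_le_one_right (abs_nonneg _) (hS01 _)).trans h2
    have b3 : |ρ n x * deriv g x| ≤ L := by
      rw [abs_mul]; exact (mul_le_of_le_one_left (abs_nonneg _) (hρ1 n x)).trans (hL2 x hx)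
    rw [abs_le] at b1 b2 b3 ⊢
    constructor <;> linarith [b1.1, b1.2, b2.1, b2.2, b3.1, b3.2]
  have hSc : Continuous (deriv S) :=
    (Real.smoothTransition.contDiff (n := 1)).continuous_deriv le_rfl
  have hScc : Continuous S := Real.smoothTransition.continuous
  have hgc : Continuous (deriv g) := hg.continuous_deriv (by simp)
  have hgcc : Continuous g := hg.continuous
  have l1 : Tendsto (fun n : ℕ => ∫ x in Ioo 0 Real.pi,
      ((ρ' n x * g x + ρ n x * deriv g x : ℝ) : ℂ) * η x) atTop
      (𝓝 (∫ x in Ioo 0 Real.pi, ((deriv g x : ℝ) : ℂ) * η x)) := by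
    refine tendsto_integral_of_dominated_convergence (fun x => (4 * M * L + L) * ‖η x‖)
      (fun n => ?_) ((integrable_coeFn η).norm.const_mul _) (fun n => ?_) ?_
    · exact (Continuous.aestronglyMeasurable (by fun_prop)).mul (integrable_coeFn η).aestronglyMeasurable
    · filter_upwards [ae_restrict_mem measurableSet_Ioo] with x hx
      rw [norm_mul, Complex.norm_real]
      exact mul_le_mul_of_nonneg_right (hbound n x hx) (norm_nonneg _)
    · filter_upwards [ae_restrict_mem measurableSet_Ioo] with x hx
      refine tendsto_const_nhds.congr' ?_
      filter_upwards [hev x hx] with n hn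
      rw [hn.1, hn.2]; simp
  have l2 : Tendsto (fun n : ℕ => ∫ x in Ioo 0 Real.pi, ((ρ n x * g x : ℝ) : ℂ) * dη x) atTop
      (𝓝 (∫ x in Ioo 0 Real.pi, ((g x : ℝ) : ℂ) * dη x)) := by
    refine tendsto_integral_of_dominated_convergence (fun x => ‖((g x : ℝ) : ℂ) * dη x‖)
      (fun n => ?_) ?_ (fun n => ?_) ?_
    · exact (Continuous.aestronglyMeasurable (by fun_prop)).mul (integrable_coeFn dη).aestronglyMeasurable
    · refine ((integrable_mul_of_continuous dη (g := fun x => ((g x : ℝ) : ℂ)) (by fun_prop)).congr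
        (Eventually.of_forall fun x => mul_comm _ _)).norm
    · filter_upwards with x
      rw [norm_mul, norm_mul, Complex.norm_real, Complex.norm_real, norm_mul]
      exact mul_le_mul_of_nonneg_right (mul_le_of_le_one_left (norm_nonneg _) (hρ1 n x))
        (norm_nonneg _)
    · filter_upwards [ae_restrict_mem measurableSet_Ioo] with x hx
      refine tendsto_const_nhds.congr' ?_
      filter_upwards [hev x hx] with n hn
      rw [hn.1]; simp
  refine tendsto_nhds_unique l1 (l2.neg.congr' ?_)
  filter_upwards [eventually_ge_atTop 1] with n hn using (hweak n hn).symm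

/-- Sines vanish linearly at both ends, so they are legitimate test functions and no boundary
condition on `η` is needed. -/
lemma inner_sinVec_weakDeriv {η dη : H} (h : HasWeakDeriv η dη) (k : ℕ) :
    inner ℂ (sinVec k) dη = -(k * cosCoeff η k) := by
  have hpi := Real.pi_pos
  have hg : ContDiff ℝ ∞ (sinMode k) := by unfold sinMode; fun_prop
  have hd : ∀ x, deriv (sinMode k) x = k * cosMode k x := fun x => (hasDerivAt_sinMode k x).deriv
  have hs : ∀ x, 0 ≤ x → |Real.sin (k * x)| ≤ k * x := fun x hx => by
    have := Real.abs_sin_le_abs (x := k * x)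
    rwa [abs_of_nonneg (show 0 ≤ (k : ℝ) * x by positivity)] at this
  have key := h.integral_eq hg (L := √(2 / Real.pi) * k)
    (fun x hx => by
      rw [sinMode, abs_mul, abs_of_nonneg (Real.sqrt_nonneg _), mul_assoc]
      exact mul_le_mul_of_nonneg_left (hs x hx.1.le) (Real.sqrt_nonneg _))
    (fun x hx => by
      rw [sinMode, abs_mul, abs_of_nonneg (Real.sqrt_nonneg _), mul_assoc]
      refine mul_le_mul_of_nonneg_left ?_ (Real.sqrt_nonneg _)
      have e : |Real.sin (k * x)| = |Real.sin (k * (Real.pi - x))| := by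
        rw [mul_sub, Real.sin_sub, Real.sin_nat_mul_pi, zero_mul, zero_sub, abs_neg, abs_mul,
          Real.abs_cos_eq_sqrt_one_sub_sin_sq (k * Real.pi), Real.sin_nat_mul_pi]
        simp
      rw [e]
      exact hs _ (by linarith [hx.2]))
    (fun x _ => by
      have := (hasDerivAt_sinMode k x).deriv
      have h2 : deriv (sinMode k) x = √(2 / Real.pi) * (Real.cos (k * x) * (k * 1)) :=
        ((((hasDerivAt_id x).const_mul (k : ℝ)).sin).const_mul _).deriv
      rw [h2, mul_one, abs_mul, abs_mul, Nat.abs_cast, abs_of_nonneg (Real.sqrt_nonneg _)]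
      exact mul_le_mul_of_nonneg_left (mul_le_of_le_one_left (Nat.cast_nonneg _)
        (Real.abs_cos_le_one _)) (Real.sqrt_nonneg _))
  rw [sinVec, inner_ofCont_real _ (continuous_sinMode k), ← neg_eq_iff_eq_neg.2 key, neg_inj,
    cosCoeff, ← integral_const_mul]
  congr 1; ext x
  rw [hd]; push_cast; ring

/-- Bessel's inequality for the sine coefficients of the weak derivative. -/
lemma summable_sq_mul_cosCoeff {η dη : H} (h : HasWeakDeriv η dη) :
    Summable fun k : ℕ => ‖k * cosCoeff η k‖ ^ 2 := by
  rw [← summable_nat_add_iff 1]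
  have := orthonormal_sinVec.inner_products_summable (x := dη)
  refine this.congr fun k => ?_
  rw [inner_sinVec_weakDeriv h, norm_neg]

lemma cosCoeff_ofCont_deriv {χ : ℝ → ℝ} (hχ : ContDiff ℝ 1 χ) (h0 : χ 0 = 0) (hpi : χ Real.pi = 0)
    (k : ℕ) :
    cosCoeff (ofCont (fun x => ((deriv χ x : ℝ) : ℂ))
        (Complex.continuous_ofReal.comp (hχ.continuous_deriv le_rfl))) k
      = k * inner ℂ (sinVec k)
        (ofCont (fun x => ((χ x : ℝ) : ℂ)) (Complex.continuous_ofReal.comp hχ.continuous)) := by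
  rw [← inner_cosVec, cosVec, sinVec, inner_ofCont_ofCont (continuous_cosMode k)
    (hχ.continuous_deriv le_rfl), inner_ofCont_ofCont (continuous_sinMode k) hχ.continuous]
  rw [intervalIntegral.integral_mul_deriv_eq_deriv_mul (fun x _ => hasDerivAt_cosMode k x)
    (fun x _ => ((hχ.differentiable one_ne_zero) x).hasDerivAt)
    ((continuous_const.mul (continuous_sinMode k)).neg.intervalIntegrable _ _)
    ((hχ.continuous_deriv le_rfl).intervalIntegrable _ _), h0, hpi]
  simp_rw [neg_mul, mul_assoc]
  rw [intervalIntegral.integral_neg, intervalIntegral.integral_const_mul]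
  push_cast
  ring

/-- The isometry mapping the `k`-th vector of the cosine basis to the `k`-th vector of an
orthonormal family. -/
def isometryOfOrthonormal {e : ℕ → H} (he : Orthonormal ℂ e) : H →ₗᵢ[ℂ] H :=
  he.orthogonalFamily.linearIsometry.comp cosBasis.repr.toLinearIsometry

lemma isometryOfOrthonormal_cosVec {e : ℕ → H} (he : Orthonormal ℂ e) (k : ℕ) :
    isometryOfOrthonormal he (cosVec k) = e k := by
  have h : cosBasis.repr (cosVec k) = lp.single 2 k (1 : ℂ) := by
    rw [← cosBasis_apply, HilbertBasis.repr_self]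
  simp only [isometryOfOrthonormal, LinearIsometry.coe_comp, Function.comp_apply,
    LinearIsometryEquiv.coe_toLinearIsometry, h]
  rw [OrthogonalFamily.linearIsometry_apply_single]
  simp

lemma orthonormal_cosVec_succ : Orthonormal ℂ (fun k : ℕ => cosVec (k + 1)) :=
  orthonormal_cosVec.comp _ (add_left_injective 1)

/-- The operator `∑ w_k φ_k ↦ ∑_{k ≥ 1} w_k √(2/π) sin (k x)`. -/
def cosToSin : H →L[ℂ] H :=
  (isometryOfOrthonormal orthonormal_sinVec).toContinuousLinearMap.comp
    (ContinuousLinearMap.adjoint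
      (isometryOfOrthonormal orthonormal_cosVec_succ).toContinuousLinearMap)

lemma cosCoeff_adjoint_isometryOfOrthonormal {e : ℕ → H} (he : Orthonormal ℂ e) (w : H) (k : ℕ) :
    cosCoeff (ContinuousLinearMap.adjoint (isometryOfOrthonormal he).toContinuousLinearMap w) k
      = inner ℂ (e k) w := by
  rw [← inner_cosVec, ContinuousLinearMap.adjoint_inner_right]
  simp [isometryOfOrthonormal_cosVec]

lemma hasSum_inner_cosToSin (ξ w : H) :
    HasSum (fun k : ℕ => conj (inner ℂ (sinVec (k + 1)) ξ) * cosCoeff w (k + 1))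
      (inner ℂ ξ (cosToSin w)) := by
  rw [cosToSin, ContinuousLinearMap.comp_apply, ← ContinuousLinearMap.adjoint_inner_left]
  have := hasSum_inner_cosCoeff
    (ContinuousLinearMap.adjoint (isometryOfOrthonormal orthonormal_sinVec).toContinuousLinearMap ξ)
    (ContinuousLinearMap.adjoint
      (isometryOfOrthonormal orthonormal_cosVec_succ).toContinuousLinearMap w)
  simpa only [cosCoeff_adjoint_isometryOfOrthonormal, inner_cosVec] using this

/-- Parseval: a test function vanishes at the ends, so the cosine coefficients of `χ'` are `k` times
the sine coefficients of `χ`. The bounded operator `cosToSin` carries time continuity and time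
integrals over to the derivative. -/
lemma hasWeakDeriv_of_cosCoeff {z w : H} (h : ∀ k : ℕ, cosCoeff w k = k * cosCoeff z k) :
    HasWeakDeriv z (-cosToSin w) := by
  intro χ hχ _ hsupp
  have h1 : ContDiff ℝ 1 χ := hχ.of_le (by simp)
  have h0 : χ 0 = 0 := image_eq_zero_of_notMem_tsupport fun h => lt_irrefl _ (hsupp h).1
  have hpi : χ Real.pi = 0 := image_eq_zero_of_notMem_tsupport fun h => lt_irrefl _ (hsupp h).2
  rw [← inner_ofCont_real _ (h1.continuous_deriv le_rfl), ← inner_ofCont_real _ h1.continuous,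
    inner_neg_right, neg_neg]
  refine HasSum.unique ?_ (hasSum_inner_cosToSin _ w)
  have hs := hasSum_inner_cosCoeff (ofCont (fun x => ((deriv χ x : ℝ) : ℂ))
        (Complex.continuous_ofReal.comp (h1.continuous_deriv le_rfl))) z
  simp_rw [cosCoeff_ofCont_deriv h1 h0 hpi] at hs
  -- The zero mode contributes nothing, while the sine system starts at index `1`.
  rw [← hasSum_nat_add_iff' 1] at hs
  simp only [Finset.range_one, Finset.sum_singleton, Nat.cast_zero, zero_mul, map_zero, sub_zero] at hs
  refine hs.congr_fun fun k => ?_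
  rw [h, map_mul, Complex.conj_natCast]
  ring

lemma hasWeakDeriv_cosVec (k : ℕ) : HasWeakDeriv (cosVec k) (-((k : ℂ) • sinVec k)) := by
  intro χ hχ _ hsupp
  have h1 : ContDiff ℝ 1 χ := hχ.of_le (by simp)
  have h0 : χ 0 = 0 := image_eq_zero_of_notMem_tsupport fun h => lt_irrefl _ (hsupp h).1
  have hpi : χ Real.pi = 0 := image_eq_zero_of_notMem_tsupport fun h => lt_irrefl _ (hsupp h).2
  rw [← inner_ofCont_real _ (h1.continuous_deriv le_rfl), ← inner_ofCont_real _ h1.continuous,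
    inner_neg_right, neg_neg, inner_smul_right, ← inner_conj_symm, inner_cosVec,
    cosCoeff_ofCont_deriv h1 h0 hpi, map_mul, inner_conj_symm, Complex.conj_natCast]

lemma hasValueAtZero_cosVec (k : ℕ) : HasValueAtZero (cosVec k) (amp k) :=
  ⟨fun x => (cosMode k x : ℂ), (Complex.continuous_ofReal.comp (continuous_cosMode k)).continuousOn,
    coeFn_ofCont _ (Complex.continuous_ofReal.comp (continuous_cosMode k)), by simp [cosMode_eq]⟩

/-- The value at `0` of an element of `W^{1,2}[0, π]` is the sum of its cosine series. -/
lemma hasSum_valueAtZero {ψ dψ : H} {c : ℂ} (h : HasWeakDeriv ψ dψ) (hc : HasValueAtZero ψ c) :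
    HasSum (fun k => amp k * cosCoeff ψ k) c := by
  -- Absolute summability from `|c_k| = (1/k) (k |c_k|)` and the arithmetic-geometric mean
  -- inequality; the cosine series then converges uniformly.
  have hsum : Summable fun k => ‖cosCoeff ψ k‖ := by
    have h1 : Summable fun k : ℕ => 1 / (k : ℝ) ^ 2 := Real.summable_one_div_nat_pow.2 one_lt_two
    refine Summable.of_norm_bounded_eventually_nat (h1.add (summable_sq_mul_cosCoeff h)) ?_
    filter_upwards [eventually_ge_atTop 1] with k hk
    have hk0 : (0 : ℝ) < k := by exact_mod_cast hk
    rw [norm_norm, norm_mul, Complex.norm_natCast]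
    have e : ‖cosCoeff ψ k‖ = (1 / k) * (k * ‖cosCoeff ψ k‖) := by field_simp
    have e2 : 1 / (k : ℝ) ^ 2 = (1 / k) ^ 2 := by rw [div_pow, one_pow]
    rw [e2]
    nlinarith [sq_nonneg ((1 / k : ℝ) - k * ‖cosCoeff ψ k‖), sq_nonneg (1 / k : ℝ),
      sq_nonneg (k * ‖cosCoeff ψ k‖)]
  have hterm : ∀ (k : ℕ) (x : ℝ), ‖cosCoeff ψ k * (cosMode k x : ℂ)‖ ≤ ‖cosCoeff ψ k‖ := fun k x => by
    rw [norm_mul, Complex.norm_real, cosMode_eq, norm_mul, Real.norm_of_nonneg (amp_pos k).le]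
    exact mul_le_of_le_one_right (norm_nonneg _)
      (mul_le_one₀ (amp_le_one k) (norm_nonneg _) (Real.abs_cos_le_one _))
  have hcont : ∀ k, Continuous fun x => cosCoeff ψ k * (cosMode k x : ℂ) := fun k =>
    continuous_const.mul (Complex.continuous_ofReal.comp (continuous_cosMode k))
  set q : ℝ → ℂ := fun x => ∑' k, cosCoeff ψ k * (cosMode k x : ℂ) with hq
  have hqc : Continuous q := continuous_tsum hcont hsum hterm
  have hqs : ∀ x, HasSum (fun k => cosCoeff ψ k * (cosMode k x : ℂ)) (q x) := fun x =>
    (Summable.of_norm_bounded hsum fun k => hterm k x).hasSum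
  have hψq : ofCont q hqc = ψ := by
    refine ext_cosCoeff fun j => ?_
    rw [← inner_cosVec, cosVec, inner_ofCont_real _ (continuous_cosMode j)]
    have e : ∫ x in Ioo 0 Real.pi, ((cosMode j x : ℝ) : ℂ) * ofCont q hqc x
        = ∫ x in Ioo 0 Real.pi, ∑' k, ((cosMode j x : ℝ) : ℂ) * (cosCoeff ψ k * (cosMode k x : ℂ)) := by
      refine integral_congr_ae ?_
      filter_upwards [coeFn_ofCont q hqc] with x hx
      rw [hx, tsum_mul_left]
    have hcm : ∀ x, ‖((cosMode j x : ℝ) : ℂ)‖ ≤ 1 := fun x => by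
      rw [Complex.norm_real, cosMode_eq, norm_mul, Real.norm_of_nonneg (amp_pos j).le]
      exact mul_le_one₀ (amp_le_one j) (norm_nonneg _) (Real.abs_cos_le_one _)
    have hbd : ∀ k x, ‖((cosMode j x : ℝ) : ℂ) * (cosCoeff ψ k * (cosMode k x : ℂ))‖
        ≤ ‖cosCoeff ψ k‖ := fun k x => by
      rw [norm_mul]
      exact (mul_le_of_le_one_left (norm_nonneg _) (hcm x)).trans (hterm k x)
    have hci : ∀ k, Integrable (fun x => ((cosMode j x : ℝ) : ℂ) * (cosCoeff ψ k * (cosMode k x : ℂ)))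
        (volume.restrict (Ioo 0 Real.pi)) := fun k =>
      (Continuous.integrableOn_Icc ((Complex.continuous_ofReal.comp (continuous_cosMode j)).mul
        (hcont k))).mono_set Ioo_subset_Icc_self
    have hi := hasSum_integral_of_summable_integral_norm hci (by
      refine Summable.of_nonneg_of_le (fun k => integral_nonneg fun _ => norm_nonneg _) (fun k => ?_)
        (hsum.mul_left Real.pi)
      calc _ ≤ ∫ x in Ioo 0 Real.pi, ‖cosCoeff ψ k‖ :=
            integral_mono (hci k).norm (integrable_const _) (hbd k)
        _ = _ := by simp [Real.pi_pos.le])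
    rw [e]
    refine hi.unique ?_
    have hval : ∀ k, ∫ x in Ioo 0 Real.pi, ((cosMode j x : ℝ) : ℂ) * (cosCoeff ψ k * (cosMode k x : ℂ))
        = if k = j then cosCoeff ψ j else 0 := fun k => by
      have h1 := cosCoeff_cosVec k j
      rw [← inner_cosVec, cosVec, cosVec, inner_ofCont_real _ (continuous_cosMode j)] at h1
      have h2 : ∫ x in Ioo 0 Real.pi, ((cosMode j x : ℝ) : ℂ) * (cosCoeff ψ k * (cosMode k x : ℂ))
          = cosCoeff ψ k * ∫ x in Ioo 0 Real.pi, ((cosMode j x : ℝ) : ℂ) * (ofCont (fun x => (cosMode k x : ℂ))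
            (Complex.continuous_ofReal.comp (continuous_cosMode k))) x := by
        rw [← integral_const_mul]
        refine integral_congr_ae ?_
        filter_upwards [coeFn_ofCont _ (Complex.continuous_ofReal.comp (continuous_cosMode k))]
          with x hx
        have hx' : (ofCont (fun x => (cosMode k x : ℂ))
          (Complex.continuous_ofReal.comp (continuous_cosMode k))) x = (cosMode k x : ℂ) := hx
        rw [hx']; ring
      rw [h2, h1]
      by_cases hjk : j = k
      · subst hjk; simp
      · simp [hjk, Ne.symm hjk]
    simp_rw [hval]
    exact hasSum_ite_eq j _
  obtain ⟨p, hp, hψp, rfl⟩ := hc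
  have hae : p =ᵐ[volume.restrict (Icc 0 Real.pi)] q := by
    rw [← restrict_Ioo_eq_restrict_Icc]
    have := coeFn_ofCont q hqc
    rw [hψq] at this
    exact hψp.symm.trans this
  -- Two functions continuous on `[0, π]` that agree almost everywhere agree at the end point as
  -- well.
  have hp0 : p 0 = q 0 := Measure.eqOn_Icc_of_ae_eq volume Real.pi_pos.ne hae hp hqc.continuousOn
    ⟨le_rfl, Real.pi_pos.le⟩
  rw [hp0]
  refine (hqs 0).congr_fun fun k => ?_
  rw [cosMode_eq]; simp [mul_comm]

end

noncomputable section

/-! ### Existence and uniqueness for the two evolution problems -/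

section Problems

variable {u : ℝ → ℂ} {ζ₀ ζ₁ : H}

/-- A coefficient is a bounded linear functional, so it commutes with the one-sided time derivative;
uniqueness in `H` reduces to that of each scalar oscillator. -/
lemma eqOn_posH_of_cosCoeff_timeDeriv (hu : MemL2Loc u)
    (hζ₀ : Summable fun k : ℕ => ‖k * cosCoeff ζ₀ k‖ ^ 2) {h : ℝ} {z : ℝ → H}
    (hz : ContDiffOn ℝ 1 z (Ici 0)) (h0 : z 0 = ζ₀)
    (hk : ∀ t, 0 ≤ t → ∀ k, cosCoeff (timeDeriv z t) k
      = cosCoeff ζ₁ k - (freq h k : ℂ) ^ 2 * (∫ s in (0 : ℝ)..t, cosCoeff (z s) k)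
        + (-(amp k * tanhc (h * k)) : ℝ) * primitive u t) :
    EqOn z (posH u ζ₀ ζ₁ h) (Ici 0) := by
  intro t ht
  refine ext_cosCoeff fun k => ?_
  rw [cosCoeff_posH hu hζ₀]
  refine eq_oscPos_of_hasDerivWithinAt (continuous_primitive hu) (y := fun t => cosCoeff (z t) k)
    (by rw [h0]) (fun s hs => ?_) ht
  rw [← hk s hs]
  have hd : HasDerivWithinAt z (timeDeriv z s) (Ici 0) s :=
    ((hz.differentiableOn one_ne_zero) s hs).hasDerivWithinAt
  simp only [← inner_cosVec]
  have := ((innerSL ℂ (cosVec k)).restrictScalars ℝ).hasFDerivAt.comp_hasDerivWithinAt s hd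
  exact this

lemma timeDeriv_congr {z z' : ℝ → H} (h : EqOn z z' (Ici 0)) {t : ℝ} (ht : 0 ≤ t) :
    timeDeriv z t = timeDeriv z' t :=
  derivWithin_congr h (h ht)

lemma integral_inner_eq {z : ℝ → H} (hz : Continuous z) (ξ : H) (t : ℝ) :
    ∫ s in (0 : ℝ)..t, inner ℂ ξ (z s) = inner ℂ ξ (∫ s in (0 : ℝ)..t, z s) :=
  (innerSL ℂ ξ).intervalIntegral_comp_comm (hz.intervalIntegrable 0 t)

lemma integral_mul_const_eq {t : ℝ} (ht : 0 ≤ t) (c : ℂ) :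
    ∫ s in (0 : ℝ)..t, u s * c = primitive u t * c := by
  rw [intervalIntegral.integral_mul_const, primitive_eq_intervalIntegral ht]

lemma velCoeff_sub (hu : MemL2Loc u) (h t : ℝ) (k : ℕ) :
    velCoeff u ζ₀ ζ₁ h t k - cosCoeff ζ₁ k
      = -(freq h k : ℂ) ^ 2 * (∫ s in (0 : ℝ)..t, posCoeff u ζ₀ ζ₁ h s k)
        + (-(amp k * tanhc (h * k)) : ℝ) * primitive u t :=
  oscVel_sub (continuous_primitive hu) t

/-- Each term of the weak equation is a series over the modes: the pairing of derivatives by the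
sine coefficients of `dψ`, the boundary term by the cosine series of `ψ` at `0`. The terms match by
the integrated oscillator equation. -/
lemma isWave_posH (hu : MemL2Loc u) (hζ₀ : Summable fun k : ℕ => ‖k * cosCoeff ζ₀ k‖ ^ 2) :
    IsWave u ζ₀ ζ₁ (posH u ζ₀ ζ₁ 0) where
  contDiffOn := (contDiff_posH hu hζ₀ 0).contDiffOn
  init := posH_zero hu hζ₀ 0
  init_deriv := by rw [timeDeriv_posH hu hζ₀ 0 le_rfl, velH_zero hu hζ₀]
  eqn := by
    have hgc : Continuous (gradH u ζ₀ ζ₁) := continuous_gradH hu hζ₀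
    have hTc : Continuous fun t => -cosToSin (gradH u ζ₀ ζ₁ t) := (cosToSin.continuous.comp hgc).neg
    refine ⟨fun t => -cosToSin (gradH u ζ₀ ζ₁ t), hTc.continuousOn, fun t _ => ?_, ?_⟩
    · refine hasWeakDeriv_of_cosCoeff fun k => ?_
      rw [cosCoeff_gradH hu hζ₀, cosCoeff_posH hu hζ₀, Complex.ofReal_natCast]
    intro ψ dψ c hψ hc t ht
    rw [timeDeriv_posH hu hζ₀ 0 ht, ← inner_sub_right, integral_inner_eq hTc,
      integral_mul_const_eq ht, intervalIntegral.integral_neg, inner_neg_right, neg_neg]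
    have hcomm : ∫ s in (0 : ℝ)..t, cosToSin (gradH u ζ₀ ζ₁ s)
        = cosToSin (∫ s in (0 : ℝ)..t, gradH u ζ₀ ζ₁ s) :=
      cosToSin.intervalIntegral_comp_comm (hgc.intervalIntegrable 0 t)
    rw [hcomm]
    have s1 := hasSum_inner_cosCoeff ψ (velH u ζ₀ ζ₁ 0 t - ζ₁)
    have s2 := hasSum_inner_cosToSin dψ (∫ s in (0 : ℝ)..t, gradH u ζ₀ ζ₁ s)
    simp_rw [inner_sinVec_weakDeriv hψ] at s2
    have s2' : HasSum (fun k : ℕ => conj (-(k * cosCoeff ψ k))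
        * cosCoeff (∫ s in (0 : ℝ)..t, gradH u ζ₀ ζ₁ s) k)
        (inner ℂ dψ (cosToSin (∫ s in (0 : ℝ)..t, gradH u ζ₀ ζ₁ s))) := by
      rw [← hasSum_nat_add_iff' 1]
      simpa using s2
    have s3 := ((hasSum_valueAtZero hψ hc).star).mul_left (primitive u t)
    refine s1.unique ((s2'.sub s3).congr_fun fun k => ?_)
    rw [cosCoeff_sub, cosCoeff_velH hu hζ₀, velCoeff_sub hu, cosCoeff_intervalIntegral hgc]
    simp_rw [cosCoeff_gradH hu hζ₀]
    rw [intervalIntegral.integral_const_mul, freq_zero, zero_mul, tanhc_zero]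
    simp only [Complex.star_def, map_mul, map_neg, Complex.conj_ofReal, Complex.conj_natCast]
    push_cast
    ring

/-- Testing with `cosVec k`, whose boundary value is `amp k`, isolates one oscillator. -/
lemma IsWave.eqOn_posH (hu : MemL2Loc u) (hζ₀ : Summable fun k : ℕ => ‖k * cosCoeff ζ₀ k‖ ^ 2)
    {z : ℝ → H} (hz : IsWave u ζ₀ ζ₁ z) : EqOn z (posH u ζ₀ ζ₁ 0) (Ici 0) := by
  refine eqOn_posH_of_cosCoeff_timeDeriv hu hζ₀ hz.contDiffOn hz.init fun t ht k => ?_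
  obtain ⟨zx, -, hzx, heq⟩ := hz.eqn
  have h := heq (cosVec k) _ _ (hasWeakDeriv_cosVec k) (hasValueAtZero_cosVec k) t ht
  rw [inner_cosVec, inner_cosVec, integral_mul_const_eq ht] at h
  have e : ∫ s in (0 : ℝ)..t, inner ℂ (-((k : ℂ) • sinVec k)) (zx s)
      = (k : ℂ) ^ 2 * ∫ s in (0 : ℝ)..t, cosCoeff (z s) k := by
    rw [← intervalIntegral.integral_const_mul]
    refine intervalIntegral.integral_congr fun s hs => ?_
    rw [uIcc_of_le ht] at hs
    simp only [inner_neg_left, inner_smul_left, inner_sinVec_weakDeriv (hzx s hs.1),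
      Complex.conj_natCast]
    ring
  rw [e] at h
  rw [freq_zero, zero_mul, tanhc_zero]
  simp only [Complex.conj_ofReal] at h
  push_cast
  linear_combination h

/-- Only the coefficient relation satisfied by every pair in the closed graph is used, so no
description of the domain of `A_μ` is required. -/
lemma isWaterWave_posH (hu : MemL2Loc u) (hζ₀ : Summable fun k : ℕ => ‖k * cosCoeff ζ₀ k‖ ^ 2)
    {h : ℝ} (hh : 0 < h) : IsWaterWave (h ^ 2) u ζ₀ ζ₁ (posH u ζ₀ ζ₁ h) where
  continuous_half := continuousInSobolev_posH hu hζ₀ h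
  contDiffOn := (contDiff_posH hu hζ₀ h).contDiffOn
  init := posH_zero hu hζ₀ h
  init_deriv := by rw [timeDeriv_posH hu hζ₀ h le_rfl, velH_zero hu hζ₀]
  eqn := by
    obtain ⟨b, hb⟩ := exists_profile_mem_neumannToNeumann hh
    have hpc : Continuous (posH u ζ₀ ζ₁ h) := continuous_posH hu hζ₀ h
    refine ⟨b, hb, fun p hp t ht => ?_⟩
    rw [timeDeriv_posH hu hζ₀ h ht, ← inner_sub_right, integral_inner_eq hpc,
      integral_mul_const_eq ht]
    have s1 := hasSum_inner_cosCoeff p.1 (velH u ζ₀ ζ₁ h t - ζ₁)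
    have s2 := (hasSum_inner_cosCoeff p.2 (∫ s in (0 : ℝ)..t, posH u ζ₀ ζ₁ h s)).mul_left
      (-(1 / ((h ^ 2 : ℝ) : ℂ)))
    have s3 := ((hasSum_inner_cosCoeff p.1 b).mul_left (primitive u t)).mul_left
      (1 / ((h ^ 2 : ℝ) : ℂ))
    refine s1.unique ((s2.add s3).congr_fun fun k => ?_)
    rw [cosCoeff_sub, cosCoeff_velH hu hζ₀, velCoeff_sub hu, cosCoeff_intervalIntegral hpc,
      cosCoeff_of_profile_mem hb, cosCoeff_of_mem_dirichletToNeumann hp]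
    simp_rw [cosCoeff_posH hu hζ₀]
    have hh0 : (h : ℂ) ≠ 0 := by exact_mod_cast hh.ne'
    simp only [map_mul, Complex.conj_ofReal]
    push_cast
    field_simp

/-- Testing with the eigenpairs of `A_μ` isolates one oscillator. -/
lemma IsWaterWave.eqOn_posH (hu : MemL2Loc u)
    (hζ₀ : Summable fun k : ℕ => ‖k * cosCoeff ζ₀ k‖ ^ 2) {h : ℝ} (hh : 0 < h) {z : ℝ → H}
    (hz : IsWaterWave (h ^ 2) u ζ₀ ζ₁ z) : EqOn z (posH u ζ₀ ζ₁ h) (Ici 0) := by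
  refine eqOn_posH_of_cosCoeff_timeDeriv hu hζ₀ hz.contDiffOn hz.init fun t ht k => ?_
  obtain ⟨b, hb, heq⟩ := hz.eqn
  have e := heq _ (cosVec_mem_dirichletToNeumann h k) t ht
  simp only [inner_smul_left, inner_cosVec, Complex.conj_ofReal] at e
  rw [integral_mul_const_eq ht, intervalIntegral.integral_const_mul, cosCoeff_of_profile_mem hb] at e
  have hh0 : (h : ℂ) ≠ 0 := by exact_mod_cast hh.ne'
  push_cast at e ⊢
  field_simp at e
  linear_combination e

end Problems

end

end WaterWaves

/-! ### Well-posedness and the shallow water limit. -/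

theorem theorem1p1 (u : ℝ → ℂ) (hu : WaterWaves.MemL2Loc u)
    (ζ₀ ζ₁ : WaterWaves.H) (hζ₀ : WaterWaves.MemW12 ζ₀) :
    (∀ μ : ℝ, 0 < μ → ∃ z : ℝ → WaterWaves.H, WaterWaves.IsWaterWave μ u ζ₀ ζ₁ z ∧
      ∀ z' : ℝ → WaterWaves.H, WaterWaves.IsWaterWave μ u ζ₀ ζ₁ z' → EqOn z' z (Ici 0)) ∧
    (∃ z : ℝ → WaterWaves.H, WaterWaves.IsWave u ζ₀ ζ₁ z ∧
      ∀ z' : ℝ → WaterWaves.H, WaterWaves.IsWave u ζ₀ ζ₁ z' → EqOn z' z (Ici 0)) ∧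
    ∀ (ζμ : ℝ → ℝ → WaterWaves.H) (ζ : ℝ → WaterWaves.H),
      (∀ μ : ℝ, 0 < μ → WaterWaves.IsWaterWave μ u ζ₀ ζ₁ (ζμ μ)) →
      WaterWaves.IsWave u ζ₀ ζ₁ ζ →
      ∀ τ : ℝ, 0 < τ →
        Tendsto (fun μ : ℝ => ⨆ t ∈ Icc 0 τ, WaterWaves.sobolevENorm (1 / 2) (ζμ μ t - ζ t))
          (𝓝[>] 0) (𝓝 0) ∧
        Tendsto (fun μ : ℝ => ⨆ t ∈ Icc 0 τ,
            ‖WaterWaves.timeDeriv (ζμ μ) t - WaterWaves.timeDeriv ζ t‖ₑ)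
          (𝓝[>] 0) (𝓝 0) := by
  obtain ⟨dζ₀, hdζ₀⟩ := hζ₀
  have hs := WaterWaves.summable_sq_mul_cosCoeff hdζ₀
  refine ⟨fun μ hμ => ⟨WaterWaves.posH u ζ₀ ζ₁ √μ, ?_, fun z' hz' => ?_⟩,
    ⟨WaterWaves.posH u ζ₀ ζ₁ 0, WaterWaves.isWave_posH hu hs,
      fun z' hz' => WaterWaves.IsWave.eqOn_posH hu hs hz'⟩, fun ζμ ζ hζμ hζ τ _ => ?_⟩
  · simpa only [Real.sq_sqrt hμ.le] using
      WaterWaves.isWaterWave_posH (ζ₁ := ζ₁) hu hs (Real.sqrt_pos.2 hμ)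
  · rw [← Real.sq_sqrt hμ.le] at hz'
    exact WaterWaves.IsWaterWave.eqOn_posH hu hs (Real.sqrt_pos.2 hμ) hz'
  -- By uniqueness any given solutions are the explicit ones with `h = √μ`, and `√μ → 0`, so both
  -- limits follow from joint continuity at `h = 0`.
  have hμeq : ∀ μ : ℝ, 0 < μ → EqOn (ζμ μ) (WaterWaves.posH u ζ₀ ζ₁ √μ) (Ici 0) := by
    intro μ hμ
    have h := hζμ μ hμ
    rw [← Real.sq_sqrt hμ.le] at h
    simpa only [Real.sq_sqrt hμ.le] using
      WaterWaves.IsWaterWave.eqOn_posH hu hs (Real.sqrt_pos.2 hμ) h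
  have heq := WaterWaves.IsWave.eqOn_posH hu hs hζ
  have hsqrt : Tendsto (fun μ : ℝ => √μ) (𝓝[>] 0) (𝓝 0) := by
    simpa using (Real.continuous_sqrt.tendsto 0).mono_left nhdsWithin_le_nhds
  constructor
  · refine ((WaterWaves.tendsto_iSup_enorm_sub
      (WaterWaves.continuous_halfH (ζ₁ := ζ₁) hu hs) τ).comp hsqrt).congr' ?_
    filter_upwards [self_mem_nhdsWithin] with μ hμ
    refine iSup_congr fun t => iSup_congr fun ht => ?_
    rw [hμeq μ hμ ht.1, heq ht.1, WaterWaves.sobolevENorm_posH_sub hu hs]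
  · refine ((WaterWaves.tendsto_iSup_enorm_sub
      (WaterWaves.continuous_velH (ζ₁ := ζ₁) hu hs) τ).comp hsqrt).congr' ?_
    filter_upwards [self_mem_nhdsWithin] with μ hμ
    refine iSup_congr fun t => iSup_congr fun ht => ?_
    rw [WaterWaves.timeDeriv_congr (hμeq μ hμ) ht.1, WaterWaves.timeDeriv_congr heq ht.1,
      WaterWaves.timeDeriv_posH hu hs _ ht.1, WaterWaves.timeDeriv_posH hu hs _ ht.1]
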